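/- Let $S^1=\mathbb R/\mathbb Z$ and $T^2=S^1\times S^1$ with coordinates $(x,y)$. A $C^1$ vector field $\partial_y+h\,\partial_x$ on $T^2$ is called a Denjoy vector field if its first return map to the circle $\{y=0\}$ is a Denjoy map, i.e. an orientation preserving homeomorphism of the circle with irrational rotation number and without dense orbits; its Denjoy continuum $\mathfrak D\subset T^2$ is its unique minimal set (nonempty, closed, invariant, with every orbit in $\mathfrak D$ dense in $\mathfrak D$). There exists a Denjoy vector field $\partial_y+h\,\partial_x$ on $T^2$, with Denjoy continuum $\mathfrak D$, such that $h$ is $C^{1+\alpha}$ for all $\alpha\in(0,1)$, $\partial_x h=0$ on $\mathfrak D$, the function $(x,y)\mapsto\int_0^x(\partial_x h(\xi,y))^2\,d\xi$ is $C^2$ on $\mathbb R^2$, and the following holds. Let $(x_0,y_0)\in T^2\setminus\mathfrak D$, let $V$ be a neighborhood of $(x_0,y_0)$ whose closure is disjoint from $\mathfrak D$, let $0<\delta<1$, and let $$N=\{(t,x,y+t)\mid (x,y)\in V,\ t\in[-1,1]\}\ \cup\ \{(t,x,y)\in[-1,1]\times T^2\mid |t|>1-\delta\}.$$ Let $K_0\colon[-1,1]\times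 T^2\to S^1$ be the map $(t,x,y)\mapsto x$. Then for every $\epsilon>0$ there exists a $C^2$-smooth map $K\colon[-1,1]\times T^2\to S^1$ such that the vector field $$v=(\partial_xK)\,\partial_t-(\partial_tK)\,\partial_x+\partial_y$$ on $[-1,1]\times T^2$ satisfies (K1) and (K2), and $K$ satisfies (K3) and (K4): (K1) $v=\partial_y+h\,\partial_x$ (that is, $\partial_xK=0$ and $\partial_tK=-h$) at every point of $\{0\}\times\mathfrak D$; (K2) the $t$-component of $v$ is positive, i.e. $\partial_xK>0$, at every point of $[-1,1]\times T^2$ outside $\{0\}\times\mathfrak D$; (K3) $\operatorname{dist}(K(q),K_0(q))<\epsilon$ for all $q\in[-1,1]\times T^2$; (K4) $K=K_0$ on $N$. -/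

import Mathlib

open Set Topology

/-- The circle `S¹ = ℝ/ℤ`. -/
abbrev S1 : Type := UnitAddCircle

/-- The torus `T² = S¹ × S¹` with coordinates `(x, y)`. -/
abbrev T2 : Type := S1 × S1

/-- The projection of the universal cover `ℝ² → T²`. -/
def toT2 (p : ℝ × ℝ) : T2 := ((p.1 : S1), (p.2 : S1))

/-- A function on `T²` read in the global coordinates `(x, y) ∈ ℝ²`; it is doubly periodic. -/
def onPlane (h : T2 → ℝ) : ℝ × ℝ → ℝ := fun p => h (toT2 p)

/-- `∂ₓ h` at the point of `T²` with coordinates `(x, y)`. -/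
noncomputable def dx (h : T2 → ℝ) (x y : ℝ) : ℝ :=
  deriv (fun ξ => onPlane h (ξ, y)) x

/-- `h` is of class `C^{1+α}` for every `α ∈ (0,1)`. -/
def IsC1AlphaForAll (h : T2 → ℝ) : Prop :=
  ContDiff ℝ 1 (onPlane h) ∧
    ∀ α : NNReal, 0 < α → α < 1 → ∃ C : NNReal, HolderWith C α (fderiv ℝ (onPlane h))

/-- The integral curves of the vector field `∂_y + h ∂_x` on `T²`, parametrized by (a lift of) the
`y`-coordinate: they are the curves `s ↦ (u s, s)` with `u' = h (u, s)`. -/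
def IsSolution (h : T2 → ℝ) (u : ℝ → ℝ) : Prop :=
  ∀ s : ℝ, HasDerivAt u (onPlane h (u s, s)) s

/-- The orbit on `T²` of the integral curve `s ↦ (u s, s)`. -/
def orbitOf (u : ℝ → ℝ) : Set T2 := range fun s : ℝ => toT2 (u s, s)

/-- A Denjoy map, given by its lift `f` to `ℝ`: an orientation preserving circle homeomorphism
with irrational rotation number and without dense orbits. -/
structure IsDenjoyMap (f : CircleDeg1Lift) : Prop where
  strictMono : StrictMono f
  continuous : Continuous f
  irrational : Irrational f.translationNumber
  not_dense : ∀ x : ℝ, ¬ Dense (range fun n : ℕ => ((f^[n] x : ℝ) : S1))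

/-- `∂_y + h ∂_x` is a Denjoy vector field on `T²`: it is `C¹` and its first return map to the
circle `{y = 0}` is a Denjoy map. -/
def IsDenjoyField (h : T2 → ℝ) : Prop :=
  ContDiff ℝ 1 (onPlane h) ∧
    ∃ f : CircleDeg1Lift, IsDenjoyMap f ∧ ∀ u : ℝ → ℝ, IsSolution h u → u 1 = f (u 0)

/-- `D` is a minimal set of the flow of `∂_y + h ∂_x`: nonempty, closed, invariant, and every orbit
in `D` is dense in `D`. A Denjoy vector field has exactly one minimal set, the Denjoy continuum. -/
structure IsMinimalSetOf (h : T2 → ℝ) (D : Set T2) : Prop where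
  nonempty : D.Nonempty
  closed : IsClosed D
  invariant : ∀ u : ℝ → ℝ, IsSolution h u → ∀ s : ℝ, toT2 (u s, s) ∈ D → orbitOf u ⊆ D
  dense : ∀ u : ℝ → ℝ, IsSolution h u → orbitOf u ⊆ D → D ⊆ closure (orbitOf u)

/-- `D` is the Denjoy continuum of the Denjoy vector field `∂_y + h ∂_x`. -/
def IsDenjoyContinuum (h : T2 → ℝ) (D : Set T2) : Prop :=
  IsDenjoyField h ∧ IsMinimalSetOf h D

/-- The manifold with boundary `[-1,1] × T²`, with coordinates `(t, (x, y))`. -/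
abbrev Slab : Type := Icc (-1 : ℝ) 1 × T2

/-- The map `K₀ : (t, x, y) ↦ x`. -/
def K0 (q : Slab) : S1 := q.2.1

/-- `L` is a `C²` lift of `K : [-1,1] × T² → S¹` to the universal covers `[-1,1] × ℝ²` and `ℝ`
(values of `L` outside `[-1,1] × ℝ²` are irrelevant). The map `K` is `C²` iff it has such a lift,
which is then unique up to an additive integer constant; the partial derivatives of `K` are those
of `L`. -/
def IsC2Lift (K : Slab → S1) (L : ℝ × ℝ × ℝ → ℝ) : Prop :=
  ContDiffOn ℝ 2 L (Icc (-1 : ℝ) 1 ×ˢ univ) ∧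
    ∀ (t : Icc (-1 : ℝ) 1) (x y : ℝ), K (t, toT2 (x, y)) = ((L ((t : ℝ), x, y) : ℝ) : S1)

/-- The vector field `v = (∂ₓ K) ∂_t - (∂_t K) ∂_x + ∂_y` on `[-1,1] × T²`, as the triple of its
`(t, x, y)`-components, computed from a lift `L` of `K`. -/
noncomputable def vField (L : ℝ × ℝ × ℝ → ℝ) (t x y : ℝ) : ℝ × ℝ × ℝ :=
  (deriv (fun ξ => L (t, ξ, y)) x,
   - derivWithin (fun τ => L (τ, x, y)) (Icc (-1 : ℝ) 1) t,
   1)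

/-- The tube `{(t, x, y + t) | (x, y) ∈ V, t ∈ [-1,1]}`. -/
def tube (V : Set T2) : Set Slab :=
  {q | ∃ p ∈ V, q.2 = (p.1, p.2 + (((q.1 : ℝ)) : S1))}

/-- The collar `{1 - δ < |t| ≤ 1}` of the boundary of `[-1,1] × T²`. -/
def collar (δ : ℝ) : Set Slab := {q | 1 - δ < |(q.1 : ℝ)|}

/-! The field comes from the linear foliation of slope `√2` by blowing up one orbit into a strip of
gaps. With `s` the time along that orbit, the gap at time `s` has width `w(s) = gapWidth s`, so the
circle at level `y` carries gaps of widths `w(y + n)`, `n ∈ ℤ`. The leaves that are left are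
explicit (`leafL`, `leafR`), their union is the Denjoy continuum `D`, and `h` is a smooth
interpolation, inside the gaps, of the slopes of the leaves.

Everything rests on the choice `w(s) = (G(s + 1) - G(s)) / 2π` with `G = arctan ∘ arsinh`. The sum
over each circle telescopes to `1/2` (`hasSum_gapWidth`); the derivatives of orders one to three are
`O(w / ⟨s⟩)` (`exists_iteratedDeriv_gapWidth_le`); and `1/w = O(⟨s⟩^p)` for every `p > 1`
(`exists_inv_gapWidth_le`), so that `w` is almost as large as summability permits.

The gaps of one level are disjoint. A series over the gaps therefore converges uniformly as soon as
its terms are summable up to an error that is supported in the gap and tends to `0`; that error need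
not be summable. A function with one step per gap loses a factor `1/w` with each derivative. With a
coefficient of size `w / ⟨s⟩` this gives `h` of class `C¹` with `∂ₓh = (w'/w) · bump` in the gaps
and `0` on `D`, and the Hölder bound follows by interpolating between `1/⟨s⟩` and `1/(⟨s⟩ w)`. With
a coefficient of size `w / ⟨s⟩²` the series is `C²`, since `1/(⟨s⟩² w) → 0`. This covers the
primitive of `(∂ₓh)²`, a barrier `B` whose derivative `∂ₓB` vanishes exactly on `D` and dominates
`(∂ₓh)²`, and a flux `H` with `H = 0` and `∂ₜH = h` at `t = 0`. The product `t h` is not known to be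
`C²`, so in the gap at time `s` the factor `t` is replaced by `⟨s⟩⁻¹ sin(⟨s⟩ sin t)`; this changes
`∂ₓ` only by `O(t²)`.

The potential `M = κB + Ct²x - H` then satisfies `∂ₜM = -h` at `t = 0`, and `∂ₓM ≥ (κ/2) ∂ₓB + t²`,
because `|t ∂ₓh| ≤ (κ/2) ∂ₓB + O(t²)` by Young's inequality. Hence `∂ₓM` vanishes exactly on `{0} ×
D` (`exists_isPotential`).

To stay close to `x`, a circle `y = y₀` is cut into short cells with ends off `D`. In a cell that
meets `D` near that level, `K` interpolates between `x` and `midpoint + M`, with `M` small; the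
cutoff rises to the left and falls to the right of `midpoint + M`, so its derivative helps the
monotonicity in `x`. Cells that miss `D` are left alone, which gives `K = K₀` on the tube
(`exists_isLocalShear`). All conditions are convex and pass through a partition of unity in `y`
(`exists_isShear`); a cutoff in `t` finishes the construction. -/

/-! ### Series with an absolutely summable part and a part with disjoint supports -/

section DisjointSeries

open Filter

variable {ι E F : Type*}

/-- At a point lying in at most one of the sets `S n`, the indicator series has at most one term. -/
theorem summable_indicator_of_subsingleton {S : ι → Set E} {g : ι → ℝ} {p : E}
    (hS : ∀ n m, p ∈ S n → p ∈ S m → n = m) :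
    Summable fun n => (S n).indicator (fun _ => g n) p := by
  by_cases h : ∃ n, p ∈ S n
  · obtain ⟨n, hn⟩ := h
    refine summable_of_ne_finset_zero (s := {n}) fun m hm => ?_
    refine indicator_of_notMem (fun hpm => hm ?_) _
    simp [hS m n hpm hn]
  · push Not at h
    convert summable_zero with n
    exact indicator_of_notMem (h n) _

theorem tsum_indicator_le_of_subsingleton {S : ι → Set E} {g : ι → ℝ} {p : E} {ε : ℝ}
    (hε : 0 ≤ ε) (hS : ∀ n m, p ∈ S n → p ∈ S m → n = m) (hg : ∀ n, g n ≤ ε) :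
    ∑' n, (S n).indicator (fun _ => g n) p ≤ ε := by
  by_cases h : ∃ n, p ∈ S n
  · obtain ⟨n, hn⟩ := h
    rw [tsum_eq_single n fun m hm =>
      indicator_of_notMem (fun hpm => hm (hS m n hpm hn)) _, indicator_of_mem hn]
    exact hg n
  · push Not at h
    rw [tsum_congr fun n => indicator_of_notMem (h n) _]
    simpa using hε

variable [NormedAddCommGroup F] [CompleteSpace F]

theorem summable_of_disjoint_bound {f : ι → E → F} {S : ι → Set E} {u g : ι → ℝ} {p : E}
    (hu : Summable u) (hS : ∀ n m, p ∈ S n → p ∈ S m → n = m)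
    (hf : ∀ n, ‖f n p‖ ≤ u n + (S n).indicator (fun _ => g n) p) : Summable fun n => f n p :=
  Summable.of_norm_bounded (hu.add (summable_indicator_of_subsingleton hS)) hf

/-- Beyond a finite set of indices the tail of `u` and every single `g n` are below `ε / 2`; at each
point at most one indicator contributes. Hence `g → 0` suffices, without summability. -/
theorem tendstoUniformlyOn_tsum_of_disjoint {f : ι → E → F} {S : ι → Set E} {u g : ι → ℝ}
    {Ω : Set E} (hu : Summable u) (hg : Tendsto g cofinite (𝓝 0))
    (hS : ∀ p ∈ Ω, ∀ n m, p ∈ S n → p ∈ S m → n = m)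
    (hf : ∀ n, ∀ p ∈ Ω, ‖f n p‖ ≤ u n + (S n).indicator (fun _ => g n) p) :
    TendstoUniformlyOn (fun t : Finset ι => fun p => ∑ n ∈ t, f n p) (fun p => ∑' n, f n p)
      atTop Ω := by
  classical
  refine Metric.tendstoUniformlyOn_iff.2 fun ε hε => ?_
  have h1 := (tendsto_order.1 (tendsto_tsum_compl_atTop_zero u)).2 _ (half_pos hε)
  have h2 : ∀ᶠ n in cofinite, g n < ε / 2 := (tendsto_order.1 hg).2 _ (half_pos hε)
  have h3 : ∀ᶠ t : Finset ι in atTop, ∀ n ∉ t, g n < ε / 2 := by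
    have h2' : {n | ¬ g n < ε / 2}.Finite := h2
    filter_upwards [eventually_ge_atTop h2'.toFinset] with t ht n hn
    by_contra hc
    exact hn (ht ((Set.Finite.mem_toFinset _).2 (by simpa using hc)))
  filter_upwards [h1, h3] with t ht1 ht3 p hp
  have hsum := summable_of_disjoint_bound hu (hS p hp) (fun n => hf n p hp)
  have hind := summable_indicator_of_subsingleton (g := g) (hS p hp)
  rw [dist_eq_norm, ← hsum.sum_add_tsum_subtype_compl t, add_sub_cancel_left]
  have hb : Summable fun n : {n // n ∉ t} =>
      u n + (S n).indicator (fun _ => g n) p := (hu.add hind).subtype _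
  calc ‖∑' n : {n // n ∉ t}, f n p‖
      ≤ ∑' n : {n // n ∉ t}, (u n + (S n).indicator (fun _ => g n) p) :=
        tsum_of_norm_bounded hb.hasSum fun n => hf n p hp
    _ = ∑' n : {n // n ∉ t}, u n + ∑' n : {n // n ∉ t}, (S n).indicator (fun _ => g n) p :=
        (hu.subtype _).tsum_add (hind.subtype _)
    _ < ε / 2 + ε / 2 := by
        refine add_lt_add_of_lt_of_le ht1 ?_
        exact tsum_indicator_le_of_subsingleton (S := fun n : {n // n ∉ t} => S n)
          (g := fun n : {n // n ∉ t} => g n) (half_pos hε).le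
          (fun n m hn hm => Subtype.ext (hS p hp _ _ hn hm)) (fun n => (ht3 n n.2).le)
    _ = ε := by ring

variable [NormedAddCommGroup E] [NormedSpace ℝ E] [NormedSpace ℝ F]

theorem hasFDerivAt_tsum_of_disjoint {f : ι → E → F} {f' : ι → E → E →L[ℝ] F} {S : ι → Set E}
    {u g : ι → ℝ} {Ω : Set E} (hΩ : IsOpen Ω) (hu : Summable u) (hg : Tendsto g cofinite (𝓝 0))
    (hS : ∀ p ∈ Ω, ∀ n m, p ∈ S n → p ∈ S m → n = m)
    (hd : ∀ n, ∀ p ∈ Ω, HasFDerivAt (f n) (f' n p) p)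
    (hf : ∀ n, ∀ p ∈ Ω, ‖f n p‖ ≤ u n + (S n).indicator (fun _ => g n) p)
    (hf' : ∀ n, ∀ p ∈ Ω, ‖f' n p‖ ≤ u n + (S n).indicator (fun _ => g n) p) {p : E} (hp : p ∈ Ω) :
    HasFDerivAt (fun q => ∑' n, f n q) (∑' n, f' n p) p := by
  refine hasFDerivAt_of_tendstoUniformlyOn (f := fun (t : Finset ι) q => ∑ n ∈ t, f n q)
    (f' := fun (t : Finset ι) q => ∑ n ∈ t, f' n q) (g' := fun q => ∑' n, f' n q) hΩ
    (tendstoUniformlyOn_tsum_of_disjoint hu hg hS hf') ?_ ?_ hp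
  · intro t q hq
    exact HasFDerivAt.fun_sum fun n _ => hd n q hq
  · intro q hq
    exact (summable_of_disjoint_bound hu (hS q hq) (fun n => hf n q hq)).hasSum

theorem contDiffOn_one_tsum_of_disjoint {f : ι → E → F} {S : ι → Set E}
    {u g : ι → ℝ} {Ω : Set E} (hΩ : IsOpen Ω) (hu : Summable u) (hg : Tendsto g cofinite (𝓝 0))
    (hS : ∀ p ∈ Ω, ∀ n m, p ∈ S n → p ∈ S m → n = m)
    (hd : ∀ n, ContDiff ℝ 1 (f n))
    (hf : ∀ n, ∀ p ∈ Ω, ‖f n p‖ ≤ u n + (S n).indicator (fun _ => g n) p)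
    (hf' : ∀ n, ∀ p ∈ Ω, ‖fderiv ℝ (f n) p‖ ≤ u n + (S n).indicator (fun _ => g n) p) :
    ContDiffOn ℝ 1 (fun q => ∑' n, f n q) Ω := by
  have hD : ∀ p ∈ Ω, HasFDerivAt (fun q => ∑' n, f n q) (∑' n, fderiv ℝ (f n) p) p := fun p hp =>
    hasFDerivAt_tsum_of_disjoint hΩ hu hg hS
      (fun n q _ => ((hd n).differentiable one_ne_zero q).hasFDerivAt) hf hf' hp
  have hc : ContinuousOn (fun p => ∑' n, fderiv ℝ (f n) p) Ω :=
    (tendstoUniformlyOn_tsum_of_disjoint hu hg hS hf').continuousOn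
      (Frequently.of_forall fun t => continuousOn_finsetSum _ fun n _ =>
        ((hd n).continuous_fderiv one_ne_zero).continuousOn)
  have h01 : (1 : WithTop ℕ∞) = 0 + 1 := by norm_num
  rw [h01, contDiffOn_succ_iff_fderiv_of_isOpen hΩ]
  refine ⟨fun p hp => (hD p hp).differentiableAt.differentiableWithinAt, by simp, ?_⟩
  rw [contDiffOn_zero]
  exact hc.congr fun p hp => (hD p hp).fderiv

theorem contDiffOn_two_tsum_of_disjoint {f : ι → E → F} {S : ι → Set E}
    {u g : ι → ℝ} {Ω : Set E} (hΩ : IsOpen Ω) (hu : Summable u) (hg : Tendsto g cofinite (𝓝 0))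
    (hS : ∀ p ∈ Ω, ∀ n m, p ∈ S n → p ∈ S m → n = m)
    (hd : ∀ n, ContDiff ℝ 2 (f n))
    (hf : ∀ i ≤ 2, ∀ n, ∀ p ∈ Ω,
      ‖iteratedFDeriv ℝ i (f n) p‖ ≤ u n + (S n).indicator (fun _ => g n) p) :
    ContDiffOn ℝ 2 (fun q => ∑' n, f n q) Ω := by
  have h0 : ∀ n, ∀ p ∈ Ω, ‖f n p‖ ≤ u n + (S n).indicator (fun _ => g n) p := fun n p hp => by
    simpa only [norm_iteratedFDeriv_zero] using hf 0 (by norm_num) n p hp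
  have h1 : ∀ n, ∀ p ∈ Ω, ‖fderiv ℝ (f n) p‖ ≤ u n + (S n).indicator (fun _ => g n) p :=
    fun n p hp => by
      simpa only [norm_iteratedFDeriv_one] using hf 1 (by norm_num) n p hp
  have h2 : ∀ n, ∀ p ∈ Ω,
      ‖fderiv ℝ (fderiv ℝ (f n)) p‖ ≤ u n + (S n).indicator (fun _ => g n) p := fun n p hp => by
    rw [← norm_iteratedFDeriv_one, norm_iteratedFDeriv_fderiv]
    exact hf 2 le_rfl n p hp
  have hD : ∀ p ∈ Ω, HasFDerivAt (fun q => ∑' n, f n q) (∑' n, fderiv ℝ (f n) p) p := fun p hp =>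
    hasFDerivAt_tsum_of_disjoint hΩ hu hg hS
      (fun n q _ => ((hd n).differentiable two_ne_zero q).hasFDerivAt) h0 h1 hp
  have h12 : (2 : WithTop ℕ∞) = 1 + 1 := by norm_num
  rw [h12, contDiffOn_succ_iff_fderiv_of_isOpen hΩ]
  refine ⟨fun p hp => (hD p hp).differentiableAt.differentiableWithinAt, by simp, ?_⟩
  refine (contDiffOn_one_tsum_of_disjoint (f := fun n => fderiv ℝ (f n)) hΩ hu hg hS
    (fun n => ?_) h1 h2).congr fun p hp => (hD p hp).fderiv
  exact (hd n).fderiv_right (by norm_num)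

end DisjointSeries

/-! ### The width of the gaps -/

section Width

open Filter Real

/-- The hypothesis says that `log f` is `C`-Lipschitz. It makes `bracket`, `gapDensity` and
`gapWidth` comparable at bounded distances. -/
theorem le_exp_mul_of_abs_deriv_le {f f' : ℝ → ℝ} {C : ℝ} (hf : ∀ s, 0 < f s)
    (hd : ∀ s, HasDerivAt f (f' s) s) (hC : ∀ s, |f' s| ≤ C * f s) (s t : ℝ) :
    f t ≤ exp (C * |t - s|) * f s := by
  have hlog : ∀ x, HasDerivAt (fun x => log (f x)) (f' x / f x) x := fun x =>
    (hd x).log (hf x).ne'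
  have hb : ∀ x ∈ (univ : Set ℝ), ‖f' x / f x‖ ≤ C := fun x _ => by
    rw [norm_eq_abs, abs_div, abs_of_pos (hf x), div_le_iff₀ (hf x)]
    exact hC x
  have := convex_univ.norm_image_sub_le_of_norm_hasDerivWithin_le
    (fun x _ => (hlog x).hasDerivWithinAt) hb (mem_univ s) (mem_univ t)
  rw [norm_eq_abs, norm_eq_abs] at this
  have h2 := (le_abs_self _).trans this
  calc f t = exp (log (f t)) := (exp_log (hf t)).symm
    _ ≤ exp (C * |t - s| + log (f s)) := exp_le_exp.2 (by linarith)
    _ = exp (C * |t - s|) * f s := by rw [exp_add, exp_log (hf s)]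

/-- The Japanese bracket `⟨s⟩ = √(1 + s²)`. -/
noncomputable def bracket (s : ℝ) : ℝ := √(1 + s ^ 2)

theorem bracket_sq (s : ℝ) : bracket s ^ 2 = 1 + s ^ 2 := sq_sqrt (by positivity)

theorem bracket_pos (s : ℝ) : 0 < bracket s := sqrt_pos.2 (by positivity)

theorem one_le_bracket (s : ℝ) : 1 ≤ bracket s := by
  nlinarith [bracket_sq s, bracket_pos s, sq_nonneg s]

theorem abs_le_bracket (s : ℝ) : |s| ≤ bracket s := by
  refine abs_le_of_sq_le_sq ?_ (bracket_pos s).le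
  rw [bracket_sq]; linarith

theorem hasDerivAt_bracket (s : ℝ) : HasDerivAt bracket (s / bracket s) s := by
  have h : HasDerivAt (fun s : ℝ => 1 + s ^ 2) (2 * s) s := by
    simpa using (hasDerivAt_pow 2 s).const_add 1
  refine (h.sqrt (by positivity)).congr_deriv ?_
  rw [mul_div_mul_left _ _ two_ne_zero]; rfl

theorem contDiff_bracket {n : WithTop ℕ∞} : ContDiff ℝ n bracket :=
  ContDiff.sqrt (by fun_prop) fun s => by positivity

theorem bracket_le_exp_mul (s t : ℝ) : bracket t ≤ exp (|t - s|) * bracket s := by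
  have := le_exp_mul_of_abs_deriv_le (C := 1) bracket_pos hasDerivAt_bracket (fun s => ?_) s t
  · simpa using this
  · rw [abs_div, abs_of_pos (bracket_pos s), div_le_iff₀ (bracket_pos s)]
    nlinarith [abs_le_bracket s, one_le_bracket s]

/-- The derivative of `arctan ∘ arsinh`. -/
noncomputable def gapDensity (s : ℝ) : ℝ := (bracket s)⁻¹ * (1 + arsinh s ^ 2)⁻¹

theorem gapDensity_pos (s : ℝ) : 0 < gapDensity s :=
  mul_pos (inv_pos.2 (bracket_pos s)) (by positivity)

theorem hasDerivAt_arctan_arsinh (s : ℝ) :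
    HasDerivAt (fun s => arctan (arsinh s)) (gapDensity s) s := by
  convert (hasDerivAt_arsinh s).arctan using 1
  rw [gapDensity, bracket]; field_simp

theorem contDiff_gapDensity {n : WithTop ℕ∞} : ContDiff ℝ n gapDensity :=
  (contDiff_bracket.inv fun s => (bracket_pos s).ne').mul
    (((contDiff_const.add (contDiff_arsinh.pow 2))).inv fun s => by positivity)

/-- Minus the logarithmic derivative of `gapDensity`. -/
noncomputable def gapDecay (s : ℝ) : ℝ :=
  s / bracket s ^ 2 + 2 * arsinh s / ((1 + arsinh s ^ 2) * bracket s)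

theorem hasDerivAt_gapDensity (s : ℝ) :
    HasDerivAt gapDensity (-gapDecay s * gapDensity s) s := by
  have h1 := (hasDerivAt_bracket s).inv (bracket_pos s).ne'
  have h2 : HasDerivAt (fun s => (1 + arsinh s ^ 2)⁻¹)
      (-(2 * arsinh s * (bracket s)⁻¹) / (1 + arsinh s ^ 2) ^ 2) s := by
    have := ((hasDerivAt_arsinh s).fun_pow 2).const_add 1
    refine (this.fun_inv (by positivity)).congr_deriv ?_
    simp [bracket]
  refine (h1.mul h2).congr_deriv ?_
  have hb := (bracket_pos s).ne'
  have hA : (1 + arsinh s ^ 2) ≠ 0 := by positivity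
  simp only [gapDecay, gapDensity, Pi.inv_apply]
  field_simp
  ring

theorem abs_div_one_add_sq_le (A : ℝ) : |2 * A / (1 + A ^ 2)| ≤ 1 := by
  rw [abs_div, abs_of_pos (show 0 < 1 + A ^ 2 by positivity), div_le_one (by positivity), abs_le]
  constructor <;> nlinarith [sq_nonneg (A + 1), sq_nonneg (A - 1)]

theorem abs_gapDecay_le (s : ℝ) : |gapDecay s| ≤ 2 / bracket s := by
  have hb := bracket_pos s
  have h1 : |s / bracket s ^ 2| ≤ 1 / bracket s := by
    rw [abs_div, abs_of_pos (by positivity : 0 < bracket s ^ 2), div_le_div_iff₀ (by positivity) hb]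
    nlinarith [abs_le_bracket s]
  have h2 : |2 * arsinh s / ((1 + arsinh s ^ 2) * bracket s)| ≤ 1 / bracket s := by
    rw [← div_div, abs_div, abs_of_pos hb]
    gcongr
    exact abs_div_one_add_sq_le _
  calc _ ≤ _ := abs_add_le _ _
    _ ≤ 1 / bracket s + 1 / bracket s := add_le_add h1 h2
    _ = _ := by ring

/-- Only one power of `bracket s` is needed from the second derivative of `gapDensity`, so crude
bounds on each factor do. -/
theorem exists_hasDerivAt_gapDecay (s : ℝ) :
    ∃ q, HasDerivAt gapDecay q s ∧ |q| ≤ 4 / bracket s := by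
  have hb := bracket_pos s
  have hb1 := one_le_bracket s
  set A := arsinh s with hA
  have h1 : HasDerivAt (fun s : ℝ => s / bracket s ^ 2) ((1 - s ^ 2) / (bracket s ^ 2) ^ 2) s := by
    have : HasDerivAt (fun s : ℝ => bracket s ^ 2) (2 * s) s := by
      simp_rw [bracket_sq]
      simpa using (hasDerivAt_pow 2 s).const_add 1
    refine ((hasDerivAt_id s).fun_div this (by positivity)).congr_deriv ?_
    rw [bracket_sq]; simp; ring
  have h2 : HasDerivAt (fun s : ℝ => 2 * arsinh s / (1 + arsinh s ^ 2))
      (2 * (1 - A ^ 2) / (1 + A ^ 2) ^ 2 * (bracket s)⁻¹) s := by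
    have h0 : HasDerivAt arsinh (bracket s)⁻¹ s := hasDerivAt_arsinh s
    refine ((h0.const_mul 2).fun_div ((h0.fun_pow 2).const_add 1) (by positivity)).congr_deriv ?_
    simp only [← hA, Nat.cast_ofNat, Nat.add_one_sub_one, pow_one]
    field_simp
    ring
  have h3 : HasDerivAt gapDecay ((1 - s ^ 2) / (bracket s ^ 2) ^ 2 +
      ((2 * (1 - A ^ 2) / (1 + A ^ 2) ^ 2 * (bracket s)⁻¹) * bracket s -
        (2 * A / (1 + A ^ 2)) * (s / bracket s)) / bracket s ^ 2) s := by
    have := h1.add (h2.div (hasDerivAt_bracket s) hb.ne')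
    refine this.congr_of_eventuallyEq (Eventually.of_forall fun x => ?_)
    simp [gapDecay, div_div]
  refine ⟨_, h3, ?_⟩
  have e1 : |(1 - s ^ 2) / (bracket s ^ 2) ^ 2| ≤ 1 / bracket s := by
    rw [abs_div, abs_of_pos (by positivity : 0 < (bracket s ^ 2) ^ 2),
      div_le_div_iff₀ (by positivity) hb]
    have : |1 - s ^ 2| ≤ bracket s ^ 2 := by
      rw [bracket_sq, abs_le]; constructor <;> nlinarith [sq_nonneg s]
    calc |1 - s ^ 2| * bracket s ≤ bracket s ^ 2 * bracket s ^ 2 := by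
          refine mul_le_mul this ?_ hb.le (by positivity)
          nlinarith
      _ = _ := by ring
  have e2 : |2 * (1 - A ^ 2) / (1 + A ^ 2) ^ 2| ≤ 2 := by
    rw [abs_div, abs_of_pos (by positivity : 0 < (1 + A ^ 2) ^ 2), div_le_iff₀ (by positivity),
      abs_le]
    constructor <;> nlinarith [sq_nonneg A, sq_nonneg (A ^ 2)]
  have e3 : |(2 * A / (1 + A ^ 2)) * (s / bracket s)| ≤ 1 := by
    rw [abs_mul]
    refine mul_le_one₀ (abs_div_one_add_sq_le A) (abs_nonneg _) ?_
    rw [abs_div, abs_of_pos hb, div_le_one hb]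
    exact abs_le_bracket s
  rw [mul_assoc, inv_mul_cancel₀ hb.ne', mul_one]
  have e4 : |(2 * (1 - A ^ 2) / (1 + A ^ 2) ^ 2 - 2 * A / (1 + A ^ 2) * (s / bracket s)) /
      bracket s ^ 2| ≤ 3 / bracket s := by
    rw [abs_div, abs_of_pos (by positivity : 0 < bracket s ^ 2)]
    have : |2 * (1 - A ^ 2) / (1 + A ^ 2) ^ 2 - 2 * A / (1 + A ^ 2) * (s / bracket s)| ≤ 3 :=
      (abs_sub _ _).trans (by linarith)
    calc _ ≤ 3 / bracket s ^ 2 := by gcongr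
      _ ≤ 3 / bracket s := by gcongr; nlinarith
  calc _ ≤ _ := abs_add_le _ _
    _ ≤ 1 / bracket s + 3 / bracket s := add_le_add e1 e4
    _ = _ := by ring

theorem abs_deriv_gapDensity_le (s : ℝ) :
    |deriv gapDensity s| ≤ 2 * gapDensity s / bracket s := by
  rw [(hasDerivAt_gapDensity s).deriv, abs_mul, abs_neg, abs_of_pos (gapDensity_pos s)]
  calc _ ≤ 2 / bracket s * gapDensity s := by
        gcongr
        · exact (gapDensity_pos s).le
        · exact abs_gapDecay_le s
    _ = _ := by ring

theorem abs_deriv_deriv_gapDensity_le (s : ℝ) :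
    |deriv (deriv gapDensity) s| ≤ 8 * gapDensity s / bracket s := by
  obtain ⟨q, hq, hqb⟩ := exists_hasDerivAt_gapDecay s
  have h : deriv gapDensity = fun s => -gapDecay s * gapDensity s :=
    funext fun s => (hasDerivAt_gapDensity s).deriv
  have hb := bracket_pos s
  have hg := gapDensity_pos s
  rw [h, (hq.fun_neg.fun_mul (hasDerivAt_gapDensity s)).deriv]
  have e : -q * gapDensity s + -gapDecay s * (-gapDecay s * gapDensity s) =
      (-q + gapDecay s ^ 2) * gapDensity s := by ring
  rw [e]
  rw [abs_mul, abs_of_pos hg]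
  have h2 : |gapDecay s ^ 2| ≤ 4 / bracket s := by
    rw [abs_pow]
    calc |gapDecay s| ^ 2 ≤ (2 / bracket s) ^ 2 := by
          gcongr; exact abs_gapDecay_le s
      _ = 4 / bracket s / bracket s := by ring
      _ ≤ 4 / bracket s := div_le_self (by positivity) (one_le_bracket s)
  calc _ ≤ (4 / bracket s + 4 / bracket s) * gapDensity s := by
        gcongr
        refine (abs_add_le _ _).trans (add_le_add ?_ h2)
        rwa [abs_neg]
    _ = _ := by ring

theorem gapDensity_le_exp_mul (s t : ℝ) :
    gapDensity t ≤ exp (2 * |t - s|) * gapDensity s := by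
  refine le_exp_mul_of_abs_deriv_le gapDensity_pos hasDerivAt_gapDensity (fun x => ?_) s t
  rw [← (hasDerivAt_gapDensity x).deriv]
  refine (abs_deriv_gapDensity_le x).trans (div_le_self ?_ (one_le_bracket x))
  have := gapDensity_pos x
  positivity

/-- The width at time `s` of the strip of gaps: the total width of the gaps on a circle is `1/2`. -/
noncomputable def gapWidth (s : ℝ) : ℝ :=
  (2 * π)⁻¹ * (arctan (arsinh (s + 1)) - arctan (arsinh s))

theorem contDiff_gapWidth {n : ℕ∞} : ContDiff ℝ n gapWidth := by
  unfold gapWidth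
  refine contDiff_const.mul (ContDiff.sub ?_ ?_)
  · exact ((contDiff_id.add contDiff_const).arsinh).arctan
  · exact contDiff_arsinh.arctan

/-- The sum telescopes between the limits `±π/2` of `arctan ∘ arsinh`. That the total is independent
of `y` is what allows the blown-up circles to keep length one, and it makes the derivatives of the
widths sum to zero. -/
theorem hasSum_gapWidth (y : ℝ) : HasSum (fun n : ℤ => gapWidth (y + n)) (1 / 2) := by
  set G : ℝ → ℝ := fun s => arctan (arsinh s)
  have hmono : Monotone G := fun a b h => arctan_strictMono.monotone (arsinh_le_arsinh.2 h)
  have htop : Tendsto (fun n : ℕ => G (y + n)) atTop (𝓝 (π / 2)) := by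
    have h1 : Tendsto (fun n : ℕ => y + (n : ℝ)) atTop atTop :=
      tendsto_atTop_add_const_left _ _ tendsto_natCast_atTop_atTop
    have h2 : Tendsto arsinh atTop atTop := sinhOrderIso.symm.tendsto_atTop
    exact (tendsto_nhds_of_tendsto_nhdsWithin tendsto_arctan_atTop).comp (h2.comp h1)
  have hbot : Tendsto (fun n : ℕ => G (y - n)) atTop (𝓝 (-(π / 2))) := by
    have h1 : Tendsto (fun n : ℕ => y - (n : ℝ)) atTop atBot :=
      tendsto_atBot_add_const_left _ _ (tendsto_neg_atTop_atBot.comp tendsto_natCast_atTop_atTop)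
    have h2 : Tendsto arsinh atBot atBot := sinhOrderIso.symm.tendsto_atBot
    exact (tendsto_nhds_of_tendsto_nhdsWithin tendsto_arctan_atBot).comp (h2.comp h1)
  have hp : HasSum (fun n : ℕ => G (y + n + 1) - G (y + n)) (π / 2 - G y) := by
    rw [hasSum_iff_tendsto_nat_of_nonneg fun n => sub_nonneg.2 (hmono (by linarith))]
    have : ∀ N : ℕ, ∑ n ∈ Finset.range N, (G (y + n + 1) - G (y + n)) = G (y + N) - G y := by
      intro N
      have := Finset.sum_range_sub (fun n : ℕ => G (y + n)) N
      simpa [add_assoc] using this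
    simp_rw [this]
    exact htop.sub_const _
  have hn : HasSum (fun n : ℕ => G (y + (-((n : ℤ) + 1) : ℤ) + 1) - G (y + (-((n : ℤ) + 1) : ℤ)))
      (G y - -(π / 2)) := by
    rw [hasSum_iff_tendsto_nat_of_nonneg fun n => sub_nonneg.2 (hmono (by linarith))]
    have : ∀ N : ℕ, ∑ n ∈ Finset.range N, (G (y + (-((n : ℤ) + 1) : ℤ) + 1) -
        G (y + (-((n : ℤ) + 1) : ℤ))) = G y - G (y - N) := by
      intro N
      have := Finset.sum_range_sub' (fun n : ℕ => G (y - n)) N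
      simp only [Nat.cast_zero, sub_zero] at this
      rw [← this]
      refine Finset.sum_congr rfl fun n _ => ?_
      push_cast
      congr 2 <;> ring
    simp_rw [this]
    exact hbot.const_sub _
  have := (HasSum.of_nat_of_neg_add_one (f := fun n : ℤ => G (y + n + 1) - G (y + n))
    (by simpa using hp) hn).mul_left (2 * π)⁻¹
  have e : (2 * π)⁻¹ * (π / 2 - G y + (G y - -(π / 2))) = 1 / 2 := by
    have := pi_ne_zero
    rw [show π / 2 - G y + (G y - -(π / 2)) = π by ring]
    field_simp
  rwa [e] at this

theorem exists_gapWidth_eq (s : ℝ) :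
    ∃ ξ ∈ Ioo s (s + 1), gapWidth s = (2 * π)⁻¹ * gapDensity ξ := by
  obtain ⟨ξ, hξ, h⟩ := exists_hasDerivAt_eq_slope (fun s => arctan (arsinh s)) gapDensity
    (lt_add_one s) (fun x _ => (hasDerivAt_arctan_arsinh x).continuousAt.continuousWithinAt)
    (fun x _ => hasDerivAt_arctan_arsinh x)
  exact ⟨ξ, hξ, by rw [h, gapWidth]; simp⟩

theorem gapWidth_pos (s : ℝ) : 0 < gapWidth s := by
  obtain ⟨ξ, -, h⟩ := exists_gapWidth_eq s
  rw [h]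
  exact mul_pos (by positivity) (gapDensity_pos ξ)

theorem gapWidth_le_half (s : ℝ) : gapWidth s ≤ 1 / 2 := by
  simpa using le_hasSum (hasSum_gapWidth s) 0 fun n _ => (gapWidth_pos _).le

/-- The width is a mean of the density over `[s, s + 1]`, and the density changes at most by a
bounded factor there. -/
theorem gapDensity_le_gapWidth {s t : ℝ} (ht : t ∈ Icc s (s + 1)) :
    gapDensity t ≤ 2 * π * exp 2 * gapWidth s := by
  obtain ⟨ξ, hξ, h⟩ := exists_gapWidth_eq s
  rw [h]
  have h1 : |t - ξ| ≤ 1 := by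
    rw [abs_le]; constructor <;> linarith [ht.1, ht.2, hξ.1, hξ.2]
  calc gapDensity t ≤ exp (2 * |t - ξ|) * gapDensity ξ := gapDensity_le_exp_mul ξ t
    _ ≤ exp 2 * gapDensity ξ := by
        have := (gapDensity_pos ξ).le
        gcongr; linarith
    _ = _ := by field_simp

theorem gapDensity_div_bracket_le {s t : ℝ} (ht : t ∈ Icc s (s + 1)) :
    gapDensity t / bracket t ≤ 2 * π * exp 3 * (gapWidth s / bracket s) := by
  have hb : bracket s ≤ exp 1 * bracket t := by
    refine (bracket_le_exp_mul t s).trans ?_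
    have := (bracket_pos t).le
    gcongr
    rw [abs_le]; constructor <;> linarith [ht.1, ht.2]
  have hs := bracket_pos s
  have hw := gapWidth_pos s
  have e3 : exp 3 = exp 2 * exp 1 := by rw [← exp_add]; norm_num
  rw [div_le_iff₀ (bracket_pos t), e3]
  calc gapDensity t ≤ 2 * π * exp 2 * gapWidth s := gapDensity_le_gapWidth ht
    _ = 2 * π * exp 2 * (gapWidth s / bracket s) * bracket s := by field_simp
    _ ≤ 2 * π * exp 2 * (gapWidth s / bracket s) * (exp 1 * bracket t) := by gcongr
    _ = _ := by ring

theorem hasDerivAt_gapWidth (s : ℝ) :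
    HasDerivAt gapWidth ((2 * π)⁻¹ * (gapDensity (s + 1) - gapDensity s)) s :=
  (((hasDerivAt_arctan_arsinh (s + 1)).comp_add_const s 1).sub
    (hasDerivAt_arctan_arsinh s)).const_mul _

theorem iteratedDeriv_succ_gapWidth (i : ℕ) (s : ℝ) :
    iteratedDeriv (i + 1) gapWidth s =
      (2 * π)⁻¹ * (iteratedDeriv i gapDensity (s + 1) - iteratedDeriv i gapDensity s) := by
  have h : ∀ k, ContDiff ℝ k gapDensity := fun k => contDiff_gapDensity
  induction i generalizing s with
  | zero => simpa using (hasDerivAt_gapWidth s).deriv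
  | succ i ih =>
    rw [iteratedDeriv_succ, funext ih]
    have hd : ∀ x, HasDerivAt (iteratedDeriv i gapDensity) (iteratedDeriv (i + 1) gapDensity x) x :=
      fun x => by
        rw [iteratedDeriv_succ]
        exact (((h (i + 1)).differentiable_iteratedDeriv i (by exact_mod_cast i.lt_succ_self))
          x).hasDerivAt
    exact ((((hd (s + 1)).comp_add_const s 1).sub (hd s)).const_mul _).deriv

/-- The basic estimate: differentiation gains `1 / bracket s` once, since each derivative of the
width is a difference of derivatives of the density. Order three is needed for the derivative of
`deriv (deriv gapWidth)`, a coefficient in the differential of the field. -/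
theorem exists_iteratedDeriv_gapWidth_le : ∃ C, 0 < C ∧ ∀ s, ∀ i, 1 ≤ i → i ≤ 3 →
    |iteratedDeriv i gapWidth s| ≤ C * (gapWidth s / bracket s) := by
  refine ⟨16 * exp 3, by positivity, fun s i hi1 hi3 => ?_⟩
  have hpos : 0 < gapWidth s / bracket s := div_pos (gapWidth_pos s) (bracket_pos s)
  have key : ∀ (f : ℝ → ℝ), (∀ x, |f x| ≤ 8 * gapDensity x / bracket x) →
      (2 * π)⁻¹ * |f (s + 1) - f s| ≤ 16 * exp 3 * (gapWidth s / bracket s) := by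
    intro f hf
    have h1 := (hf (s + 1)).trans_eq (mul_div_assoc _ _ _)
    have h2 := (hf s).trans_eq (mul_div_assoc _ _ _)
    have h3 := gapDensity_div_bracket_le (right_mem_Icc.2 (lt_add_one s).le)
    have h4 := gapDensity_div_bracket_le (left_mem_Icc.2 (lt_add_one s).le)
    have h5 := (abs_sub (f (s + 1)) (f s))
    rw [inv_mul_le_iff₀ (by positivity)]
    nlinarith
  obtain ⟨j, rfl⟩ : ∃ j, i = j + 1 := ⟨i - 1, by omega⟩
  rw [iteratedDeriv_succ_gapWidth, abs_mul, abs_of_pos (by positivity : 0 < (2 * π)⁻¹)]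
  have hj : j = 0 ∨ j = 1 ∨ j = 2 := by omega
  -- For the first derivative the gain comes from the mean value theorem; in the higher ones
  -- `gapDensity` has already been differentiated and the triangle inequality suffices.
  rcases hj with rfl | rfl | rfl
  · simp only [iteratedDeriv_zero]
    obtain ⟨ξ, hξ, h⟩ := exists_hasDerivAt_eq_slope gapDensity (deriv gapDensity)
      (lt_add_one s) (fun x _ => (hasDerivAt_gapDensity x).continuousAt.continuousWithinAt)
      (fun x _ => (hasDerivAt_gapDensity x).differentiableAt.hasDerivAt)
    rw [add_sub_cancel_left, div_one] at h
    rw [← h, inv_mul_le_iff₀ (by positivity)]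
    have h1 := (abs_deriv_gapDensity_le ξ).trans_eq (mul_div_assoc _ _ _)
    have h2 := gapDensity_div_bracket_le (Ioo_subset_Icc_self hξ)
    nlinarith [mul_pos (mul_pos pi_pos (exp_pos 3)) hpos]
  · refine key _ fun x => ?_
    rw [iteratedDeriv_one]
    refine (abs_deriv_gapDensity_le x).trans ?_
    have := gapDensity_pos x
    have := bracket_pos x
    gcongr; norm_num
  · refine key _ fun x => ?_
    rw [iteratedDeriv_succ, iteratedDeriv_one]
    exact abs_deriv_deriv_gapDensity_le x

theorem exists_gapWidth_le_exp_mul :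
    ∃ C, 0 < C ∧ ∀ s t, gapWidth t ≤ exp (C * |t - s|) * gapWidth s := by
  obtain ⟨C, hC, h⟩ := exists_iteratedDeriv_gapWidth_le
  refine ⟨C, hC, fun s t => le_exp_mul_of_abs_deriv_le gapWidth_pos
    (fun s => (hasDerivAt_gapWidth s).differentiableAt.hasDerivAt) (fun x => ?_) s t⟩
  have := h x 1 le_rfl (by norm_num)
  rw [iteratedDeriv_one] at this
  refine this.trans ?_
  gcongr
  exact div_le_self (gapWidth_pos x).le (one_le_bracket x)

theorem exp_abs_arsinh_le (s : ℝ) : exp |arsinh s| ≤ 2 * bracket s := by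
  have h := abs_le_bracket s
  rcases abs_cases (arsinh s) with ⟨h1, -⟩ | ⟨h1, -⟩ <;> rw [h1]
  · rw [exp_arsinh]
    have := le_abs_self s
    unfold bracket at *
    linarith
  · rw [← arsinh_neg, exp_arsinh, neg_sq]
    have := neg_abs_le s
    unfold bracket at *
    linarith

/-- The inverse density is `bracket s * (1 + arsinh s ^ 2)`, and the squared logarithm is absorbed
by the power `p - 1` of the bracket. This lower bound on the widths gives both the `C²` sums and the
Hölder exponents. -/
theorem exists_inv_gapWidth_le {p : ℝ} (hp : 1 < p) :
    ∃ C, 0 < C ∧ ∀ s, (gapWidth s)⁻¹ ≤ C * bracket s ^ p := by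
  -- Half of the spare exponent, because `arsinh` enters squared.
  set ε := (p - 1) / 2 with hε
  have hε0 : 0 < ε := by linarith
  refine ⟨2 * π * exp 2 * (1 + ε⁻¹ ^ 2 * 2 ^ (p - 1)), by positivity, fun s => ?_⟩
  have hb := bracket_pos s
  have hw := gapWidth_pos s
  have h1 : |arsinh s| ≤ ε⁻¹ * (2 * bracket s) ^ ε := by
    rw [← div_eq_inv_mul, le_div_iff₀ hε0]
    calc |arsinh s| * ε ≤ exp (|arsinh s| * ε) := by
          linarith [add_one_le_exp (|arsinh s| * ε)]
      _ = exp |arsinh s| ^ ε := exp_mul _ _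
      _ ≤ _ := by gcongr; exact exp_abs_arsinh_le s
  have h2 : arsinh s ^ 2 ≤ ε⁻¹ ^ 2 * 2 ^ (p - 1) * bracket s ^ (p - 1) := by
    rw [← sq_abs]
    calc |arsinh s| ^ 2 ≤ (ε⁻¹ * (2 * bracket s) ^ ε) ^ 2 := by gcongr
      _ = ε⁻¹ ^ 2 * (2 * bracket s) ^ (p - 1) := by
          rw [mul_pow, ← rpow_natCast (_ ^ ε), ← rpow_mul (by positivity)]
          congr 2
          rw [hε]; push_cast; ring
      _ = _ := by rw [mul_rpow (by norm_num) hb.le]; ring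
  have h3 : 1 ≤ bracket s ^ (p - 1) := one_le_rpow (one_le_bracket s) (by linarith)
  have h4 : (gapDensity s)⁻¹ ≤ (1 + ε⁻¹ ^ 2 * 2 ^ (p - 1)) * bracket s ^ p := by
    rw [gapDensity, mul_inv, inv_inv, inv_inv]
    calc bracket s * (1 + arsinh s ^ 2)
        ≤ bracket s * ((1 + ε⁻¹ ^ 2 * 2 ^ (p - 1)) * bracket s ^ (p - 1)) := by
          gcongr; linarith
      _ = (1 + ε⁻¹ ^ 2 * 2 ^ (p - 1)) * (bracket s ^ (p - 1) * bracket s) := by ring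
      _ = _ := by rw [← rpow_add_one hb.ne']; ring_nf
  have h5 := gapDensity_le_gapWidth (left_mem_Icc.2 (lt_add_one s).le)
  have h6 : (gapWidth s)⁻¹ ≤ 2 * π * exp 2 * (gapDensity s)⁻¹ := by
    have := gapDensity_pos s
    rw [← div_eq_mul_inv, le_div_iff₀ this, inv_mul_le_iff₀ hw]
    linarith
  calc _ ≤ _ := h6
    _ ≤ 2 * π * exp 2 * ((1 + ε⁻¹ ^ 2 * 2 ^ (p - 1)) * bracket s ^ p) := by gcongr
    _ = _ := by ring

end Width

/-! ### The blown-up linear foliation -/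

section BlowUp

open Filter Real

theorem exists_shift_iteratedDeriv_gapWidth_le (R : ℝ) : ∃ C, 0 < C ∧ ∀ y, |y| ≤ R → ∀ n : ℤ,
    ∀ i ≤ 3, |iteratedDeriv i gapWidth (y + n)| ≤ C * gapWidth n := by
  obtain ⟨C, hC, h⟩ := exists_iteratedDeriv_gapWidth_le
  obtain ⟨C', hC', h'⟩ := exists_gapWidth_le_exp_mul
  refine ⟨(1 + C) * exp (C' * R), by positivity, fun y hy n i hi => ?_⟩
  have h1 : |iteratedDeriv i gapWidth (y + n)| ≤ (1 + C) * gapWidth (y + n) := by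
    have hw := gapWidth_pos (y + n)
    rcases Nat.eq_zero_or_pos i with rfl | hi0
    · rw [iteratedDeriv_zero, abs_of_pos hw]; nlinarith
    · have := div_le_self hw.le (one_le_bracket (y + n))
      refine (h _ i hi0 hi).trans ?_
      nlinarith
  have h2 : gapWidth (y + n) ≤ exp (C' * R) * gapWidth n := by
    refine (h' n (y + n)).trans ?_
    have := (gapWidth_pos n).le
    gcongr
    simpa using hy
  calc _ ≤ _ := h1
    _ ≤ (1 + C) * (exp (C' * R) * gapWidth n) := by gcongr
    _ = _ := by ring

theorem summable_gapWidth_int : Summable fun n : ℤ => gapWidth n := by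
  simpa using (hasSum_gapWidth 0).summable

/-- The sum over the gaps at level `y` of the `k`-th derivatives of the widths, with
coefficients `e`. -/
noncomputable def gapSeries (k : ℕ) (e : ℤ → ℝ) (y : ℝ) : ℝ :=
  ∑' n : ℤ, e n * iteratedDeriv k gapWidth (y + n)

theorem exists_abs_iteratedDeriv_gapWidth_le :
    ∃ C, 0 < C ∧ ∀ s, ∀ i ≤ 3, |iteratedDeriv i gapWidth s| ≤ C * gapWidth s := by
  obtain ⟨C, hC, h⟩ := exists_iteratedDeriv_gapWidth_le
  refine ⟨1 + C, by positivity, fun s i hi => ?_⟩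
  have hw := gapWidth_pos s
  rcases Nat.eq_zero_or_pos i with rfl | hi0
  · rw [iteratedDeriv_zero, abs_of_pos hw]; nlinarith
  · have := div_le_self hw.le (one_le_bracket s)
    refine (h _ i hi0 hi).trans ?_
    nlinarith

theorem abs_mul_le_of_abs_le_one {a b c : ℝ} (ha : |a| ≤ 1) (hb : |b| ≤ c) : |a * b| ≤ c := by
  rw [abs_mul]
  exact (mul_le_of_le_one_left (abs_nonneg _) ha).trans hb

theorem summable_gapSeries {k : ℕ} (hk : k ≤ 3) {e : ℤ → ℝ} (he : ∀ n, |e n| ≤ 1) (y : ℝ) :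
    Summable fun n : ℤ => e n * iteratedDeriv k gapWidth (y + n) := by
  obtain ⟨C, hC, h⟩ := exists_abs_iteratedDeriv_gapWidth_le
  refine Summable.of_norm_bounded ((hasSum_gapWidth y).summable.mul_left C) fun n => ?_
  exact abs_mul_le_of_abs_le_one (he n) (h _ k hk)

theorem exists_abs_gapSeries_le : ∃ C, 0 < C ∧ ∀ k ≤ 3, ∀ e : ℤ → ℝ, (∀ n, |e n| ≤ 1) → ∀ y,
    |gapSeries k e y| ≤ C := by
  obtain ⟨C, hC, h⟩ := exists_abs_iteratedDeriv_gapWidth_le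
  refine ⟨C * (1 / 2), by positivity, fun k hk e he y => ?_⟩
  rw [← norm_eq_abs]
  refine tsum_of_norm_bounded ((hasSum_gapWidth y).mul_left C) fun n => ?_
  exact abs_mul_le_of_abs_le_one (he n) (h _ k hk)

theorem hasDerivAt_iteratedDeriv_gapWidth (k : ℕ) (s : ℝ) :
    HasDerivAt (iteratedDeriv k gapWidth) (iteratedDeriv (k + 1) gapWidth s) s := by
  have h : ContDiff ℝ (k + 1 : ℕ) gapWidth := contDiff_gapWidth (n := (k + 1 : ℕ))
  rw [iteratedDeriv_succ]
  exact ((h.differentiable_iteratedDeriv k (by exact_mod_cast k.lt_succ_self)) s).hasDerivAt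

theorem hasDerivAt_gapSeries {k : ℕ} (hk : k ≤ 2) {e : ℤ → ℝ} (he : ∀ n, |e n| ≤ 1) (y : ℝ) :
    HasDerivAt (gapSeries k e) (gapSeries (k + 1) e y) y := by
  obtain ⟨C, hC, h⟩ := exists_shift_iteratedDeriv_gapWidth_le (|y| + 1)
  have hd : ∀ n : ℤ, ∀ x : ℝ, HasDerivAt (fun y => e n * iteratedDeriv k gapWidth (y + n))
      (e n * iteratedDeriv (k + 1) gapWidth (x + n)) x := fun n x =>
    ((hasDerivAt_iteratedDeriv_gapWidth k (x + n)).comp_add_const x n).const_mul _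
  refine hasDerivAt_tsum_of_isPreconnected (u := fun n : ℤ => C * gapWidth n)
    (summable_gapWidth_int.mul_left C) Metric.isOpen_ball
    (convex_ball y (1 : ℝ)).isPreconnected (fun n x _ => hd n x) (fun n x hx => ?_)
    (Metric.mem_ball_self one_pos) (summable_gapSeries (by omega) he y)
    (Metric.mem_ball_self one_pos)
  refine abs_mul_le_of_abs_le_one (he n) (h x ?_ n _ (by omega))
  rw [Metric.mem_ball, dist_eq] at hx
  have := abs_add_le (x - y) y
  rw [sub_add_cancel] at this
  linarith

theorem contDiff_gapSeries {e : ℤ → ℝ} (he : ∀ n, |e n| ≤ 1) : ContDiff ℝ 2 (gapSeries 0 e) := by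
  have hd : ∀ k ≤ 2, deriv (gapSeries k e) = gapSeries (k + 1) e := fun k hk =>
    funext fun y => (hasDerivAt_gapSeries hk he y).deriv
  have hD : ∀ k ≤ 2, Differentiable ℝ (gapSeries k e) := fun k hk y =>
    (hasDerivAt_gapSeries hk he y).differentiableAt
  have h1 : ContDiff ℝ 1 (gapSeries 1 e) := by
    rw [contDiff_one_iff_deriv, hd 1 (by norm_num)]
    exact ⟨hD 1 (by norm_num), (hD 2 le_rfl).continuous⟩
  rw [show (2 : WithTop ℕ∞) = 1 + 1 by norm_num, contDiff_succ_iff_deriv, hd 0 (by norm_num)]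
  exact ⟨hD 0 (by norm_num), by simp, h1⟩

theorem gapSeries_add_int (k : ℕ) (e : ℤ → ℝ) (y : ℝ) (m : ℤ) :
    gapSeries k e (y + m) = gapSeries k (fun n => e (n - m)) y := by
  unfold gapSeries
  rw [← (Equiv.addRight m).tsum_eq (fun n => e (n - m) * iteratedDeriv k gapWidth (y + n))]
  refine tsum_congr fun n => ?_
  simp only [Equiv.coe_addRight, add_sub_cancel_right, Int.cast_add]
  congr 2; ring

/-- This series is the derivative of the constant total width. -/
theorem gapSeries_one_const (c y : ℝ) (hc : |c| ≤ 1) : gapSeries 1 (fun _ => c) y = 0 := by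
  have h : gapSeries 0 (fun _ => c) = fun _ => c * (1 / 2) := funext fun x => by
    simp only [gapSeries, iteratedDeriv_zero]
    exact ((hasSum_gapWidth x).mul_left c).tsum_eq
  have := (hasDerivAt_gapSeries (k := 0) (by norm_num) (fun _ => hc) y).unique
    (h ▸ hasDerivAt_const y _)
  exact this

/-- The left continuous sawtooth. -/
noncomputable def saw (u : ℝ) : ℝ := ⌈u⌉ - u

/-- The right continuous sawtooth. -/
noncomputable def sawR (u : ℝ) : ℝ := ⌊u⌋ + 1 - u

theorem saw_nonneg (u : ℝ) : 0 ≤ saw u := sub_nonneg.2 (Int.le_ceil u)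

theorem saw_le_one (u : ℝ) : saw u ≤ 1 := by
  have := Int.ceil_lt_add_one u
  unfold saw; linarith

theorem sawR_nonneg (u : ℝ) : 0 ≤ sawR u := sub_nonneg.2 (Int.lt_floor_add_one u).le

theorem sawR_le_one (u : ℝ) : sawR u ≤ 1 := by
  have := Int.floor_le u
  unfold sawR; linarith

theorem abs_saw_le (u : ℝ) : |saw u| ≤ 1 := abs_le.2 ⟨by linarith [saw_nonneg u], saw_le_one u⟩

theorem abs_sawR_le (u : ℝ) : |sawR u| ≤ 1 := abs_le.2 ⟨by linarith [sawR_nonneg u], sawR_le_one u⟩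

theorem saw_add_int (u : ℝ) (k : ℤ) : saw (u + k) = saw u := by
  simp [saw]

theorem sawR_add_int (u : ℝ) (k : ℤ) : sawR (u + k) = sawR u := by
  simp [sawR]; ring

theorem eventually_saw_left (θ c : ℝ) :
    ∀ᶠ θ' in 𝓝[<] θ, saw (θ' - c) = ⌈θ - c⌉ - (θ' - c) ∧ sawR (θ' - c) = ⌈θ - c⌉ - (θ' - c) := by
  have h : (⌈θ - c⌉ : ℝ) - 1 + c < θ := by linarith [Int.ceil_lt_add_one (θ - c)]
  filter_upwards [Ioo_mem_nhdsLT h] with θ' hθ'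
  have h1 : ⌈θ' - c⌉ = ⌈θ - c⌉ := by
    rw [Int.ceil_eq_iff]
    exact ⟨by linarith [hθ'.1], by linarith [hθ'.2, Int.le_ceil (θ - c)]⟩
  have h2 : ⌊θ' - c⌋ = ⌈θ - c⌉ - 1 := by
    rw [Int.floor_eq_iff]
    push_cast
    exact ⟨by linarith [hθ'.1], by linarith [hθ'.2, Int.le_ceil (θ - c)]⟩
  exact ⟨by rw [saw, h1], by rw [sawR, h2]; push_cast; ring⟩

theorem eventually_saw_right (θ c : ℝ) : ∀ᶠ θ' in 𝓝[>] θ,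
    saw (θ' - c) = ⌊θ - c⌋ + 1 - (θ' - c) ∧ sawR (θ' - c) = ⌊θ - c⌋ + 1 - (θ' - c) := by
  have h : θ < (⌊θ - c⌋ : ℝ) + 1 + c := by linarith [Int.lt_floor_add_one (θ - c)]
  filter_upwards [Ioo_mem_nhdsGT h] with θ' hθ'
  have h1 : ⌈θ' - c⌉ = ⌊θ - c⌋ + 1 := by
    rw [Int.ceil_eq_iff]
    push_cast
    exact ⟨by linarith [hθ'.1, Int.floor_le (θ - c)], by linarith [hθ'.2]⟩
  have h2 : ⌊θ' - c⌋ = ⌊θ - c⌋ := by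
    rw [Int.floor_eq_iff]
    exact ⟨by linarith [hθ'.1, Int.floor_le (θ - c)], by linarith [hθ'.2]⟩
  exact ⟨by rw [saw, h1]; push_cast; ring, by rw [sawR, h2]⟩

theorem tendsto_saw_left (θ c : ℝ) :
    Tendsto (fun θ' => saw (θ' - c)) (𝓝[<] θ) (𝓝 (saw (θ - c))) ∧
    Tendsto (fun θ' => sawR (θ' - c)) (𝓝[<] θ) (𝓝 (saw (θ - c))) := by
  have h : Tendsto (fun θ' : ℝ => (⌈θ - c⌉ : ℝ) - (θ' - c)) (𝓝[<] θ) (𝓝 (saw (θ - c))) :=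
    tendsto_nhdsWithin_of_tendsto_nhds (Continuous.tendsto (by fun_prop) θ)
  exact ⟨h.congr' ((eventually_saw_left θ c).mono fun x hx => hx.1.symm),
    h.congr' ((eventually_saw_left θ c).mono fun x hx => hx.2.symm)⟩

theorem tendsto_saw_right (θ c : ℝ) :
    Tendsto (fun θ' => saw (θ' - c)) (𝓝[>] θ) (𝓝 (sawR (θ - c))) ∧
    Tendsto (fun θ' => sawR (θ' - c)) (𝓝[>] θ) (𝓝 (sawR (θ - c))) := by
  have h : Tendsto (fun θ' : ℝ => (⌊θ - c⌋ : ℝ) + 1 - (θ' - c)) (𝓝[>] θ) (𝓝 (sawR (θ - c))) :=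
    tendsto_nhdsWithin_of_tendsto_nhds (Continuous.tendsto (by fun_prop) θ)
  exact ⟨h.congr' ((eventually_saw_right θ c).mono fun x hx => hx.1.symm),
    h.congr' ((eventually_saw_right θ c).mono fun x hx => hx.2.symm)⟩

theorem tendsto_gapSeries {l : Filter ℝ} {e : ℝ → ℤ → ℝ} {e' : ℤ → ℝ} {k : ℕ} (hk : k ≤ 3)
    (he : ∀ θ n, |e θ n| ≤ 1) (h : ∀ n, Tendsto (fun θ => e θ n) l (𝓝 (e' n))) (y : ℝ) :
    Tendsto (fun θ => gapSeries k (e θ) y) l (𝓝 (gapSeries k e' y)) := by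
  obtain ⟨C, hC, hb⟩ := exists_abs_iteratedDeriv_gapWidth_le
  exact tendsto_tsum_of_dominated_convergence ((hasSum_gapWidth y).summable.mul_left C)
    (fun n => (h n).mul_const _)
    (Eventually.of_forall fun θ n => abs_mul_le_of_abs_le_one (he θ n) (hb _ k hk))

/-- The leafSlope of the linear foliation that is blown up. -/
noncomputable def leafSlope : ℝ := √2

theorem irrational_leafSlope : Irrational leafSlope := irrational_sqrt_two

/-- The leaf with label `θ` of the blown-up foliation (its left edge if it is doubled). -/
noncomputable def leafL (θ y : ℝ) : ℝ := θ + leafSlope * y + gapSeries 0 (fun n => saw (θ - leafSlope * n)) y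

/-- The leaf with label `θ` of the blown-up foliation (its right edge if it is doubled). -/
noncomputable def leafR (θ y : ℝ) : ℝ :=
  θ + leafSlope * y + gapSeries 0 (fun n => sawR (θ - leafSlope * n)) y

/-- The left edge at time `s` of the strip of gaps. -/
noncomputable def gapEdge (s : ℝ) : ℝ := leafSlope * s + gapSeries 0 (fun n => saw (-(leafSlope * n))) s

/-- The single strip of gaps, followed for `n` turns, crosses level `y` at the label `leafSlope *
n`. -/
theorem gapEdge_add_int (y : ℝ) (n : ℤ) : gapEdge (y + n) = leafL (leafSlope * n) y := by
  rw [gapEdge, leafL, gapSeries_add_int]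
  have : (fun m : ℤ => saw (-(leafSlope * ((m - n : ℤ) : ℝ)))) =
      fun m : ℤ => saw (leafSlope * n - leafSlope * m) := by
    funext m; congr 1; push_cast; ring
  rw [this]; ring

theorem leafL_add_int (θ y : ℝ) (k : ℤ) : leafL (θ + k) y = leafL θ y + k := by
  have : (fun n : ℤ => saw (θ + k - leafSlope * n)) = fun n : ℤ => saw (θ - leafSlope * n) := by
    funext n; rw [add_sub_right_comm, saw_add_int]
  rw [leafL, leafL, this]; ring

theorem leafR_add_int (θ y : ℝ) (k : ℤ) : leafR (θ + k) y = leafR θ y + k := by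
  have : (fun n : ℤ => sawR (θ + k - leafSlope * n)) = fun n : ℤ => sawR (θ - leafSlope * n) := by
    funext n; rw [add_sub_right_comm, sawR_add_int]
  rw [leafR, leafR, this]; ring

/-- The holonomy of the foliation acts on labels as the rotation by `leafSlope`. -/
theorem leafL_add_level (θ y : ℝ) (m : ℤ) : leafL θ (y + m) = leafL (θ + leafSlope * m) y := by
  have : (fun n : ℤ => saw (θ - leafSlope * ((n - m : ℤ) : ℝ))) =
      fun n : ℤ => saw (θ + leafSlope * m - leafSlope * n) := by
    funext n; congr 1; push_cast; ring
  rw [leafL, leafL, gapSeries_add_int, this]; ring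

theorem leafR_add_level (θ y : ℝ) (m : ℤ) : leafR θ (y + m) = leafR (θ + leafSlope * m) y := by
  have : (fun n : ℤ => sawR (θ - leafSlope * ((n - m : ℤ) : ℝ))) =
      fun n : ℤ => sawR (θ + leafSlope * m - leafSlope * n) := by
    funext n; congr 1; push_cast; ring
  rw [leafR, leafR, gapSeries_add_int, this]; ring

theorem gapSeries_zero_mem {e : ℤ → ℝ} (h0 : ∀ n, 0 ≤ e n) (h1 : ∀ n, e n ≤ 1) (y : ℝ) :
    gapSeries 0 e y ∈ Icc (0 : ℝ) (1 / 2) := by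
  have hs : Summable fun n : ℤ => e n * gapWidth (y + n) := by
    simpa using summable_gapSeries (k := 0) (by norm_num)
      (fun n => abs_le.2 ⟨by linarith [h0 n], h1 n⟩) y
  simp only [gapSeries, iteratedDeriv_zero]
  refine ⟨tsum_nonneg fun n => mul_nonneg (h0 n) (gapWidth_pos _).le, ?_⟩
  exact hasSum_le (fun n => mul_le_of_le_one_left (gapWidth_pos _).le (h1 n)) hs.hasSum
    (hasSum_gapWidth y)

theorem leafL_mem (θ y : ℝ) : leafL θ y ∈ Icc (θ + leafSlope * y) (θ + leafSlope * y + 1 / 2) := by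
  have := gapSeries_zero_mem (fun n : ℤ => saw_nonneg (θ - leafSlope * n)) (fun n => saw_le_one _) y
  unfold leafL
  exact ⟨by linarith [this.1], by linarith [this.2]⟩

theorem tendsto_leaf_left (θ y : ℝ) :
    Tendsto (fun θ' => leafL θ' y) (𝓝[<] θ) (𝓝 (leafL θ y)) ∧
    Tendsto (fun θ' => leafR θ' y) (𝓝[<] θ) (𝓝 (leafL θ y)) := by
  have h : Tendsto (fun θ' : ℝ => θ' + leafSlope * y) (𝓝[<] θ) (𝓝 (θ + leafSlope * y)) :=
    tendsto_nhdsWithin_of_tendsto_nhds (Continuous.tendsto (by fun_prop) θ)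
  exact ⟨h.add (tendsto_gapSeries (by norm_num) (fun θ n => abs_saw_le _)
      (fun n => (tendsto_saw_left θ _).1) y),
    h.add (tendsto_gapSeries (by norm_num) (fun θ n => abs_sawR_le _)
      (fun n => (tendsto_saw_left θ _).2) y)⟩

theorem tendsto_leaf_right (θ y : ℝ) :
    Tendsto (fun θ' => leafL θ' y) (𝓝[>] θ) (𝓝 (leafR θ y)) ∧
    Tendsto (fun θ' => leafR θ' y) (𝓝[>] θ) (𝓝 (leafR θ y)) := by
  have h : Tendsto (fun θ' : ℝ => θ' + leafSlope * y) (𝓝[>] θ) (𝓝 (θ + leafSlope * y)) :=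
    tendsto_nhdsWithin_of_tendsto_nhds (Continuous.tendsto (by fun_prop) θ)
  exact ⟨h.add (tendsto_gapSeries (by norm_num) (fun θ n => abs_saw_le _)
      (fun n => (tendsto_saw_right θ _).1) y),
    h.add (tendsto_gapSeries (by norm_num) (fun θ n => abs_sawR_le _)
      (fun n => (tendsto_saw_right θ _).2) y)⟩

/-- For `θ ≤ θ'`, the difference of ceilings counts the gaps of the `n`-th family with label in `[θ,
θ')`. The linear part of the sawtooth, summed against the total width `1/2`, takes away half of `θ'
- θ`. So leaves are spread by half the difference of labels plus the widths of the gaps in between.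
-/
theorem hasSum_leafL_sub (θ θ' y : ℝ) :
    HasSum (fun n : ℤ => ((⌈θ' - leafSlope * n⌉ : ℝ) - ⌈θ - leafSlope * n⌉) * gapWidth (y + n))
      (leafL θ' y - leafL θ y - (θ' - θ) / 2) := by
  have h1 := (summable_gapSeries (k := 0) (by norm_num)
    (fun n : ℤ => abs_saw_le (θ' - leafSlope * n)) y).hasSum
  have h2 := (summable_gapSeries (k := 0) (by norm_num)
    (fun n : ℤ => abs_saw_le (θ - leafSlope * n)) y).hasSum
  have h3 := (h1.sub h2).add ((hasSum_gapWidth y).mul_left (θ' - θ))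
  have e : leafL θ' y - leafL θ y - (θ' - θ) / 2 =
      gapSeries 0 (fun n => saw (θ' - leafSlope * n)) y -
        gapSeries 0 (fun n => saw (θ - leafSlope * n)) y + (θ' - θ) * (1 / 2) := by
    simp only [leafL]; ring
  rw [e]
  refine h3.congr_fun fun n => ?_
  simp only [saw, iteratedDeriv_zero]; ring

/-- Across the gap with label `leafSlope * n + k` the leaves jump by the width of the gap. -/
theorem leafL_jump {n k : ℤ} {θ' : ℝ} (h : leafSlope * n + k < θ') (y : ℝ) :
    leafL (leafSlope * n + k) y + gapWidth (y + n) + (θ' - (leafSlope * n + k)) / 2 ≤ leafL θ' y := by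
  have hs := hasSum_leafL_sub (leafSlope * n + k) θ' y
  have h0 : ∀ m : ℤ, 0 ≤ ((⌈θ' - leafSlope * m⌉ : ℝ) - ⌈leafSlope * n + k - leafSlope * m⌉) *
      gapWidth (y + m) := fun m => by
    refine mul_nonneg (sub_nonneg.2 ?_) (gapWidth_pos _).le
    exact_mod_cast Int.ceil_mono (by linarith)
  have h1 := le_hasSum hs n fun m _ => h0 m
  have h2 : (1 : ℝ) ≤ (⌈θ' - leafSlope * n⌉ : ℝ) - ⌈leafSlope * n + k - leafSlope * n⌉ := by
    have e : ⌈leafSlope * n + k - leafSlope * (n : ℝ)⌉ = k := by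
      rw [add_sub_cancel_left, Int.ceil_intCast]
    have : k < ⌈θ' - leafSlope * n⌉ := Int.lt_ceil.2 (by linarith)
    rw [e]
    have : (k : ℝ) + 1 ≤ ⌈θ' - leafSlope * n⌉ := by exact_mod_cast this
    linarith
  nlinarith [gapWidth_pos (y + n)]

theorem leafL_add_le {θ θ' : ℝ} (h : θ ≤ θ') (y : ℝ) : leafL θ y + (θ' - θ) / 2 ≤ leafL θ' y := by
  have hs := hasSum_leafL_sub θ θ' y
  have := hs.nonneg fun m => mul_nonneg (sub_nonneg.2
    (by exact_mod_cast Int.ceil_mono (by linarith))) (gapWidth_pos _).le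
  linarith

theorem leafL_mono (y : ℝ) : Monotone fun θ => leafL θ y := fun θ θ' h => by
  have := leafL_add_le h y
  simp only
  linarith

theorem leafR_le_leafL {θ θ' : ℝ} (h : θ < θ') (y : ℝ) : leafR θ y ≤ leafL θ' y := by
  refine le_of_tendsto (tendsto_leaf_right θ y).1 ?_
  filter_upwards [Ioo_mem_nhdsGT h] with x hx
  exact leafL_mono y hx.2.le

theorem leafL_le_leafR (θ y : ℝ) : leafL θ y ≤ leafR θ y := by
  refine ge_of_tendsto (tendsto_leaf_right θ y).1 ?_
  filter_upwards [self_mem_nhdsWithin] with x hx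
  exact leafL_mono y (le_of_lt hx)

theorem leafSlope_mul_add_injective {n n' k k' : ℤ} (h : leafSlope * n + k = leafSlope * n' + k') : n = n' := by
  by_contra hne
  have h1 : leafSlope * ((n - n' : ℤ) : ℝ) = ((k' - k : ℤ) : ℝ) := by push_cast; linarith
  exact (irrational_leafSlope.mul_intCast (sub_ne_zero.2 hne)).ne_int _ h1

theorem leafR_leafSlope_mul (n k : ℤ) (y : ℝ) :
    leafR (leafSlope * n + k) y = leafL (leafSlope * n + k) y + gapWidth (y + n) := by
  have h1 := summable_gapSeries (k := 0) (by norm_num)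
    (fun m : ℤ => abs_sawR_le (leafSlope * n + k - leafSlope * m)) y
  have h2 := summable_gapSeries (k := 0) (by norm_num)
    (fun m : ℤ => abs_saw_le (leafSlope * n + k - leafSlope * m)) y
  have h3 : gapSeries 0 (fun m => sawR (leafSlope * n + k - leafSlope * m)) y -
      gapSeries 0 (fun m => saw (leafSlope * n + k - leafSlope * m)) y = gapWidth (y + n) := by
    rw [gapSeries, gapSeries, ← h1.tsum_sub h2, tsum_eq_single n]
    · rw [add_sub_cancel_left]; simp [saw, sawR]
    · intro m hm
      have : saw (leafSlope * n + k - leafSlope * m) = sawR (leafSlope * n + k - leafSlope * m) := by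
        rw [saw, sawR]
        congr 1
        have hne : (⌊leafSlope * n + k - leafSlope * m⌋ : ℝ) ≠ leafSlope * n + k - leafSlope * m := fun he =>
          hm (leafSlope_mul_add_injective (n := n) (k := k) (n' := m)
            (k' := ⌊leafSlope * n + k - leafSlope * m⌋) (by rw [he]; ring)).symm
        have : ⌈leafSlope * n + k - leafSlope * m⌉ = ⌊leafSlope * n + k - leafSlope * m⌋ + 1 := by
          rw [Int.ceil_eq_iff]
          push_cast
          exact ⟨by linarith [lt_of_le_of_ne (Int.floor_le _) hne],
            (Int.lt_floor_add_one _).le⟩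
        rw [this]; push_cast; ring
      rw [this, sub_self]
  rw [leafL, leafR]; linarith

theorem dense_leafSlope : Dense {θ : ℝ | ∃ n k : ℤ, θ = leafSlope * n + k} := by
  have h := (dense_addSubgroupClosure_pair_iff (a := leafSlope) (b := 1)).2
    (by simpa using irrational_leafSlope)
  refine h.mono fun θ hθ => ?_
  obtain ⟨n, k, h⟩ := AddSubgroup.mem_closure_pair.1 hθ
  exact ⟨n, k, by rw [← h]; simp [mul_comm]⟩

theorem exists_leafSlope_mem_Ioo {a b : ℝ} (h : a < b) (c : ℝ) :
    ∃ n k : ℤ, c + leafSlope * n + k ∈ Ioo a b := by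
  obtain ⟨θ, ⟨n, k, rfl⟩, h1⟩ := dense_leafSlope.exists_mem_open isOpen_Ioo
    (nonempty_Ioo.2 (sub_lt_sub_right h c))
  exact ⟨n, k, by linarith [h1.1], by linarith [h1.2]⟩

/-- The point `x` lies in the closed gap at time `s`. -/
def InGap (x s : ℝ) : Prop := ∃ k : ℤ, x - k ∈ Icc (gapEdge s) (gapEdge s + gapWidth s)

/-- Two different gaps are separated by at least half the difference of their labels, by
`leafL_jump`, so even the closed gaps are disjoint. -/
theorem InGap.eq {x y : ℝ} {n m : ℤ} (hn : InGap x (y + n)) (hm : InGap x (y + m)) : n = m := by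
  obtain ⟨k, hk1, hk2⟩ := hn
  obtain ⟨l, hl1, hl2⟩ := hm
  rw [gapEdge_add_int] at hk1 hk2 hl1 hl2
  rcases lt_trichotomy (leafSlope * n + k) (leafSlope * m + l) with h | h | h
  · have := leafL_jump h y
    rw [leafL_add_int, leafL_add_int] at this
    linarith
  · exact leafSlope_mul_add_injective h
  · have := leafL_jump h y
    rw [leafL_add_int, leafL_add_int] at this
    linarith

/-- The lift to the plane of the Denjoy continuum: the complement of the open gaps. -/
def denjoyPlane : Set (ℝ × ℝ) :=
  {p | ∀ n k : ℤ, p.1 - k ∉ Ioo (gapEdge (p.2 + n)) (gapEdge (p.2 + n) + gapWidth (p.2 + n))}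

theorem continuous_gapEdge : Continuous gapEdge :=
  (continuous_const.mul continuous_id).add (contDiff_gapSeries fun _ => abs_saw_le _).continuous

theorem isClosed_denjoyPlane : IsClosed denjoyPlane := by
  have hE := continuous_gapEdge
  have hW : Continuous gapWidth := (contDiff_gapWidth (n := 0)).continuous
  have : denjoyPlane = ⋂ n : ℤ, ⋂ k : ℤ,
      ({p | gapEdge (p.2 + n) < p.1 - k} ∩
        {p | p.1 - k < gapEdge (p.2 + n) + gapWidth (p.2 + n)})ᶜ := by
    ext p; simp [denjoyPlane]
  rw [this]
  refine isClosed_iInter fun n => isClosed_iInter fun k => ?_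
  rw [isClosed_compl_iff]
  exact (isOpen_lt (by fun_prop) (by fun_prop)).inter (isOpen_lt (by fun_prop) (by fun_prop))

theorem leafL_mem_denjoyPlane (θ y : ℝ) : (leafL θ y, y) ∈ denjoyPlane := by
  intro n k h
  simp only [gapEdge_add_int] at h
  obtain ⟨h1, h2⟩ := h
  have hlt : leafSlope * n + k < θ := by
    by_contra hc
    have := leafL_mono y (not_lt.1 hc)
    simp only [leafL_add_int] at this
    linarith
  have := leafL_jump hlt y
  rw [leafL_add_int] at this
  linarith

theorem leafR_mem_denjoyPlane (θ y : ℝ) : (leafR θ y, y) ∈ denjoyPlane :=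
  isClosed_denjoyPlane.mem_of_tendsto ((tendsto_leaf_right θ y).1.prodMk_nhds tendsto_const_nhds)
    (Eventually.of_forall fun θ' => leafL_mem_denjoyPlane θ' y)

/-- The label is the supremum of those whose left leaf is at most `x`; the one-sided limits of the
leaves give the two inequalities. -/
theorem exists_leaf_between (x y : ℝ) : ∃ θ, leafL θ y ≤ x ∧ x ≤ leafR θ y := by
  set A := {θ | leafL θ y ≤ x}
  have hne : A.Nonempty := ⟨x - leafSlope * y - 1, by
    have := (leafL_mem (x - leafSlope * y - 1) y).2
    show leafL _ y ≤ x
    linarith⟩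
  have hbdd : BddAbove A := ⟨x - leafSlope * y, fun θ (hθ : leafL θ y ≤ x) => by
    linarith [(leafL_mem θ y).1]⟩
  have hlt : ∀ θ < sSup A, leafL θ y ≤ x := fun θ hθ => by
    obtain ⟨θ', h1, h2⟩ := exists_lt_of_lt_csSup hne hθ
    exact (leafL_mono y h2.le).trans h1
  refine ⟨sSup A, ?_, ?_⟩
  · refine le_of_tendsto (tendsto_leaf_left (sSup A) y).1 ?_
    filter_upwards [self_mem_nhdsWithin] with θ hθ
    exact hlt θ hθ
  · refine ge_of_tendsto (tendsto_leaf_right (sSup A) y).1 ?_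
    filter_upwards [self_mem_nhdsWithin] with θ hθ
    by_contra hc
    exact absurd (le_csSup hbdd (not_le.1 hc).le) (not_le.2 hθ)

theorem leafR_eq_leafL_or (θ y : ℝ) :
    leafR θ y = leafL θ y ∨ ∃ n k : ℤ, θ = leafSlope * n + k := by
  by_cases h : ∃ n k : ℤ, θ = leafSlope * n + k
  · exact Or.inr h
  refine Or.inl ?_
  rw [leafL, leafR]
  congr 2
  funext n
  rw [saw, sawR]
  congr 1
  have hne : (⌊θ - leafSlope * n⌋ : ℝ) ≠ θ - leafSlope * n := fun he =>
    h ⟨n, ⌊θ - leafSlope * n⌋, by rw [he]; ring⟩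
  have : ⌈θ - leafSlope * n⌉ = ⌊θ - leafSlope * n⌋ + 1 := by
    rw [Int.ceil_eq_iff]
    push_cast
    exact ⟨by linarith [lt_of_le_of_ne (Int.floor_le _) hne], (Int.lt_floor_add_one _).le⟩
  rw [this]; push_cast; ring

/-- A point between the two edges of a leaf either has a leaf that is not doubled, or sits in a
closed gap and can only be one of its ends. -/
theorem mem_denjoyPlane_iff {x y : ℝ} :
    (x, y) ∈ denjoyPlane ↔ ∃ θ, x = leafL θ y ∨ x = leafR θ y := by
  constructor
  · intro h
    obtain ⟨θ, h1, h2⟩ := exists_leaf_between x y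
    refine ⟨θ, ?_⟩
    rcases leafR_eq_leafL_or θ y with he | ⟨n, k, rfl⟩
    · exact Or.inl (le_antisymm (h2.trans he.le) h1)
    · by_contra! hc
      apply h n k
      rw [leafR_leafSlope_mul] at h2 hc
      simp only [gapEdge_add_int]
      rw [leafL_add_int] at h1 h2 hc
      exact ⟨by linarith [lt_of_le_of_ne h1 (Ne.symm hc.1)], by linarith [lt_of_le_of_ne h2 hc.2]⟩
  · rintro ⟨θ, rfl | rfl⟩
    · exact leafL_mem_denjoyPlane θ y
    · exact leafR_mem_denjoyPlane θ y

/-- Every horizontal interval meets the complement of the lifted Denjoy continuum. -/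
theorem exists_notMem_denjoyPlane {x₁ x₂ : ℝ} (h : x₁ < x₂) (y : ℝ) :
    ∃ x ∈ Ioo x₁ x₂, (x, y) ∉ denjoyPlane := by
  by_contra! hc
  have gap : ∀ n k : ℤ, ¬ (x₁ ≤ leafL (leafSlope * n + k) y ∧
      leafL (leafSlope * n + k) y + gapWidth (y + n) ≤ x₂) := by
    rintro n k ⟨h1, h2⟩
    have hw := gapWidth_pos (y + n)
    refine hc (leafL (leafSlope * n + k) y + gapWidth (y + n) / 2) ⟨by linarith, by linarith⟩ n k ?_
    rw [leafL_add_int]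
    simp only [gapEdge_add_int]
    exact ⟨by linarith, by linarith⟩
  -- If the labels of `p` and `q` differ, a gap label lies strictly between them; if they agree, `p`
  -- and `q` are the two edges of one gap. Either way a whole gap lies between `x₁` and `x₂`.
  set p := x₁ + (x₂ - x₁) / 3
  set q := x₁ + 2 * (x₂ - x₁) / 3
  have hp : (p, y) ∈ denjoyPlane := hc p ⟨by simp only [p]; linarith, by simp only [p]; linarith⟩
  have hq : (q, y) ∈ denjoyPlane := hc q ⟨by simp only [q]; linarith, by simp only [q]; linarith⟩
  have hpq : p < q := by simp only [p, q]; linarith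
  have hp1 : x₁ < p := by simp only [p]; linarith
  have hq2 : q < x₂ := by simp only [q]; linarith
  obtain ⟨θ, hθ⟩ := mem_denjoyPlane_iff.1 hp
  obtain ⟨η, hη⟩ := mem_denjoyPlane_iff.1 hq
  have hθ1 : leafL θ y ≤ p ∧ p ≤ leafR θ y := by
    have := leafL_le_leafR θ y
    rcases hθ with h | h <;> rw [h] <;> constructor <;> linarith
  have hη1 : leafL η y ≤ q ∧ q ≤ leafR η y := by
    have := leafL_le_leafR η y
    rcases hη with h | h <;> rw [h] <;> constructor <;> linarith
  rcases lt_trichotomy θ η with hlt | rfl | hlt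
  · obtain ⟨n, k, h1, h2⟩ := exists_leafSlope_mem_Ioo hlt 0
    rw [zero_add] at h1 h2
    refine gap n k ⟨?_, ?_⟩
    · linarith [leafR_le_leafL h1 y]
    · linarith [leafL_jump h2 y]
  · have hLR : leafL θ y = p ∧ leafR θ y = q := by
      rcases hθ with h | h <;> rcases hη with h' | h' <;> constructor <;> linarith [hθ1.1, hη1.2]
    rcases leafR_eq_leafL_or θ y with he | ⟨n, k, rfl⟩
    · linarith
    · refine gap n k ⟨by linarith, ?_⟩
      rw [← leafR_leafSlope_mul]; linarith
  · linarith [leafR_le_leafL hlt y]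

end BlowUp

/-! ### Step functions across the gaps and their series -/

section DerivBounds

variable {E : Type*} [NormedAddCommGroup E] [NormedSpace ℝ E]

/-- The derivatives of `f` of order at most two at `p` are bounded by `A`, `A * l`, `A * l ^ 2`. -/
def DerivBound (f : E → ℝ) (p : E) (A l : ℝ) : Prop :=
  ∀ i ≤ 2, ‖iteratedFDeriv ℝ i f p‖ ≤ A * l ^ i

theorem DerivBound.mono {f : E → ℝ} {p : E} {A B l m : ℝ} (h : DerivBound f p A l) (hA : 0 ≤ A)
    (hl : 0 ≤ l) (hAB : A ≤ B) (hlm : l ≤ m) : DerivBound f p B m := fun i hi =>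
  (h i hi).trans (by have := hA.trans hAB; gcongr)

/-- Leibniz with a common length scale; the binomial coefficients add up to at most `2 ^ 2 = 4`. -/
theorem DerivBound.mul {f g : E → ℝ} {p : E} {A B l : ℝ} (hf : ContDiff ℝ 2 f)
    (hg : ContDiff ℝ 2 g) (hfA : DerivBound f p A l) (hgB : DerivBound g p B l) (hA : 0 ≤ A)
    (hl : 0 ≤ l) : DerivBound (fun x => f x * g x) p (4 * (A * B)) l := fun i hi => by
  have hB : 0 ≤ B := by simpa using (norm_nonneg _).trans (hgB 0 (by norm_num))
  refine (norm_iteratedFDeriv_mul_le hf hg p (n := i) (by exact_mod_cast hi)).trans ?_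
  calc _ ≤ ∑ j ∈ Finset.range (i + 1), (i.choose j : ℝ) * (A * B * l ^ i) := by
        refine Finset.sum_le_sum fun j hj => ?_
        have hj' : j ≤ i := by simpa [Nat.lt_succ_iff] using hj
        rw [mul_assoc]
        refine mul_le_mul_of_nonneg_left ?_ (Nat.cast_nonneg _)
        calc _ ≤ (A * l ^ j) * (B * l ^ (i - j)) :=
              mul_le_mul (hfA j (by omega)) (hgB _ (by omega)) (norm_nonneg _) (by positivity)
          _ = A * B * (l ^ j * l ^ (i - j)) := by ring
          _ = _ := by rw [← pow_add, Nat.add_sub_cancel' hj']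
    _ = 2 ^ i * (A * B * l ^ i) := by
        rw [← Finset.sum_mul]
        congr 1
        exact_mod_cast Nat.sum_range_choose i
    _ ≤ 4 * (A * B * l ^ i) := by
        gcongr
        calc (2 : ℝ) ^ i ≤ 2 ^ 2 := by gcongr; norm_num
          _ = 4 := by norm_num
    _ = _ := by ring

theorem DerivBound.comp {φ : ℝ → ℝ} {u : E → ℝ} {p : E} {M l : ℝ} (hφ : ContDiff ℝ 2 φ)
    (hu : ContDiff ℝ 2 u) (hM : ∀ i ≤ 2, |iteratedDeriv i φ (u p)| ≤ M)
    (hl : ∀ i, 1 ≤ i → i ≤ 2 → ‖iteratedFDeriv ℝ i u p‖ ≤ l ^ i) (hl0 : 0 ≤ l) :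
    DerivBound (fun x => φ (u x)) p (2 * M) l := fun i hi => by
  have hM0 : 0 ≤ M := (abs_nonneg _).trans (hM 0 (by norm_num))
  refine (norm_iteratedFDeriv_comp_le (n := i) (C := M) (D := l) hφ hu (by exact_mod_cast hi) p
    (fun j hj => ?_) (fun j h1 h2 => hl j h1 (h2.trans hi))).trans ?_
  · rw [norm_iteratedFDeriv_eq_norm_iteratedDeriv]
    exact hM j (hj.trans hi)
  · gcongr
    have : (i.factorial : ℝ) ≤ (Nat.factorial 2 : ℕ) := by
      exact_mod_cast Nat.factorial_le hi
    simpa using this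

theorem norm_iteratedFDeriv_comp_clm_le {g : ℝ → ℝ} {ℓ : E →L[ℝ] ℝ} (hg : ContDiff ℝ 2 g)
    (hℓ : ‖ℓ‖ ≤ 1) (p : E) {i : ℕ} (hi : i ≤ 2) :
    ‖iteratedFDeriv ℝ i (fun x => g (ℓ x)) p‖ ≤ |iteratedDeriv i g (ℓ p)| := by
  have := ContinuousLinearMap.iteratedFDeriv_comp_right ℓ hg p (i := i) (by exact_mod_cast hi)
  rw [show (fun x => g (ℓ x)) = g ∘ ℓ from rfl, this]
  refine (ContinuousMultilinearMap.norm_compContinuousLinearMap_le _ _).trans ?_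
  rw [norm_iteratedFDeriv_eq_norm_iteratedDeriv]
  exact mul_le_of_le_one_right (norm_nonneg _)
    (Finset.prod_le_one (fun _ _ => norm_nonneg _) fun _ _ => hℓ)

theorem DerivBound.comp_clm {g : ℝ → ℝ} {ℓ : E →L[ℝ] ℝ} {p : E} {A l : ℝ} (hg : ContDiff ℝ 2 g)
    (hℓ : ‖ℓ‖ ≤ 1) (h : ∀ i ≤ 2, |iteratedDeriv i g (ℓ p)| ≤ A * l ^ i) :
    DerivBound (fun x => g (ℓ x)) p A l := fun i hi =>
  (norm_iteratedFDeriv_comp_clm_le hg hℓ p hi).trans (h i hi)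

end DerivBounds

/-! ### Staircase functions with one smooth step per gap -/

section Profiles

open Filter Real

/-- A step of height `q` carried by the interval `[0, 1]`. -/
structure IsProfile (σ : ℝ → ℝ) (q : ℝ) : Prop where
  contDiff : ContDiff ℝ 2 σ
  zero : ∀ r ≤ 0, σ r = 0
  one : ∀ r, 1 ≤ r → σ r = q

/-- The function of `(x, s)` that rises with profile `σ` across each gap at time `s`. -/
noncomputable def gapStep (σ : ℝ → ℝ) (q : ℝ) (p : ℝ × ℝ) : ℝ :=
  q * ⌊p.1 - gapEdge p.2⌋ + σ (Int.fract (p.1 - gapEdge p.2) / gapWidth p.2)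

theorem contDiff_gapEdge : ContDiff ℝ 2 gapEdge :=
  (contDiff_const.mul contDiff_id).add (contDiff_gapSeries fun _ => abs_saw_le _)

/-- Near `p` the integer part can be frozen. Where the floor drops by one, the point is just left of
a gap edge: as widths are at most `1/2`, the previous step is already complete and the next has not
begun, so the two formulas agree. -/
theorem gapStep_eventuallyEq {σ : ℝ → ℝ} {q : ℝ} (hσ : IsProfile σ q) (p : ℝ × ℝ) :
    gapStep σ q =ᶠ[𝓝 p] fun p' => q * ⌊p.1 - gapEdge p.2⌋ +
      σ ((p'.1 - gapEdge p'.2 - ⌊p.1 - gapEdge p.2⌋) / gapWidth p'.2) := by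
  set k := ⌊p.1 - gapEdge p.2⌋ with hk
  have hE := continuous_gapEdge
  have hc : Continuous fun p' : ℝ × ℝ => p'.1 - gapEdge p'.2 := by fun_prop
  have hn : Ioo ((k : ℝ) - 1 / 2) (k + 1) ∈ 𝓝 (p.1 - gapEdge p.2) :=
    Ioo_mem_nhds (by linarith [Int.floor_le (p.1 - gapEdge p.2)]) (Int.lt_floor_add_one _)
  filter_upwards [hc.continuousAt.preimage_mem_nhds hn] with p' hp'
  obtain ⟨h1, h2⟩ : (k : ℝ) - 1 / 2 < p'.1 - gapEdge p'.2 ∧ p'.1 - gapEdge p'.2 < k + 1 := hp'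
  have hw := gapWidth_pos p'.2
  have hw2 := gapWidth_le_half p'.2
  rw [gapStep]
  rcases le_or_gt (k : ℝ) (p'.1 - gapEdge p'.2) with h | h
  · have hf : ⌊p'.1 - gapEdge p'.2⌋ = k := Int.floor_eq_iff.2 ⟨h, h2⟩
    rw [Int.fract, hf]
  · have hf : ⌊p'.1 - gapEdge p'.2⌋ = k - 1 :=
      Int.floor_eq_iff.2 ⟨by push_cast; linarith, by push_cast; linarith⟩
    rw [Int.fract, hf, hσ.one, hσ.zero]
    · push_cast; ring
    · exact div_nonpos_of_nonpos_of_nonneg (by linarith) hw.le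
    · rw [le_div_iff₀ hw]; push_cast; linarith

theorem contDiff_gapStep {σ : ℝ → ℝ} {q : ℝ} (hσ : IsProfile σ q) :
    ContDiff ℝ 2 (gapStep σ q) := by
  rw [contDiff_iff_contDiffAt]
  intro p
  refine ContDiffAt.congr_of_eventuallyEq ?_ (gapStep_eventuallyEq hσ p)
  have hE := contDiff_gapEdge
  have hW := contDiff_gapWidth (n := 2)
  have h1 : ContDiff ℝ 2 fun p' : ℝ × ℝ =>
      (p'.1 - gapEdge p'.2 - ⌊p.1 - gapEdge p.2⌋) / gapWidth p'.2 :=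
    ((contDiff_fst.sub (hE.comp contDiff_snd)).sub contDiff_const).div (hW.comp contDiff_snd)
      fun p' => (gapWidth_pos _).ne'
  exact (contDiff_const.add (hσ.contDiff.comp h1)).contDiffAt

theorem inGap_iff {x s : ℝ} : InGap x s ↔ Int.fract (x - gapEdge s) ≤ gapWidth s := by
  constructor
  · rintro ⟨k, h1, h2⟩
    have hw := gapWidth_le_half s
    have : ⌊x - gapEdge s⌋ = k := Int.floor_eq_iff.2 ⟨by linarith, by linarith⟩
    rw [Int.fract, this]; linarith
  · intro h
    have := Int.fract_nonneg (x - gapEdge s)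
    rw [Int.fract] at h this
    exact ⟨⌊x - gapEdge s⌋, by linarith, by linarith⟩

theorem gapStep_eventuallyEq_const {σ : ℝ → ℝ} {q : ℝ} (hσ : IsProfile σ q) {p : ℝ × ℝ}
    (hp : ¬ InGap p.1 p.2) : ∃ c, gapStep σ q =ᶠ[𝓝 p] fun _ => c := by
  have hE := continuous_gapEdge
  have hW : Continuous gapWidth := (contDiff_gapWidth (n := 0)).continuous
  refine ⟨q * ⌊p.1 - gapEdge p.2⌋ + q, (gapStep_eventuallyEq hσ p).trans ?_⟩
  have h1 : gapWidth p.2 < p.1 - gapEdge p.2 - ⌊p.1 - gapEdge p.2⌋ :=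
    not_le.1 (mt inGap_iff.2 hp)
  have h2 : ∀ᶠ p' : ℝ × ℝ in 𝓝 p, gapWidth p'.2 < p'.1 - gapEdge p'.2 - ⌊p.1 - gapEdge p.2⌋ :=
    (show Continuous fun p' : ℝ × ℝ => gapWidth p'.2 by fun_prop).continuousAt.eventually_lt
      (show Continuous fun p' : ℝ × ℝ => p'.1 - gapEdge p'.2 - ⌊p.1 - gapEdge p.2⌋ by
        fun_prop).continuousAt h1
  filter_upwards [h2] with p' hp'
  rw [hσ.one]
  rw [le_div_iff₀ (gapWidth_pos _)]; linarith

/-- Since `gapWidth` has bounded logarithmic derivatives, differentiating its inverse costs only a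
constant. -/
theorem exists_derivBound_inv_gapWidth :
    ∃ C, 1 ≤ C ∧ ∀ s, ∀ i ≤ 2, |iteratedDeriv i (fun s => (gapWidth s)⁻¹) s| ≤
      C * (gapWidth s)⁻¹ * 1 ^ i := by
  obtain ⟨C, hC, h⟩ := exists_abs_iteratedDeriv_gapWidth_le
  refine ⟨1 + C + C + 2 * C ^ 2, by nlinarith, fun s i hi => ?_⟩
  have hw := fun s => gapWidth_pos s
  have hwi : 0 < (gapWidth s)⁻¹ := inv_pos.2 (hw s)
  have hd1 : ∀ s, HasDerivAt (fun s => (gapWidth s)⁻¹)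
      (-iteratedDeriv 1 gapWidth s / gapWidth s ^ 2) s := fun s =>
    (hasDerivAt_iteratedDeriv_gapWidth 0 s).fun_inv (hw s).ne'
  have hd2 := ((hasDerivAt_iteratedDeriv_gapWidth 1 s).fun_neg.fun_div
    ((hasDerivAt_iteratedDeriv_gapWidth 0 s).fun_pow 2) (pow_ne_zero 2 (hw s).ne'))
  have h1 := h s 1 (by norm_num)
  have h2 := h s 2 (by norm_num)
  have e1 : |-iteratedDeriv 1 gapWidth s / gapWidth s ^ 2| ≤ C * (gapWidth s)⁻¹ := by
    rw [abs_div, abs_neg, abs_of_pos (by have := hw s; positivity : 0 < gapWidth s ^ 2),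
      div_le_iff₀ (by have := hw s; positivity)]
    refine h1.trans_eq ?_
    have := (hw s).ne'
    field_simp
  have key : ∀ x, x ≤ (C + 2 * C ^ 2) * (gapWidth s)⁻¹ → x ≤
      (1 + C + C + 2 * C ^ 2) * (gapWidth s)⁻¹ * 1 ^ i := fun x hx => by
    rw [one_pow, mul_one]; nlinarith
  have hi' : i = 0 ∨ i = 1 ∨ i = 2 := by omega
  rcases hi' with rfl | rfl | rfl
  · rw [iteratedDeriv_zero, abs_of_pos hwi]; nlinarith [mul_pos hC hwi]
  · rw [iteratedDeriv_one, (hd1 s).deriv]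
    apply key
    refine e1.trans ?_
    nlinarith
  · apply key
    rw [iteratedDeriv_succ, iteratedDeriv_one, funext fun s => (hd1 s).deriv]
    simp only [iteratedDeriv_zero] at hd2
    rw [hd2.deriv]
    have e : (-iteratedDeriv (1 + 1) gapWidth s * gapWidth s ^ 2 - -iteratedDeriv 1 gapWidth s *
        ((2 : ℕ) * gapWidth s ^ (2 - 1) * iteratedDeriv (0 + 1) gapWidth s)) / (gapWidth s ^ 2) ^ 2 =
        -(iteratedDeriv 2 gapWidth s / gapWidth s) * (gapWidth s)⁻¹ +
          2 * (iteratedDeriv 1 gapWidth s / gapWidth s) ^ 2 * (gapWidth s)⁻¹ := by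
      have := (hw s).ne'
      field_simp
      push_cast
      ring
    rw [e]
    have b1 : |iteratedDeriv 1 gapWidth s / gapWidth s| ≤ C := by
      rwa [abs_div, abs_of_pos (hw s), div_le_iff₀ (hw s)]
    have b2 : |iteratedDeriv 2 gapWidth s / gapWidth s| ≤ C := by
      rwa [abs_div, abs_of_pos (hw s), div_le_iff₀ (hw s)]
    rw [← add_mul, abs_mul, abs_of_pos hwi]
    gcongr
    refine (abs_add_le _ _).trans (add_le_add (by rwa [abs_neg]) ?_)
    rw [abs_mul, abs_pow, abs_two]
    gcongr

theorem exists_abs_iteratedDeriv_gapEdge_le :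
    ∃ C, 1 ≤ C ∧ ∀ s, ∀ i, 1 ≤ i → i ≤ 2 → |iteratedDeriv i gapEdge s| ≤ C := by
  obtain ⟨C, hC, h⟩ := exists_abs_gapSeries_le
  refine ⟨|leafSlope| + C + 1, by have := abs_nonneg leafSlope; linarith, fun s i h1 h2 => ?_⟩
  set e : ℤ → ℝ := fun n => saw (-(leafSlope * n))
  have he : ∀ n, |e n| ≤ 1 := fun n => abs_saw_le _
  have hd : ∀ s, HasDerivAt gapEdge (leafSlope * 1 + gapSeries 1 e s) s := fun s =>
    ((hasDerivAt_id s).const_mul leafSlope).add (hasDerivAt_gapSeries (by norm_num) he s)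
  have hd2 : HasDerivAt (fun s => leafSlope * 1 + gapSeries 1 e s) (gapSeries 2 e s) s :=
    (hasDerivAt_gapSeries (by norm_num) he s).const_add _
  have := abs_nonneg leafSlope
  have hi' : i = 1 ∨ i = 2 := by omega
  rcases hi' with rfl | rfl
  · rw [iteratedDeriv_one, (hd s).deriv, mul_one]
    refine (abs_add_le _ _).trans ?_
    linarith [h 1 (by norm_num) e he s]
  · rw [iteratedDeriv_succ, iteratedDeriv_one, funext fun s => (hd s).deriv, hd2.deriv]
    linarith [h 2 (by norm_num) e he s]

theorem exists_norm_iteratedFDeriv_gapNum_le : ∃ C, 1 ≤ C ∧ ∀ (p : ℝ × ℝ) (k : ℤ) (i : ℕ),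
    1 ≤ i → i ≤ 2 → ‖iteratedFDeriv ℝ i (fun p' : ℝ × ℝ => p'.1 - gapEdge p'.2 - k) p‖ ≤ C := by
  obtain ⟨C, hC, h⟩ := exists_abs_iteratedDeriv_gapEdge_le
  refine ⟨1 + C, by linarith, fun p k i hi1 hi2 => ?_⟩
  have hi : (i : WithTop ℕ∞) ≤ 2 := by exact_mod_cast hi2
  set f₁ : ℝ × ℝ → ℝ := fun p' => (fun x : ℝ => x - k) (ContinuousLinearMap.fst ℝ ℝ ℝ p') with hf₁
  set f₂ : ℝ × ℝ → ℝ := fun p' => gapEdge (ContinuousLinearMap.snd ℝ ℝ ℝ p') with hf₂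
  have e : (fun p' : ℝ × ℝ => p'.1 - gapEdge p'.2 - k) = f₁ - f₂ := by
    funext p'; simp [hf₁, hf₂]; ring
  have hx : ContDiff ℝ 2 (fun x : ℝ => x - k) := contDiff_id.sub contDiff_const
  have c₁ : ContDiff ℝ 2 f₁ := hx.comp (ContinuousLinearMap.fst ℝ ℝ ℝ).contDiff
  have c₂ : ContDiff ℝ 2 f₂ := contDiff_gapEdge.comp (ContinuousLinearMap.snd ℝ ℝ ℝ).contDiff
  have b₁ : ‖iteratedFDeriv ℝ i f₁ p‖ ≤ 1 := by
    refine (norm_iteratedFDeriv_comp_clm_le hx (ContinuousLinearMap.norm_fst_le ℝ ℝ ℝ) p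
      hi2).trans ?_
    have hd : deriv (fun x : ℝ => x - k) = fun _ => 1 := by funext x; simp
    have hii : i = 1 ∨ i = 2 := by omega
    rcases hii with rfl | rfl
    · rw [iteratedDeriv_one, hd]; simp
    · rw [iteratedDeriv_succ, iteratedDeriv_one, hd]; simp
  have b₂ : ‖iteratedFDeriv ℝ i f₂ p‖ ≤ C :=
    (norm_iteratedFDeriv_comp_clm_le contDiff_gapEdge (ContinuousLinearMap.norm_snd_le ℝ ℝ ℝ) p
      hi2).trans (h _ i hi1 hi2)
  rw [e, iteratedFDeriv_sub_apply (c₁.contDiffAt.of_le hi) (c₂.contDiffAt.of_le hi)]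
  exact (norm_sub_le _ _).trans (add_le_add b₁ b₂)

theorem contDiff_inv_gapWidth : ContDiff ℝ 2 fun s => (gapWidth s)⁻¹ :=
  (contDiff_gapWidth (n := 2)).inv fun s => (gapWidth_pos s).ne'

theorem one_le_inv_gapWidth (s : ℝ) : 1 ≤ (gapWidth s)⁻¹ := by
  rw [one_le_inv₀ (gapWidth_pos s)]
  linarith [gapWidth_le_half s]

/-- The normalized coordinate in the gap varies on the scale of the width. The numerator is at most
`gapWidth` with bounded derivatives, so both factors fit one estimate with scale `C * (gapWidth
p.2)⁻¹`. -/
theorem exists_derivBound_gapCoord : ∃ C, 1 ≤ C ∧ ∀ (p : ℝ × ℝ) (k : ℤ),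
    |p.1 - gapEdge p.2 - k| ≤ gapWidth p.2 → ∀ i, 1 ≤ i → i ≤ 2 →
    ‖iteratedFDeriv ℝ i (fun p' : ℝ × ℝ => (p'.1 - gapEdge p'.2 - k) * (gapWidth p'.2)⁻¹) p‖ ≤
      (C * (gapWidth p.2)⁻¹) ^ i := by
  obtain ⟨C₁, hC₁, h₁⟩ := exists_derivBound_inv_gapWidth
  obtain ⟨C₂, hC₂, h₂⟩ := exists_norm_iteratedFDeriv_gapNum_le
  have h₁' : ∀ p : ℝ × ℝ, DerivBound (fun p' : ℝ × ℝ => (gapWidth p'.2)⁻¹) p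
      (C₁ * (gapWidth p.2)⁻¹) 1 := fun p i hi =>
    (norm_iteratedFDeriv_comp_clm_le (ℓ := ContinuousLinearMap.snd ℝ ℝ ℝ) contDiff_inv_gapWidth
      (ContinuousLinearMap.norm_snd_le ℝ ℝ ℝ) p hi).trans (h₁ p.2 i hi)
  set C := C₁ + C₂ with hC
  have hC1 : 1 ≤ C := by linarith
  refine ⟨4 * C * C, by nlinarith, fun p k hk i hi1 hi2 => ?_⟩
  have hw := gapWidth_pos p.2
  have hW1 := one_le_inv_gapWidth p.2
  have hwW : gapWidth p.2 * (gapWidth p.2)⁻¹ = 1 := mul_inv_cancel₀ hw.ne'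
  set W := (gapWidth p.2)⁻¹ with hW
  have hz : ContDiff ℝ 2 fun p' : ℝ × ℝ => p'.1 - gapEdge p'.2 - k :=
    (contDiff_fst.sub (contDiff_gapEdge.comp contDiff_snd)).sub contDiff_const
  have b2 : DerivBound (fun p' : ℝ × ℝ => (gapWidth p'.2)⁻¹) p (C * W) (C * W) := by
    have := h₁' p
    exact this.mono (by positivity) zero_le_one (by gcongr; linarith) (by nlinarith)
  have b1 : DerivBound (fun p' : ℝ × ℝ => p'.1 - gapEdge p'.2 - k) p (gapWidth p.2) (C * W) := by
    intro j hj
    have hj : j = 0 ∨ j = 1 ∨ j = 2 := by omega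
    rcases hj with rfl | rfl | rfl
    · simpa using hk
    · refine (h₂ p k 1 le_rfl (by norm_num)).trans ?_
      rw [pow_one, mul_left_comm, hwW, mul_one]
      linarith
    · refine (h₂ p k 2 (by norm_num) le_rfl).trans ?_
      have : gapWidth p.2 * (C * W) ^ 2 = C * C * W := by
        calc _ = (gapWidth p.2 * W) * (C * C * W) := by ring
          _ = _ := by rw [hwW, one_mul]
      rw [this]
      nlinarith [mul_nonneg (by nlinarith : 0 ≤ C * C) (by linarith : 0 ≤ W - 1)]
  have := DerivBound.mul hz (contDiff_inv_gapWidth.comp contDiff_snd) b1 b2 hw.le (by positivity)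
    i hi2
  refine this.trans ?_
  have e : 4 * (gapWidth p.2 * (C * W)) = 4 * C := by
    calc _ = 4 * C * (gapWidth p.2 * W) := by ring
      _ = _ := by rw [hwW, mul_one]
  rw [e, mul_pow, mul_pow (4 * C * C), mul_pow (4 * C), ← mul_assoc]
  have : 4 * C ≤ (4 * C) ^ i := le_self_pow₀ (by linarith) (by omega)
  gcongr

/-- A function of `(x, s)` whose derivatives of order `i` are bounded outside the gaps and of
size `gapWidth s ^ (-i)` in the gap at time `s`. -/
structure IsGapFun (U : ℝ × ℝ → ℝ) : Prop where
  contDiff : ContDiff ℝ 2 U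
  bound : ∃ C, 0 < C ∧ ∀ p, |U p| ≤ C ∧ ∀ i, 1 ≤ i → i ≤ 2 →
    ‖iteratedFDeriv ℝ i U p‖ ≤
      C * (1 + {p | InGap p.1 p.2}.indicator (fun p => (gapWidth p.2)⁻¹ ^ i) p)

theorem isGapFun_const (c : ℝ) : IsGapFun fun _ => c where
  contDiff := contDiff_const
  bound := by
    refine ⟨|c| + 1, by positivity, fun p => ⟨by linarith, fun i hi _ => ?_⟩⟩
    rw [iteratedFDeriv_const_of_ne (by omega)]
    simp only [Pi.zero_apply, norm_zero]
    refine mul_nonneg (by positivity) (add_nonneg zero_le_one (indicator_nonneg ?_ _))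
    intro p _
    have := gapWidth_pos p.2
    positivity

theorem IsProfile.exists_bound {σ : ℝ → ℝ} {q : ℝ} (hσ : IsProfile σ q) :
    ∃ M, 0 < M ∧ (∀ r ∈ Icc (0 : ℝ) 1, ∀ i ≤ 2, |iteratedDeriv i σ r| ≤ M) ∧
      ∀ r, 0 ≤ r → |σ r| ≤ M := by
  have h : ∀ i ≤ 2, ∃ M, ∀ r ∈ Icc (0 : ℝ) 1, |iteratedDeriv i σ r| ≤ M := fun i hi =>
    isCompact_Icc.exists_bound_of_continuousOn
      (hσ.contDiff.continuous_iteratedDeriv i (by exact_mod_cast hi)).continuousOn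
  obtain ⟨M₀, h₀⟩ := h 0 (by norm_num)
  obtain ⟨M₁, h₁⟩ := h 1 (by norm_num)
  obtain ⟨M₂, h₂⟩ := h 2 (by norm_num)
  have a0 := le_abs_self M₀
  have a1 := le_abs_self M₁
  have a2 := le_abs_self M₂
  have a3 := abs_nonneg M₀
  have a4 := abs_nonneg M₁
  have a5 := abs_nonneg M₂
  refine ⟨|M₀| + |M₁| + |M₂| + 1, by linarith, fun r hr i hi => ?_, fun r hr => ?_⟩
  · have hi' : i = 0 ∨ i = 1 ∨ i = 2 := by omega
    rcases hi' with rfl | rfl | rfl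
    · linarith [h₀ r hr]
    · linarith [h₁ r hr]
    · linarith [h₂ r hr]
  · rcases le_total r 1 with h1 | h1
    · have := h₀ r ⟨hr, h1⟩
      rw [iteratedDeriv_zero] at this
      linarith
    · have := h₀ 1 (by simp)
      rw [iteratedDeriv_zero, hσ.one 1 le_rfl] at this
      rw [hσ.one r h1]; linarith

theorem exists_bound_iteratedFDeriv_gapStep {σ : ℝ → ℝ} {q : ℝ} (hσ : IsProfile σ q) :
    ∃ C, 0 < C ∧ ∀ p : ℝ × ℝ, ∀ i, 1 ≤ i → i ≤ 2 → ‖iteratedFDeriv ℝ i (gapStep σ q) p‖ ≤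
      C * {p | InGap p.1 p.2}.indicator (fun p => (gapWidth p.2)⁻¹ ^ i) p := by
  obtain ⟨C, hC, h⟩ := exists_derivBound_gapCoord
  obtain ⟨M, hM, hσM, -⟩ := hσ.exists_bound
  refine ⟨2 * M * C ^ 2, by positivity, fun p i hi1 hi2 => ?_⟩
  have hi' : (i : WithTop ℕ∞) ≤ 2 := by exact_mod_cast hi2
  have hw := gapWidth_pos p.2
  by_cases hp : InGap p.1 p.2
  · have hmem : p ∈ {p : ℝ × ℝ | InGap p.1 p.2} := hp
    rw [indicator_of_mem hmem]
    set k := ⌊p.1 - gapEdge p.2⌋ with hk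
    have hI : ContDiff ℝ 2 fun s => (gapWidth s)⁻¹ :=
      (contDiff_gapWidth (n := 2)).inv fun s => (gapWidth_pos s).ne'
    have hu : ContDiff ℝ 2 fun p' : ℝ × ℝ => (p'.1 - gapEdge p'.2 - k) * (gapWidth p'.2)⁻¹ :=
      ((contDiff_fst.sub (contDiff_gapEdge.comp contDiff_snd)).sub contDiff_const).mul
        (hI.comp contDiff_snd)
    have e := (gapStep_eventuallyEq hσ p).iteratedFDeriv ℝ i
    have h0 : 0 ≤ p.1 - gapEdge p.2 - k := Int.fract_nonneg _
    have h1 : p.1 - gapEdge p.2 - k ≤ gapWidth p.2 := inGap_iff.1 hp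
    simp only [div_eq_mul_inv, ← hk] at e
    have e2 : (fun p' : ℝ × ℝ => q * k + σ ((p'.1 - gapEdge p'.2 - k) * (gapWidth p'.2)⁻¹)) =
      (fun _ => q * k) +
        fun p' : ℝ × ℝ => σ ((p'.1 - gapEdge p'.2 - k) * (gapWidth p'.2)⁻¹) := rfl
    have hσu : ContDiff ℝ 2 fun p' : ℝ × ℝ => σ ((p'.1 - gapEdge p'.2 - k) * (gapWidth p'.2)⁻¹) :=
      hσ.contDiff.comp hu
    rw [e.eq_of_nhds, e2, iteratedFDeriv_add_apply contDiffAt_const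
      (hσu.contDiffAt.of_le hi'), iteratedFDeriv_const_of_ne (by omega)]
    simp only [Pi.zero_apply, zero_add]
    have := DerivBound.comp (M := M) (l := C * (gapWidth p.2)⁻¹) hσ.contDiff hu
      (fun j hj => hσM _ ⟨by positivity, by rwa [← div_eq_mul_inv, div_le_one hw]⟩ j hj)
      (fun j h1' h2' => h p k (by rw [abs_of_nonneg h0]; exact h1) j h1' h2') (by positivity) i hi2
    refine this.trans ?_
    rw [mul_pow, ← mul_assoc]
    gcongr
  · have hmem : p ∉ {p : ℝ × ℝ | InGap p.1 p.2} := hp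
    obtain ⟨c, hc⟩ := gapStep_eventuallyEq_const hσ hp
    rw [(hc.iteratedFDeriv ℝ i).eq_of_nhds, iteratedFDeriv_const_of_ne (by omega),
      indicator_of_notMem hmem]
    simp

/-- The bounded function obtained from `gapStep` by subtracting its mean slope. -/
noncomputable def gapOsc (σ : ℝ → ℝ) (q : ℝ) (p : ℝ × ℝ) : ℝ :=
  gapStep σ q p - q * (p.1 - leafSlope * p.2)

/-- Boundedness holds because `gapEdge s` stays within `1/2` of `leafSlope * s` and the floor within
`1` of its argument; subtracting a linear map affects only the first derivative. -/
theorem isGapFun_gapOsc {σ : ℝ → ℝ} {q : ℝ} (hσ : IsProfile σ q) : IsGapFun (gapOsc σ q) where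
  contDiff := (contDiff_gapStep hσ).sub (by fun_prop)
  bound := by
    obtain ⟨C, hC, h⟩ := exists_bound_iteratedFDeriv_gapStep hσ
    obtain ⟨M, hM, -, hσM⟩ := hσ.exists_bound
    set ℓ : ℝ × ℝ →L[ℝ] ℝ := q • (ContinuousLinearMap.fst ℝ ℝ ℝ -
      leafSlope • ContinuousLinearMap.snd ℝ ℝ ℝ)
    have hℓ : (fun p : ℝ × ℝ => q * (p.1 - leafSlope * p.2)) = ℓ := by
      funext p; simp [ℓ]
    refine ⟨C + ‖ℓ‖ + 2 * |q| + M, by positivity, fun p => ⟨?_, fun i hi1 hi2 => ?_⟩⟩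
    · have hE : gapEdge p.2 - leafSlope * p.2 ∈ Icc (0 : ℝ) (1 / 2) := by
        have := gapSeries_zero_mem (fun n : ℤ => saw_nonneg (-(leafSlope * n)))
          (fun n => saw_le_one _) p.2
        simpa [gapEdge] using this
      have hf0 := Int.fract_nonneg (p.1 - gapEdge p.2)
      have hf1 := (Int.fract_lt_one (p.1 - gapEdge p.2)).le
      have e : gapOsc σ q p = -(q * (Int.fract (p.1 - gapEdge p.2) +
          (gapEdge p.2 - leafSlope * p.2))) +
          σ (Int.fract (p.1 - gapEdge p.2) / gapWidth p.2) := by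
        have := Int.floor_add_fract (p.1 - gapEdge p.2)
        rw [gapOsc, gapStep]
        linear_combination q * this
      rw [e]
      refine (abs_add_le _ _).trans ?_
      rw [abs_neg, abs_mul, abs_of_nonneg (add_nonneg hf0 hE.1)]
      have h1 := hσM (Int.fract (p.1 - gapEdge p.2) / gapWidth p.2)
        (div_nonneg hf0 (gapWidth_pos _).le)
      have h2 := norm_nonneg ℓ
      have h3 := mul_le_mul_of_nonneg_left
        (show Int.fract (p.1 - gapEdge p.2) + (gapEdge p.2 - leafSlope * p.2) ≤ 2 by
          linarith [hE.2]) (abs_nonneg q)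
      linarith
    · have hi' : (i : WithTop ℕ∞) ≤ 2 := by exact_mod_cast hi2
      have e : gapOsc σ q = gapStep σ q - ℓ := by rw [← hℓ]; rfl
      rw [e, iteratedFDeriv_sub_apply ((contDiff_gapStep hσ).contDiffAt.of_le hi')
        ℓ.contDiff.contDiffAt]
      have h1 : ‖iteratedFDeriv ℝ i ℓ p‖ ≤ ‖ℓ‖ := by
        have hii : i = 1 ∨ i = 2 := by omega
        rcases hii with rfl | rfl
        · rw [norm_iteratedFDeriv_one, ContinuousLinearMap.fderiv]
        · rw [show 2 = 1 + 1 from rfl, ← norm_iteratedFDeriv_fderiv, norm_iteratedFDeriv_one]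
          have : fderiv ℝ (ℓ : ℝ × ℝ → ℝ) = fun _ => ℓ := by funext p; simp
          rw [this]; simp
      have hI : 0 ≤ {p : ℝ × ℝ | InGap p.1 p.2}.indicator (fun p => (gapWidth p.2)⁻¹ ^ i) p := by
        refine indicator_nonneg (fun p _ => ?_) _
        have := gapWidth_pos p.2
        positivity
      calc _ ≤ _ := norm_sub_le _ _
        _ ≤ C * _ + ‖ℓ‖ := add_le_add (h p i hi1 hi2) h1
        _ ≤ _ := by
          have := norm_nonneg ℓ
          have := abs_nonneg q
          nlinarith [mul_nonneg (by linarith : 0 ≤ ‖ℓ‖ + 2 * |q| + M) hI]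

end Profiles

/-! ### Sums of translates over the gaps and their differentiability -/

section GapSums

open Filter Real

/-- The size of the derivatives in the gap at time `s` of the summands of a convergent series. -/
noncomputable def gapDecayRate (s : ℝ) : ℝ :=
  (bracket s)⁻¹ + (bracket s)⁻¹ ^ 2 * (gapWidth s)⁻¹

theorem gapDecayRate_pos (s : ℝ) : 0 < gapDecayRate s := by
  have := bracket_pos s
  have := gapWidth_pos s
  unfold gapDecayRate; positivity

theorem tendsto_gapDecayRate : Tendsto (fun n : ℤ => gapDecayRate n) cofinite (𝓝 0) := by
  -- Any exponent strictly between `1` and `2` would make `⟨n⟩⁻² / gapWidth n` tend to zero.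
  obtain ⟨C, hC, h⟩ := exists_inv_gapWidth_le (p := 3 / 2) (by norm_num)
  have h1 : Tendsto (fun n : ℤ => bracket n) cofinite atTop := by
    refine tendsto_atTop_mono (fun n => abs_le_bracket n) ?_
    rw [Int.cofinite_eq, tendsto_sup]
    exact ⟨tendsto_abs_atBot_atTop.comp (tendsto_intCast_atBot_iff.2 tendsto_id),
      tendsto_abs_atTop_atTop.comp tendsto_intCast_atTop_atTop⟩
  have h2 : Tendsto (fun n : ℤ => (bracket n)⁻¹ + C * bracket n ^ (-(1 / 2) : ℝ)) cofinite
      (𝓝 (0 + C * 0)) :=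
    (tendsto_inv_atTop_zero.comp h1).add
      (((tendsto_rpow_neg_atTop (by norm_num : (0 : ℝ) < 1 / 2)).comp h1).const_mul C)
  rw [mul_zero, add_zero] at h2
  refine squeeze_zero (fun n => (gapDecayRate_pos n).le) (fun n => ?_) h2
  have hb := bracket_pos n
  refine add_le_add_right ?_ _
  calc (bracket n)⁻¹ ^ 2 * (gapWidth n)⁻¹ ≤ (bracket n)⁻¹ ^ 2 * (C * bracket n ^ (3 / 2 : ℝ)) := by
        gcongr; exact h n
    _ = C * (bracket n ^ (-2 : ℝ) * bracket n ^ (3 / 2 : ℝ)) := by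
        rw [rpow_neg hb.le, inv_pow, rpow_two]; ring
    _ = _ := by rw [← rpow_add hb]; norm_num

theorem exists_gapDecayRate_shift_le (R : ℝ) : ∃ C, 0 < C ∧ ∀ y, |y| ≤ R → ∀ n : ℤ,
    gapWidth (y + n) ≤ C * gapWidth n ∧ gapDecayRate (y + n) ≤ C * gapDecayRate n := by
  obtain ⟨C₀, hC₀, h₀⟩ := exists_gapWidth_le_exp_mul
  refine ⟨exp (C₀ * R) + exp R + exp R ^ 2 * exp (C₀ * R), by positivity, fun y hy n => ?_⟩
  have hw := gapWidth_pos n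
  have hw' := gapWidth_pos (y + n)
  have hb := bracket_pos n
  have hb' := bracket_pos (y + n)
  have e1 : gapWidth (y + n) ≤ exp (C₀ * R) * gapWidth n := by
    refine (h₀ n (y + n)).trans ?_
    gcongr
    simpa using hy
  have e2 : (gapWidth (y + n))⁻¹ ≤ exp (C₀ * R) * (gapWidth n)⁻¹ := by
    rw [← div_eq_mul_inv, le_div_iff₀ hw, inv_mul_le_iff₀ hw', mul_comm]
    refine (h₀ (y + n) n).trans ?_
    gcongr
    simpa using hy
  have e3 : (bracket (y + n))⁻¹ ≤ exp R * (bracket n)⁻¹ := by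
    rw [← div_eq_mul_inv, le_div_iff₀ hb, inv_mul_le_iff₀ hb', mul_comm]
    refine (bracket_le_exp_mul (y + n) n).trans ?_
    gcongr
    simpa using hy
  have p1 := exp_pos (C₀ * R)
  have p2 := exp_pos R
  refine ⟨e1.trans ?_, ?_⟩
  · gcongr; nlinarith [mul_pos (pow_pos p2 2) p1]
  · unfold gapDecayRate
    calc (bracket (y + n))⁻¹ + (bracket (y + n))⁻¹ ^ 2 * (gapWidth (y + n))⁻¹
        ≤ exp R * (bracket n)⁻¹ + (exp R * (bracket n)⁻¹) ^ 2 * (exp (C₀ * R) * (gapWidth n)⁻¹) := by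
          gcongr
      _ = exp R * (bracket n)⁻¹ + exp R ^ 2 * exp (C₀ * R) *
            ((bracket n)⁻¹ ^ 2 * (gapWidth n)⁻¹) := by ring
      _ ≤ _ := by
          rw [mul_add]
          gcongr
          · nlinarith [mul_pos (pow_pos p2 2) p1]
          · linarith

/-- The gap at time `s` in the space of all `(t, x, s)`. -/
def gapRegion : Set (ℝ × ℝ × ℝ) := {p | InGap p.2.1 p.2.2}

/-- A function of `(t, x, s)` whose translates by integers in `s` can be summed, together with
their derivatives of order at most `K`. -/
structure IsGapSummand (K : ℕ) (F : ℝ × ℝ × ℝ → ℝ) : Prop where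
  contDiff : ContDiff ℝ 2 F
  bound : ∃ C, 0 < C ∧ ∀ p, ∀ i ≤ K, ‖iteratedFDeriv ℝ i F p‖ ≤
    C * (gapWidth p.2.2 + gapRegion.indicator (fun p => gapDecayRate p.2.2) p)

/-- The sum of the translates of `F` by integers in `s`. -/
noncomputable def gapSum (F : ℝ × ℝ × ℝ → ℝ) (p : ℝ × ℝ × ℝ) : ℝ :=
  ∑' n : ℤ, F (p.1, p.2.1, p.2.2 + n)

theorem gapSum_add_int (F : ℝ × ℝ × ℝ → ℝ) (t x y : ℝ) (m : ℤ) :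
    gapSum F (t, x, y + m) = gapSum F (t, x, y) := by
  unfold gapSum
  rw [← (Equiv.addLeft m).tsum_eq (fun n => F (t, x, y + n))]
  refine tsum_congr fun n => ?_
  simp [add_assoc]

theorem add_shift_eq (p : ℝ × ℝ × ℝ) (n : ℤ) :
    p + ((0, 0, (n : ℝ)) : ℝ × ℝ × ℝ) = (p.1, p.2.1, p.2.2 + n) := by
  ext <;> simp

theorem iteratedFDeriv_shift (F : ℝ × ℝ × ℝ → ℝ) (n : ℤ) (i : ℕ) (p : ℝ × ℝ × ℝ) :
    iteratedFDeriv ℝ i (fun p : ℝ × ℝ × ℝ => F (p.1, p.2.1, p.2.2 + n)) p =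
      iteratedFDeriv ℝ i F (p.1, p.2.1, p.2.2 + n) := by
  have := iteratedFDeriv_comp_add_right (𝕜 := ℝ) (f := F) i ((0, 0, (n : ℝ)) : ℝ × ℝ × ℝ) p
  simpa only [add_shift_eq] using this

theorem fderiv_shift (F : ℝ × ℝ × ℝ → ℝ) (n : ℤ) (p : ℝ × ℝ × ℝ) :
    fderiv ℝ (fun p : ℝ × ℝ × ℝ => F (p.1, p.2.1, p.2.2 + n)) p =
      fderiv ℝ F (p.1, p.2.1, p.2.2 + n) := by
  have := fderiv_comp_add_right (𝕜 := ℝ) (f := F) (x := p) ((0, 0, (n : ℝ)) : ℝ × ℝ × ℝ)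
  simpa only [add_shift_eq] using this

theorem contDiff_shift {F : ℝ × ℝ × ℝ → ℝ} {N : WithTop ℕ∞} (hF : ContDiff ℝ N F) (n : ℤ) :
    ContDiff ℝ N fun p : ℝ × ℝ × ℝ => F (p.1, p.2.1, p.2.2 + n) := by
  have h : ContDiff ℝ N fun p : ℝ × ℝ × ℝ => ((p.1, p.2.1, p.2.2 + n) : ℝ × ℝ × ℝ) := by fun_prop
  exact hF.comp h

theorem IsGapSummand.exists_bound {K : ℕ} {F : ℝ × ℝ × ℝ → ℝ} (hF : IsGapSummand K F) (R : ℝ) :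
    ∃ C, 0 < C ∧ ∀ i ≤ K, ∀ n : ℤ, ∀ p ∈ {p : ℝ × ℝ × ℝ | |p.2.2| < R},
      ‖iteratedFDeriv ℝ i (fun p : ℝ × ℝ × ℝ => F (p.1, p.2.1, p.2.2 + n)) p‖ ≤ C * gapWidth n +
        {p : ℝ × ℝ × ℝ | InGap p.2.1 (p.2.2 + n)}.indicator (fun _ => C * gapDecayRate n) p := by
  obtain ⟨C₁, hC₁, h₁⟩ := hF.bound
  obtain ⟨C₂, hC₂, h₂⟩ := exists_gapDecayRate_shift_le R
  refine ⟨C₁ * C₂, by positivity, fun i hi n p hp => ?_⟩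
  rw [iteratedFDeriv_shift]
  refine (h₁ _ i hi).trans ?_
  obtain ⟨h3, h4⟩ := h₂ p.2.2 (le_of_lt hp) n
  rw [mul_add]
  refine add_le_add ?_ ?_
  · rw [mul_assoc]; gcongr
  · by_cases hg : InGap p.2.1 (p.2.2 + n)
    · rw [indicator_of_mem (show (p.1, p.2.1, p.2.2 + (n : ℝ)) ∈ gapRegion from hg),
        indicator_of_mem (show p ∈ {p : ℝ × ℝ × ℝ | InGap p.2.1 (p.2.2 + n)} from hg), mul_assoc]
      gcongr
    · rw [indicator_of_notMem (show (p.1, p.2.1, p.2.2 + (n : ℝ)) ∉ gapRegion from hg),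
        indicator_of_notMem (show p ∉ {p : ℝ × ℝ × ℝ | InGap p.2.1 (p.2.2 + n)} from hg), mul_zero]

theorem isOpen_slab (R : ℝ) : IsOpen {p : ℝ × ℝ × ℝ | |p.2.2| < R} :=
  isOpen_lt (by fun_prop) (by fun_prop)

/-- On a strip of bounded `y` the integer translates satisfy the hypotheses of the disjoint series
theorem: the widths are summable, the closed gaps disjoint, and the decay rates tend to zero. -/
theorem IsGapSummand.contDiff_two {F : ℝ × ℝ × ℝ → ℝ} (hF : IsGapSummand 2 F) :
    ContDiff ℝ 2 (gapSum F) := by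
  rw [contDiff_iff_contDiffAt]
  intro p
  obtain ⟨C, hC, h⟩ := hF.exists_bound (|p.2.2| + 1)
  have hp : p ∈ {q : ℝ × ℝ × ℝ | |q.2.2| < |p.2.2| + 1} := lt_add_one |p.2.2|
  refine (contDiffOn_two_tsum_of_disjoint (S := fun n : ℤ => {p : ℝ × ℝ × ℝ | InGap p.2.1 (p.2.2 + n)})
    (u := fun n : ℤ => C * gapWidth n) (g := fun n : ℤ => C * gapDecayRate n)
     (isOpen_slab _) (summable_gapWidth_int.mul_left C)
    (by have := tendsto_gapDecayRate.const_mul C; rwa [mul_zero] at this) (fun q _ n m hn hm => InGap.eq hn hm)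
    (fun n => contDiff_shift hF.contDiff n) h).contDiffAt ((isOpen_slab _).mem_nhds hp)

theorem IsGapSummand.exists_bound_one {K : ℕ} {F : ℝ × ℝ × ℝ → ℝ} (hF : IsGapSummand K F)
    (hK : 1 ≤ K) (R : ℝ) :
    ∃ C, 0 < C ∧ ∀ n : ℤ, ∀ p ∈ {p : ℝ × ℝ × ℝ | |p.2.2| < R},
      ‖F (p.1, p.2.1, p.2.2 + n)‖ ≤ C * gapWidth n +
        {p : ℝ × ℝ × ℝ | InGap p.2.1 (p.2.2 + n)}.indicator (fun _ => C * gapDecayRate n) p ∧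
      ‖fderiv ℝ F (p.1, p.2.1, p.2.2 + n)‖ ≤ C * gapWidth n +
        {p : ℝ × ℝ × ℝ | InGap p.2.1 (p.2.2 + n)}.indicator (fun _ => C * gapDecayRate n) p := by
  obtain ⟨C, hC, h⟩ := hF.exists_bound R
  refine ⟨C, hC, fun n p hp => ⟨?_, ?_⟩⟩
  · simpa only [norm_iteratedFDeriv_zero] using h 0 (Nat.zero_le _) n p hp
  · rw [← fderiv_shift, ← norm_iteratedFDeriv_one]
    exact h 1 hK n p hp

theorem IsGapSummand.contDiff_one {F : ℝ × ℝ × ℝ → ℝ} (hF : IsGapSummand 1 F) :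
    ContDiff ℝ 1 (gapSum F) := by
  rw [contDiff_iff_contDiffAt]
  intro p
  obtain ⟨C, hC, h⟩ := hF.exists_bound_one le_rfl (|p.2.2| + 1)
  have hp : p ∈ {q : ℝ × ℝ × ℝ | |q.2.2| < |p.2.2| + 1} := lt_add_one |p.2.2|
  refine (contDiffOn_one_tsum_of_disjoint (S := fun n : ℤ => {p : ℝ × ℝ × ℝ | InGap p.2.1 (p.2.2 + n)})
    (u := fun n : ℤ => C * gapWidth n) (g := fun n : ℤ => C * gapDecayRate n)
     (isOpen_slab _) (summable_gapWidth_int.mul_left C)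
    (by have := tendsto_gapDecayRate.const_mul C; rwa [mul_zero] at this) (fun q _ n m hn hm => InGap.eq hn hm)
    (fun n => contDiff_shift (hF.contDiff.of_le one_le_two) n) (fun n p hp => (h n p hp).1)
    (fun n p hp => ?_)).contDiffAt ((isOpen_slab _).mem_nhds hp)
  rw [fderiv_shift]
  exact (h n p hp).2

theorem IsGapSummand.hasFDerivAt {K : ℕ} {F : ℝ × ℝ × ℝ → ℝ} (hF : IsGapSummand K F) (hK : 1 ≤ K)
    (p : ℝ × ℝ × ℝ) :
    HasFDerivAt (gapSum F) (∑' n : ℤ, fderiv ℝ F (p.1, p.2.1, p.2.2 + n)) p := by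
  obtain ⟨C, hC, h⟩ := hF.exists_bound_one hK (|p.2.2| + 1)
  have hp : p ∈ {q : ℝ × ℝ × ℝ | |q.2.2| < |p.2.2| + 1} := lt_add_one |p.2.2|
  refine hasFDerivAt_tsum_of_disjoint (S := fun n : ℤ => {p : ℝ × ℝ × ℝ | InGap p.2.1 (p.2.2 + n)})
    (u := fun n : ℤ => C * gapWidth n) (g := fun n : ℤ => C * gapDecayRate n)

    (f' := fun (n : ℤ) (p : ℝ × ℝ × ℝ) => fderiv ℝ F (p.1, p.2.1, p.2.2 + n))
    (isOpen_slab _) (summable_gapWidth_int.mul_left C)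
    (by have := tendsto_gapDecayRate.const_mul C; rwa [mul_zero] at this) (fun q _ n m hn hm => InGap.eq hn hm)
    (fun n q _ => ?_) (fun n p hp => (h n p hp).1) (fun n p hp => (h n p hp).2) hp
  rw [← fderiv_shift]
  exact ((contDiff_shift hF.contDiff n).differentiable two_ne_zero q).hasFDerivAt

theorem IsGapSummand.summable {K : ℕ} {F : ℝ × ℝ × ℝ → ℝ} (hF : IsGapSummand K F) (hK : 1 ≤ K)
    (t x y : ℝ) : Summable fun n : ℤ => F (t, x, y + n) := by
  obtain ⟨C, hC, h⟩ := hF.exists_bound_one hK (|y| + 1)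
  exact summable_of_disjoint_bound (S := fun n : ℤ => {p : ℝ × ℝ × ℝ | InGap p.2.1 (p.2.2 + n)})
    (u := fun n : ℤ => C * gapWidth n) (g := fun n : ℤ => C * gapDecayRate n)
     (f := fun (n : ℤ) (p : ℝ × ℝ × ℝ) => F (p.1, p.2.1, p.2.2 + n))
    (p := (t, x, y)) (summable_gapWidth_int.mul_left C) (fun n m hn hm => InGap.eq hn hm)
    fun n => (h n (t, x, y) (lt_add_one |y|)).1

theorem IsGapSummand.summable_fderiv {K : ℕ} {F : ℝ × ℝ × ℝ → ℝ} (hF : IsGapSummand K F)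
    (hK : 1 ≤ K) (t x y : ℝ) : Summable fun n : ℤ => fderiv ℝ F (t, x, y + n) := by
  obtain ⟨C, hC, h⟩ := hF.exists_bound_one hK (|y| + 1)
  exact summable_of_disjoint_bound (S := fun n : ℤ => {p : ℝ × ℝ × ℝ | InGap p.2.1 (p.2.2 + n)})
    (u := fun n : ℤ => C * gapWidth n) (g := fun n : ℤ => C * gapDecayRate n)

    (f := fun (n : ℤ) (p : ℝ × ℝ × ℝ) => fderiv ℝ F (p.1, p.2.1, p.2.2 + n))
    (p := (t, x, y)) (summable_gapWidth_int.mul_left C) (fun n m hn hm => InGap.eq hn hm)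
    fun n => (h n (t, x, y) (lt_add_one |y|)).2

/-- Differentiation of a gap sum along a direction. -/
theorem IsGapSummand.hasSum_fderiv_apply {K : ℕ} {F : ℝ × ℝ × ℝ → ℝ} (hF : IsGapSummand K F)
    (hK : 1 ≤ K) (t x y : ℝ) (v : ℝ × ℝ × ℝ) :
    HasSum (fun n : ℤ => fderiv ℝ F (t, x, y + n) v) (fderiv ℝ (gapSum F) (t, x, y) v) := by
  rw [(hF.hasFDerivAt hK (t, x, y)).fderiv]
  exact (ContinuousLinearMap.apply ℝ ℝ v).hasSum (hF.summable_fderiv hK t x y).hasSum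

/-- A function of `(t, x, s)` with derivatives of order `i` of size
`gapWidth s * ⟨s⟩ ^ (i - K)`. -/
structure IsGapCoeff (K : ℕ) (c : ℝ × ℝ × ℝ → ℝ) : Prop where
  contDiff : ContDiff ℝ 2 c
  bound : ∃ C, 0 < C ∧ ∀ p, ∀ i ≤ K, ‖iteratedFDeriv ℝ i c p‖ * bracket p.2.2 ^ K ≤
    C * gapWidth p.2.2 * bracket p.2.2 ^ i

theorem norm_iteratedFDeriv_comp_snd_le {U : ℝ × ℝ → ℝ} (hU : ContDiff ℝ 2 U) (p : ℝ × ℝ × ℝ)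
    {i : ℕ} (hi : i ≤ 2) :
    ‖iteratedFDeriv ℝ i (fun p : ℝ × ℝ × ℝ => U p.2) p‖ ≤ ‖iteratedFDeriv ℝ i U p.2‖ := by
  have := ContinuousLinearMap.iteratedFDeriv_comp_right (ContinuousLinearMap.snd ℝ ℝ (ℝ × ℝ)) hU p
    (i := i) (by exact_mod_cast hi)
  simp only [Function.comp_def, ContinuousLinearMap.coe_snd'] at this
  rw [this]
  refine (ContinuousMultilinearMap.norm_compContinuousLinearMap_le _ _).trans ?_
  exact mul_le_of_le_one_right (norm_nonneg _) (Finset.prod_le_one (fun _ _ => norm_nonneg _)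
    fun _ _ => ContinuousLinearMap.norm_snd_le ℝ ℝ (ℝ × ℝ))

/-- The cases `i = 1` and `i = 2` account for the two terms of `gapDecayRate`. -/
theorem gapWidth_mul_le_gapDecayRate {K i j : ℕ} (hK : K ≤ 2) (hij : j + i ≤ K) (hi : 1 ≤ i)
    (s : ℝ) : gapWidth s * bracket s ^ j * (gapWidth s)⁻¹ ^ i ≤ gapDecayRate s * bracket s ^ K := by
  have hw := gapWidth_pos s
  have hb := bracket_pos s
  have hb1 := one_le_bracket s
  have hW : 0 < (gapWidth s)⁻¹ := inv_pos.2 hw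
  have hB : 0 < (bracket s)⁻¹ := inv_pos.2 hb
  have e1 : bracket s ^ j ≤ bracket s ^ (K - i) := pow_le_pow_right₀ hb1 (by omega)
  have hKi : bracket s ^ K = bracket s ^ (K - i) * bracket s ^ i := by
    rw [← pow_add]; congr 1; omega
  have hii : i = 1 ∨ i = 2 := by omega
  have key : gapWidth s * (gapWidth s)⁻¹ ^ i ≤ gapDecayRate s * bracket s ^ i := by
    rw [gapDecayRate, add_mul]
    rcases hii with rfl | rfl
    · have : (bracket s)⁻¹ * bracket s ^ 1 = 1 := by field_simp
      rw [this, pow_one, mul_inv_cancel₀ hw.ne']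
      have : 0 < (bracket s)⁻¹ ^ 2 * (gapWidth s)⁻¹ * bracket s ^ 1 := by positivity
      linarith
    · have h1 : (bracket s)⁻¹ ^ 2 * (gapWidth s)⁻¹ * bracket s ^ 2 = (gapWidth s)⁻¹ := by
        field_simp
      have h2 : gapWidth s * (gapWidth s)⁻¹ ^ 2 = (gapWidth s)⁻¹ := by field_simp
      rw [h1, h2]
      have : 0 < (bracket s)⁻¹ * bracket s ^ 2 := by positivity
      linarith
  calc _ = bracket s ^ j * (gapWidth s * (gapWidth s)⁻¹ ^ i) := by ring
    _ ≤ bracket s ^ (K - i) * (gapDecayRate s * bracket s ^ i) := by gcongr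
    _ = _ := by rw [hKi]; ring

/-- In the Leibniz formula a derivative on `c` costs one power of the bracket, and a derivative on
`U` costs one inverse width, only inside the gap. The reserve `⟨s⟩ ^ (-K)` in `c` pays for `K`
derivatives in all. -/
theorem IsGapCoeff.isGapSummand {K : ℕ} (hK : K ≤ 2) {c : ℝ × ℝ × ℝ → ℝ} (hc : IsGapCoeff K c)
    {U : ℝ × ℝ → ℝ} (hU : IsGapFun U) : IsGapSummand K fun p => c p * U p.2 where
  contDiff := hc.contDiff.mul (hU.contDiff.comp contDiff_snd)
  bound := by
    obtain ⟨C₁, hC₁, h₁⟩ := hc.bound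
    obtain ⟨C₂, hC₂, h₂⟩ := hU.bound
    refine ⟨4 * (C₁ * C₂), by positivity, fun p i hi => ?_⟩
    have hb := bracket_pos p.2.2
    have hb1 := one_le_bracket p.2.2
    have hw := gapWidth_pos p.2.2
    have hbK : 0 < bracket p.2.2 ^ K := by positivity
    set s := p.2.2 with hs
    have hUc : ContDiff ℝ 2 fun p : ℝ × ℝ × ℝ => U p.2 := hU.contDiff.comp contDiff_snd
    set ind := gapRegion.indicator (fun p => gapDecayRate p.2.2) p with hind
    have hind0 : 0 ≤ ind := indicator_nonneg (fun p _ => (gapDecayRate_pos _).le) _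
    have key : ∀ j ≤ i, ‖iteratedFDeriv ℝ j c p‖ *
        ‖iteratedFDeriv ℝ (i - j) (fun p : ℝ × ℝ × ℝ => U p.2) p‖ ≤
          C₁ * C₂ * (gapWidth s + ind) := fun j hj => by
      have g1 : ‖iteratedFDeriv ℝ j c p‖ ≤ C₁ * gapWidth s * bracket s ^ j / bracket s ^ K := by
        rw [le_div_iff₀ hbK]; exact h₁ p j (hj.trans hi)
      have g0 : C₁ * gapWidth s * bracket s ^ j / bracket s ^ K ≤ C₁ * gapWidth s := by
        rw [div_le_iff₀ hbK]
        have : bracket s ^ j ≤ bracket s ^ K := pow_le_pow_right₀ hb1 (hj.trans hi)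
        gcongr
      rcases Nat.eq_zero_or_pos (i - j) with h0 | h0
      · rw [h0]
        have g2 : ‖iteratedFDeriv ℝ 0 (fun p : ℝ × ℝ × ℝ => U p.2) p‖ ≤ C₂ := by
          rw [norm_iteratedFDeriv_zero]; exact (h₂ p.2).1
        calc _ ≤ (C₁ * gapWidth s) * C₂ :=
              mul_le_mul (g1.trans g0) g2 (norm_nonneg _) (by positivity)
          _ ≤ _ := by nlinarith [mul_nonneg (mul_pos hC₁ hC₂).le hind0]
      · have g2 := (norm_iteratedFDeriv_comp_snd_le hU.contDiff p (i := i - j) (by omega)).trans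
          ((h₂ p.2).2 (i - j) h0 (by omega))
        have g3 : C₁ * gapWidth s * bracket s ^ j / bracket s ^ K *
            {p : ℝ × ℝ | InGap p.1 p.2}.indicator (fun p => (gapWidth p.2)⁻¹ ^ (i - j)) p.2 ≤
              C₁ * ind := by
          by_cases hg : InGap p.2.1 p.2.2
          · rw [hind, indicator_of_mem (show p ∈ gapRegion from hg),
              indicator_of_mem (show p.2 ∈ {p : ℝ × ℝ | InGap p.1 p.2} from hg), ← hs,
              div_mul_eq_mul_div, div_le_iff₀ hbK]
            have := gapWidth_mul_le_gapDecayRate hK (i := i - j) (j := j) (by omega) h0 s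
            calc _ = C₁ * (gapWidth s * bracket s ^ j * (gapWidth s)⁻¹ ^ (i - j)) := by ring
              _ ≤ C₁ * (gapDecayRate s * bracket s ^ K) := by gcongr
              _ = _ := by ring
          · rw [hind, indicator_of_notMem (show p ∉ gapRegion from hg),
              indicator_of_notMem (show p.2 ∉ {p : ℝ × ℝ | InGap p.1 p.2} from hg)]
            simp
        calc _ ≤ (C₁ * gapWidth s * bracket s ^ j / bracket s ^ K) * (C₂ * (1 +
              {p : ℝ × ℝ | InGap p.1 p.2}.indicator (fun p => (gapWidth p.2)⁻¹ ^ (i - j)) p.2)) :=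
              mul_le_mul g1 g2 (norm_nonneg _) (by positivity)
          _ = C₂ * (C₁ * gapWidth s * bracket s ^ j / bracket s ^ K +
              C₁ * gapWidth s * bracket s ^ j / bracket s ^ K *
              {p : ℝ × ℝ | InGap p.1 p.2}.indicator (fun p => (gapWidth p.2)⁻¹ ^ (i - j)) p.2) := by
              ring
          _ ≤ C₂ * (C₁ * gapWidth s + C₁ * ind) := by gcongr
          _ = _ := by ring
    refine (norm_iteratedFDeriv_mul_le hc.contDiff hUc p (n := i)
      (by exact_mod_cast hi.trans hK)).trans ?_
    calc _ ≤ ∑ j ∈ Finset.range (i + 1), (i.choose j : ℝ) * (C₁ * C₂ * (gapWidth s + ind)) := by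
          refine Finset.sum_le_sum fun j hj => ?_
          rw [mul_assoc]
          exact mul_le_mul_of_nonneg_left (key j (by simpa [Nat.lt_succ_iff] using hj))
            (Nat.cast_nonneg _)
      _ = 2 ^ i * (C₁ * C₂ * (gapWidth s + ind)) := by
          rw [← Finset.sum_mul]
          congr 1
          exact_mod_cast Nat.sum_range_choose i
      _ ≤ 4 * (C₁ * C₂ * (gapWidth s + ind)) := by
          refine mul_le_mul_of_nonneg_right ?_ (by positivity)
          calc (2 : ℝ) ^ i ≤ 2 ^ 2 := pow_le_pow_right₀ (by norm_num) (hi.trans hK)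
            _ = 4 := by norm_num
      _ = _ := by ring

end GapSums

/-! ### Size of the coefficients of the field, the energy, the barrier and the flux -/

section Coefficients

open Filter Real

theorem derivBound_iff {f : ℝ → ℝ} {s A l : ℝ} :
    DerivBound f s A l ↔ ∀ i ≤ 2, |iteratedDeriv i f s| ≤ A * l ^ i := by
  simp only [DerivBound, norm_iteratedFDeriv_eq_norm_iteratedDeriv, norm_eq_abs]

/-- The projection of `(t, x, s)` to `s`. -/
noncomputable def timeCLM : ℝ × ℝ × ℝ →L[ℝ] ℝ :=
  (ContinuousLinearMap.snd ℝ ℝ ℝ).comp (ContinuousLinearMap.snd ℝ ℝ (ℝ × ℝ))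

theorem norm_timeCLM_le : ‖timeCLM‖ ≤ 1 :=
  (ContinuousLinearMap.opNorm_comp_le _ _).trans (mul_le_one₀ (ContinuousLinearMap.norm_snd_le _ _ _)
    (norm_nonneg _) (ContinuousLinearMap.norm_snd_le _ _ _))

theorem DerivBound.comp_time {g : ℝ → ℝ} {p : ℝ × ℝ × ℝ} {A l : ℝ} (hg : ContDiff ℝ 2 g)
    (h : DerivBound g p.2.2 A l) : DerivBound (fun p : ℝ × ℝ × ℝ => g p.2.2) p A l :=
  DerivBound.comp_clm (ℓ := timeCLM) hg norm_timeCLM_le (derivBound_iff.1 h)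

theorem isGapCoeff_of_derivBound {K : ℕ} (hK : K ≤ 2) {c : ℝ × ℝ × ℝ → ℝ} (hc : ContDiff ℝ 2 c)
    {C L : ℝ} (hC : 0 < C) (hL : 1 ≤ L)
    (h : ∀ p, DerivBound c p (C * gapWidth p.2.2 * (bracket p.2.2)⁻¹ ^ K) (L * bracket p.2.2)) :
    IsGapCoeff K c where
  contDiff := hc
  bound := by
    refine ⟨C * L ^ 2, by positivity, fun p i hi => ?_⟩
    have hb := bracket_pos p.2.2
    have hw := gapWidth_pos p.2.2
    have h1 : L ^ i ≤ L ^ 2 := pow_le_pow_right₀ hL (hi.trans hK)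
    calc _ ≤ C * gapWidth p.2.2 * (bracket p.2.2)⁻¹ ^ K * (L * bracket p.2.2) ^ i *
          bracket p.2.2 ^ K := mul_le_mul_of_nonneg_right (h p i (hi.trans hK)) (by positivity)
      _ = C * gapWidth p.2.2 * bracket p.2.2 ^ i * L ^ i := by
          rw [inv_pow, mul_pow]; field_simp
      _ ≤ C * gapWidth p.2.2 * bracket p.2.2 ^ i * L ^ 2 := by gcongr
      _ = _ := by ring

theorem isGapCoeff_of_time {K : ℕ} (hK : K ≤ 2) {g : ℝ → ℝ} (hg : ContDiff ℝ 2 g) {C : ℝ}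
    (hC : 0 < C) (h : ∀ s, DerivBound g s (C * gapWidth s * (bracket s)⁻¹ ^ K) 1) :
    IsGapCoeff K fun p => g p.2.2 := by
  refine isGapCoeff_of_derivBound hK (hg.comp timeCLM.contDiff) hC le_rfl fun p => ?_
  have hb := bracket_pos p.2.2
  have hw := gapWidth_pos p.2.2
  exact (DerivBound.comp_time hg (h _)).mono (by positivity) zero_le_one le_rfl
    (by rw [one_mul]; exact one_le_bracket _)

theorem contDiff_iteratedDeriv_gapWidth (k : ℕ) : ContDiff ℝ 2 (iteratedDeriv k gapWidth) := by
  have h : ContDiff ℝ (2 + k : ℕ) gapWidth := contDiff_gapWidth (n := (2 + k : ℕ))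
  rw [iteratedDeriv_eq_iterate]
  exact ContDiff.iterate_deriv' 2 k (by exact_mod_cast h)

theorem exists_derivBound_gapWidth :
    ∃ C, 0 < C ∧ ∀ s, DerivBound gapWidth s (C * gapWidth s) 1 := by
  obtain ⟨C, hC, h⟩ := exists_abs_iteratedDeriv_gapWidth_le
  refine ⟨C, hC, fun s => derivBound_iff.2 fun i hi => ?_⟩
  rw [one_pow, mul_one]
  exact h s i (by omega)

theorem exists_derivBound_deriv_gapWidth :
    ∃ C, 0 < C ∧ ∀ s, DerivBound (deriv gapWidth) s (C * gapWidth s * (bracket s)⁻¹) 1 := by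
  obtain ⟨C, hC, h⟩ := exists_iteratedDeriv_gapWidth_le
  refine ⟨C, hC, fun s => derivBound_iff.2 fun i hi => ?_⟩
  rw [one_pow, mul_one, mul_assoc, ← div_eq_mul_inv, ← iteratedDeriv_succ']
  exact h s (i + 1) (by omega) (by omega)

theorem hasDerivAt_inv_bracket (s : ℝ) :
    HasDerivAt (fun s => (bracket s)⁻¹) (-s / bracket s ^ 3) s := by
  have hb := (bracket_pos s).ne'
  refine ((hasDerivAt_bracket s).fun_inv hb).congr_deriv ?_
  field_simp

theorem abs_iteratedDeriv_bracket_le (s : ℝ) {i : ℕ} (hi : i ≤ 2) :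
    |iteratedDeriv i bracket s| ≤ bracket s := by
  have hb := bracket_pos s
  have hb1 := one_le_bracket s
  have h2 := bracket_sq s
  have hd : deriv bracket = fun s => s * (bracket s)⁻¹ :=
    funext fun s => (hasDerivAt_bracket s).deriv
  have hi' : i = 0 ∨ i = 1 ∨ i = 2 := by omega
  rcases hi' with rfl | rfl | rfl
  · rw [iteratedDeriv_zero, abs_of_pos hb]
  · rw [iteratedDeriv_one, hd, abs_mul, abs_inv, abs_of_pos hb, ← div_eq_mul_inv, div_le_iff₀ hb]
    nlinarith [abs_le_bracket s]
  · rw [iteratedDeriv_succ, iteratedDeriv_one, hd,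
      ((hasDerivAt_id' s).fun_mul (hasDerivAt_inv_bracket s)).deriv]
    have : 1 * (bracket s)⁻¹ + s * (-s / bracket s ^ 3) = (bracket s)⁻¹ ^ 3 := by
      field_simp
      linarith
    rw [this, abs_of_pos (by positivity)]
    exact (pow_le_one₀ (by positivity) (inv_le_one_of_one_le₀ hb1)).trans hb1

theorem abs_iteratedDeriv_inv_bracket_le (s : ℝ) {i : ℕ} (hi : i ≤ 2) :
    |iteratedDeriv i (fun s => (bracket s)⁻¹) s| ≤ 4 * (bracket s)⁻¹ := by
  have hb := bracket_pos s
  have hb1 := one_le_bracket s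
  have h2 := bracket_sq s
  have hBi : 0 < (bracket s)⁻¹ := inv_pos.2 hb
  have hd : deriv (fun s => (bracket s)⁻¹) = fun s => -s / bracket s ^ 3 :=
    funext fun s => (hasDerivAt_inv_bracket s).deriv
  have hi' : i = 0 ∨ i = 1 ∨ i = 2 := by omega
  rcases hi' with rfl | rfl | rfl
  · rw [iteratedDeriv_zero, abs_of_pos hBi]; linarith
  · rw [iteratedDeriv_one, hd, abs_div, abs_neg, abs_of_pos (pow_pos hb 3),
      div_le_iff₀ (pow_pos hb 3)]
    have : 4 * (bracket s)⁻¹ * bracket s ^ 3 = 4 * bracket s ^ 2 := by field_simp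
    rw [this]
    nlinarith [abs_le_bracket s]
  · have hd2 := (hasDerivAt_neg s).fun_div ((hasDerivAt_bracket s).fun_pow 3) (pow_pos hb 3).ne'
    rw [iteratedDeriv_succ, iteratedDeriv_one, hd, hd2.deriv, abs_div,
      abs_of_pos (pow_pos (pow_pos hb 3) 2), div_le_iff₀ (pow_pos (pow_pos hb 3) 2)]
    have e1 : -1 * bracket s ^ 3 - -s * (((3 : ℕ) : ℝ) * bracket s ^ (3 - 1) * (s / bracket s)) =
        bracket s * (3 * s ^ 2 - bracket s ^ 2) := by
      push_cast; field_simp; ring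
    have e2 : 4 * (bracket s)⁻¹ * (bracket s ^ 3) ^ 2 = bracket s * (4 * bracket s ^ 4) := by
      field_simp
    rw [e1, e2, abs_mul, abs_of_pos hb]
    refine mul_le_mul_of_nonneg_left ?_ hb.le
    rw [show bracket s ^ 4 = (bracket s ^ 2) ^ 2 by ring, h2, abs_le]
    constructor <;> nlinarith [sq_nonneg s, sq_nonneg (s ^ 2)]

theorem contDiff_inv_bracket : ContDiff ℝ 2 fun s => (bracket s)⁻¹ :=
  contDiff_bracket.inv fun s => (bracket_pos s).ne'

theorem derivBound_inv_bracket (s : ℝ) :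
    DerivBound (fun s => (bracket s)⁻¹) s (4 * (bracket s)⁻¹) 1 :=
  derivBound_iff.2 fun i hi => by
    rw [one_pow, mul_one]; exact abs_iteratedDeriv_inv_bracket_le s hi

theorem abs_iteratedDeriv_sin_le (s : ℝ) {i : ℕ} (hi : i ≤ 2) : |iteratedDeriv i sin s| ≤ 1 := by
  have hi' : i = 0 ∨ i = 1 ∨ i = 2 := by omega
  rcases hi' with rfl | rfl | rfl
  · rw [iteratedDeriv_zero]; exact abs_sin_le_one s
  · rw [iteratedDeriv_one, Real.deriv_sin]; exact abs_cos_le_one s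
  · rw [iteratedDeriv_succ, iteratedDeriv_one, Real.deriv_sin, Real.deriv_cos', abs_neg]
    exact abs_sin_le_one s

/-- Only one power of the bracket is gained, hence `K = 1`: the field built from it is `C¹`. -/
theorem isGapCoeff_deriv : IsGapCoeff 1 fun p => deriv gapWidth p.2.2 := by
  obtain ⟨C, hC, h⟩ := exists_derivBound_deriv_gapWidth
  refine isGapCoeff_of_time (by norm_num) ?_ hC fun s => by rw [pow_one]; exact h s
  simpa using contDiff_iteratedDeriv_gapWidth 1

theorem isGapCoeff_deriv_deriv : IsGapCoeff 1 fun p => deriv (deriv gapWidth) p.2.2 := by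
  obtain ⟨C, hC, h⟩ := exists_iteratedDeriv_gapWidth_le
  have e : deriv (deriv gapWidth) = iteratedDeriv 2 gapWidth := by
    rw [iteratedDeriv_succ, iteratedDeriv_one]
  have hcd : ContDiff ℝ 2 fun p : ℝ × ℝ × ℝ => deriv (deriv gapWidth) p.2.2 := by
    rw [e]; exact (contDiff_iteratedDeriv_gapWidth 2).comp timeCLM.contDiff
  refine ⟨hcd, C, hC, fun p i hi => ?_⟩
  have hb := bracket_pos p.2.2
  have hb1 := one_le_bracket p.2.2
  have hw := gapWidth_pos p.2.2
  have h1 := norm_iteratedFDeriv_comp_clm_le (contDiff_iteratedDeriv_gapWidth 2) norm_timeCLM_le p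
    (i := i) (by omega)
  have h2 : iteratedDeriv i (iteratedDeriv 2 gapWidth) = iteratedDeriv (i + 2) gapWidth := by
    simp only [iteratedDeriv_eq_iterate, Function.iterate_add_apply]
  rw [h2, ← e] at h1
  calc _ ≤ C * (gapWidth p.2.2 / bracket p.2.2) * bracket p.2.2 ^ 1 :=
        mul_le_mul_of_nonneg_right (h1.trans (h _ (i + 2) (by omega) (by omega))) (by positivity)
    _ = C * gapWidth p.2.2 * 1 := by field_simp
    _ ≤ _ := by
        refine mul_le_mul_of_nonneg_left (one_le_pow₀ hb1) (by positivity)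

/-- The coefficient of the strictly monotone function of the gaps. -/
noncomputable def barrierCoeff (s : ℝ) : ℝ := gapWidth s * ((bracket s)⁻¹ * (bracket s)⁻¹)

/-- The coefficient of the energy of the gaps. -/
noncomputable def energyCoeff (s : ℝ) : ℝ := deriv gapWidth s * deriv gapWidth s * (gapWidth s)⁻¹

/-- The coefficient of the primitive of the vector field with respect to `t`. -/
noncomputable def fluxCoeff (p : ℝ × ℝ × ℝ) : ℝ :=
  deriv gapWidth p.2.2 * (bracket p.2.2)⁻¹ * sin (bracket p.2.2 * sin p.1)

theorem isGapCoeff_barrierCoeff : IsGapCoeff 2 fun p => barrierCoeff p.2.2 := by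
  obtain ⟨C, hC, h⟩ := exists_derivBound_gapWidth
  have hB := contDiff_inv_bracket
  have hW := contDiff_gapWidth (n := 2)
  refine isGapCoeff_of_time le_rfl (C := 256 * C) (hW.mul (hB.mul hB)) (by positivity) fun s => ?_
  have hb := bracket_pos s
  have hw := gapWidth_pos s
  have h1 := DerivBound.mul hB hB (derivBound_inv_bracket s) (derivBound_inv_bracket s)
    (by positivity) zero_le_one
  exact ((h s).mul hW (hB.mul hB) h1 (by positivity) zero_le_one).mono (by positivity) zero_le_one
    (le_of_eq (by ring)) le_rfl

theorem contDiff_deriv_gapWidth : ContDiff ℝ 2 (deriv gapWidth) := by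
  simpa using contDiff_iteratedDeriv_gapWidth 1

/-- Two factors `deriv gapWidth` give two powers of the inverse bracket, so the primitive of `(∂ₓ
h)²` is more regular than `h`. -/
theorem isGapCoeff_energyCoeff : IsGapCoeff 2 fun p => energyCoeff p.2.2 := by
  obtain ⟨C₁, hC₁, h₁⟩ := exists_derivBound_deriv_gapWidth
  obtain ⟨C₂, hC₂, h₂⟩ := exists_derivBound_inv_gapWidth
  have hD := contDiff_deriv_gapWidth
  have hI := contDiff_inv_gapWidth
  refine isGapCoeff_of_time le_rfl (C := 16 * C₁ ^ 2 * C₂) ((hD.mul hD).mul hI) (by positivity)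
    fun s => ?_
  have hb := bracket_pos s
  have hw := gapWidth_pos s
  have h1 := DerivBound.mul hD hD (h₁ s) (h₁ s) (by positivity) zero_le_one
  exact (h1.mul (hD.mul hD) hI (derivBound_iff.2 (h₂ s)) (by positivity) zero_le_one).mono
    (by positivity) zero_le_one (le_of_eq (by field_simp; ring)) le_rfl

/-- Replacing `t` by `⟨s⟩⁻¹ sin (⟨s⟩ sin t)` makes the coefficient of size `gapWidth s / ⟨s⟩²`,
while each derivative in `t` costs one factor `⟨s⟩`, as `IsGapCoeff 2` permits. With the factor `t`
itself one power of the bracket would be missing. -/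
theorem isGapCoeff_fluxCoeff : IsGapCoeff 2 fluxCoeff := by
  obtain ⟨C, hC, h⟩ := exists_derivBound_deriv_gapWidth
  have hD := contDiff_deriv_gapWidth
  have hB := contDiff_inv_bracket
  have hb2 : ContDiff ℝ 2 bracket := contDiff_bracket
  have ht : ContDiff ℝ 2 fun p : ℝ × ℝ × ℝ => sin p.1 := by fun_prop
  have hbs : ContDiff ℝ 2 fun p : ℝ × ℝ × ℝ => bracket p.2.2 := hb2.comp timeCLM.contDiff
  have hc1 : ContDiff ℝ 2 fun p : ℝ × ℝ × ℝ => deriv gapWidth p.2.2 * (bracket p.2.2)⁻¹ :=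
    (hD.mul hB).comp timeCLM.contDiff
  have hu : ContDiff ℝ 2 fun p : ℝ × ℝ × ℝ => bracket p.2.2 * sin p.1 := hbs.mul ht
  refine isGapCoeff_of_derivBound le_rfl (hc1.mul (contDiff_sin.comp hu)) (C := 128 * C) (L := 4)
    (by positivity) (by norm_num) fun p => ?_
  have hb := bracket_pos p.2.2
  have hb1 := one_le_bracket p.2.2
  have hw := gapWidth_pos p.2.2
  have b1 : DerivBound (fun p : ℝ × ℝ × ℝ => deriv gapWidth p.2.2 * (bracket p.2.2)⁻¹) p
      (4 * (C * gapWidth p.2.2 * (bracket p.2.2)⁻¹ * (4 * (bracket p.2.2)⁻¹)))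
      (4 * bracket p.2.2) :=
    (((h _).mul hD hB (derivBound_inv_bracket _) (by positivity)
      zero_le_one).comp_time (hD.mul hB)).mono (by positivity) zero_le_one le_rfl (by linarith)
  have b2 : DerivBound (fun p : ℝ × ℝ × ℝ => bracket p.2.2 * sin p.1) p
      (4 * (bracket p.2.2 * 1)) 1 := by
    refine DerivBound.mul hbs ht (DerivBound.comp_time hb2 (derivBound_iff.2 fun i hi => ?_))
      (DerivBound.comp_clm (ℓ := ContinuousLinearMap.fst ℝ ℝ (ℝ × ℝ)) contDiff_sin
        (ContinuousLinearMap.norm_fst_le ℝ ℝ (ℝ × ℝ)) fun i hi => ?_) hb.le zero_le_one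
    · rw [one_pow, mul_one]; exact abs_iteratedDeriv_bracket_le _ hi
    · rw [one_pow, mul_one]; exact abs_iteratedDeriv_sin_le _ hi
  have b3 : DerivBound (fun p : ℝ × ℝ × ℝ => sin (bracket p.2.2 * sin p.1)) p (2 * 1)
      (4 * bracket p.2.2) := by
    refine DerivBound.comp contDiff_sin hu (fun i hi => abs_iteratedDeriv_sin_le _ hi)
      (fun i h1 hi => (b2 i hi).trans ?_) (by positivity)
    rw [one_pow, mul_one, mul_one]
    exact le_self_pow₀ (by linarith) (by omega)
  exact (b1.mul hc1 (contDiff_sin.comp hu) b3 (by positivity) (by positivity)).mono (by positivity)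
    (by positivity) (le_of_eq (by ring)) le_rfl

end Coefficients

/-! ### Bumps in the gaps and the derivatives of sums of staircases -/

section Bumps

open Filter Real

/-- A smooth nonnegative function with support `[0, 1]` and integral `1`. -/
noncomputable def bumpDensity (r : ℝ) : ℝ :=
  expNegInvGlue r * expNegInvGlue (1 - r) / ∫ ρ in (0 : ℝ)..1, expNegInvGlue ρ * expNegInvGlue (1 - ρ)

theorem continuous_bumpNum : Continuous fun r => expNegInvGlue r * expNegInvGlue (1 - r) := by
  have h := (expNegInvGlue.contDiff (n := 0)).continuous
  exact h.mul (h.comp (by fun_prop))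

theorem integral_bumpNum_pos : 0 < ∫ ρ in (0 : ℝ)..1, expNegInvGlue ρ * expNegInvGlue (1 - ρ) := by
  refine intervalIntegral.intervalIntegral_pos_of_pos_on (continuous_bumpNum.intervalIntegrable _ _)
    (fun x hx => mul_pos (expNegInvGlue.pos_of_pos hx.1)
      (expNegInvGlue.pos_of_pos (sub_pos.2 hx.2))) one_pos

theorem contDiff_bumpDensity {n : ℕ∞} : ContDiff ℝ n bumpDensity := by
  have h := expNegInvGlue.contDiff (n := n)
  exact (h.mul (h.comp (contDiff_const.sub contDiff_id))).div_const _

theorem continuous_bumpDensity : Continuous bumpDensity :=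
  (contDiff_bumpDensity (n := 0)).continuous

theorem bumpDensity_nonneg (r : ℝ) : 0 ≤ bumpDensity r :=
  div_nonneg (mul_nonneg (expNegInvGlue.nonneg _) (expNegInvGlue.nonneg _)) integral_bumpNum_pos.le

theorem bumpDensity_of_nonpos {r : ℝ} (h : r ≤ 0) : bumpDensity r = 0 := by
  rw [bumpDensity, expNegInvGlue.zero_of_nonpos h, zero_mul, zero_div]

theorem bumpDensity_of_one_le {r : ℝ} (h : 1 ≤ r) : bumpDensity r = 0 := by
  rw [bumpDensity, expNegInvGlue.zero_of_nonpos (sub_nonpos.2 h), mul_zero, zero_div]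

theorem bumpDensity_pos {r : ℝ} (h : r ∈ Ioo (0 : ℝ) 1) : 0 < bumpDensity r :=
  div_pos (mul_pos (expNegInvGlue.pos_of_pos h.1) (expNegInvGlue.pos_of_pos (sub_pos.2 h.2)))
    integral_bumpNum_pos

theorem exists_bumpDensity_le : ∃ M, 0 < M ∧ ∀ r, bumpDensity r ≤ M := by
  obtain ⟨M, hM⟩ := (isCompact_Icc (a := (0 : ℝ)) (b := 1)).exists_bound_of_continuousOn
    continuous_bumpDensity.continuousOn
  refine ⟨|M| + 1, by positivity, fun r => ?_⟩
  by_cases hr : r ∈ Icc (0 : ℝ) 1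
  · exact (le_abs_self _).trans ((hM r hr).trans (by linarith [le_abs_self M]))
  · have : bumpDensity r = 0 := by
      rcases not_and_or.1 hr with h | h
      · exact bumpDensity_of_nonpos (not_le.1 h).le
      · exact bumpDensity_of_one_le (not_le.1 h).le
    rw [this]; positivity

/-- The primitive of a power of `bumpDensity`. -/
noncomputable def bumpProfile (k : ℕ) (r : ℝ) : ℝ := ∫ ρ in (0 : ℝ)..r, bumpDensity ρ ^ k

/-- The integral of a power of `bumpDensity`. -/
noncomputable def bumpMass (k : ℕ) : ℝ := bumpProfile k 1

theorem bumpMass_one : bumpMass 1 = 1 := by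
  simp only [bumpMass, bumpProfile, pow_one, bumpDensity]
  rw [intervalIntegral.integral_div, div_self integral_bumpNum_pos.ne']

theorem hasDerivAt_bumpProfile (k : ℕ) (r : ℝ) :
    HasDerivAt (bumpProfile k) (bumpDensity r ^ k) r :=
  ((continuous_bumpDensity.pow k).integral_hasStrictDerivAt 0 r).hasDerivAt

theorem isProfile_bumpProfile {k : ℕ} (hk : k ≠ 0) : IsProfile (bumpProfile k) (bumpMass k) where
  contDiff := by
    have h2 : (2 : WithTop ℕ∞) = 1 + 1 := by norm_num
    rw [h2, contDiff_succ_iff_deriv]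
    refine ⟨fun r => (hasDerivAt_bumpProfile k r).differentiableAt, fun h => ?_, ?_⟩
    · simp at h
    · rw [funext fun r => (hasDerivAt_bumpProfile k r).deriv]
      exact (contDiff_bumpDensity (n := 1)).pow k
  zero r hr := by
    rw [bumpProfile, intervalIntegral.integral_zero_ae]
    refine Eventually.of_forall fun x hx => ?_
    rw [uIoc_of_ge hr] at hx
    rw [bumpDensity_of_nonpos hx.2, zero_pow hk]
  one r hr := by
    have hi : ∀ a b, IntervalIntegrable (fun ρ => bumpDensity ρ ^ k) MeasureTheory.volume a b :=
      fun a b => (continuous_bumpDensity.pow k).intervalIntegrable a b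
    have : ∫ ρ in (1 : ℝ)..r, bumpDensity ρ ^ k = 0 := by
      refine intervalIntegral.integral_zero_ae (Eventually.of_forall fun x hx => ?_)
      rw [uIoc_of_le hr] at hx
      rw [bumpDensity_of_one_le hx.1.le, zero_pow hk]
    rw [bumpMass, bumpProfile, bumpProfile,
      ← intervalIntegral.integral_add_adjacent_intervals (hi 0 1) (hi 1 r), this, add_zero]

/-- The bump in the gap at time `s`. -/
noncomputable def gapBump (x s : ℝ) : ℝ := bumpDensity (Int.fract (x - gapEdge s) / gapWidth s)

theorem gapBump_nonneg (x s : ℝ) : 0 ≤ gapBump x s := bumpDensity_nonneg _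

theorem gapBump_pos_iff {x s : ℝ} :
    0 < gapBump x s ↔ ∃ k : ℤ, x - k ∈ Ioo (gapEdge s) (gapEdge s + gapWidth s) := by
  have hw := gapWidth_pos s
  have hw2 := gapWidth_le_half s
  constructor
  · intro h
    refine ⟨⌊x - gapEdge s⌋, ?_⟩
    have h1 : 0 < Int.fract (x - gapEdge s) / gapWidth s := by
      by_contra hc
      exact h.ne' (bumpDensity_of_nonpos (not_lt.1 hc))
    have h2 : Int.fract (x - gapEdge s) / gapWidth s < 1 := by
      by_contra hc
      exact h.ne' (bumpDensity_of_one_le (not_lt.1 hc))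
    rw [div_lt_one hw] at h2
    have h3 : 0 < Int.fract (x - gapEdge s) := by
      have := mul_pos h1 hw
      rwa [div_mul_cancel₀ _ hw.ne'] at this
    rw [Int.fract] at h2 h3
    constructor <;> linarith
  · rintro ⟨k, h1, h2⟩
    have : ⌊x - gapEdge s⌋ = k := Int.floor_eq_iff.2 ⟨by linarith, by linarith⟩
    refine bumpDensity_pos ?_
    rw [Int.fract, this]
    exact ⟨div_pos (by linarith) hw, by rw [div_lt_one hw]; linarith⟩

theorem gapBump_pos_inGap {x s : ℝ} (h : 0 < gapBump x s) : InGap x s := by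
  obtain ⟨k, hk⟩ := gapBump_pos_iff.1 h
  exact ⟨k, Ioo_subset_Icc_self hk⟩

theorem mem_denjoyPlane_iff_gapBump {x y : ℝ} :
    (x, y) ∈ denjoyPlane ↔ ∀ n : ℤ, gapBump x (y + n) = 0 := by
  simp only [denjoyPlane, mem_ofPred_eq]
  refine forall_congr' fun n => ?_
  rw [← not_iff_not, not_forall]
  push Not
  rw [← gapBump_pos_iff]
  exact ⟨fun h => h.ne', fun h => (gapBump_nonneg _ _).lt_of_ne' h⟩

/-- Reduces pointwise identities between series over the gaps to a single term. -/
theorem gapBump_cases (x y : ℝ) :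
    (x, y) ∈ denjoyPlane ∨ (x, y) ∉ denjoyPlane ∧
      ∃ n : ℤ, 0 < gapBump x (y + n) ∧ ∀ m, m ≠ n → gapBump x (y + m) = 0 := by
  by_cases h : (x, y) ∈ denjoyPlane
  · exact Or.inl h
  refine Or.inr ⟨h, ?_⟩
  rw [mem_denjoyPlane_iff_gapBump] at h
  push Not at h
  obtain ⟨n, hn⟩ := h
  have hn' := (gapBump_nonneg x (y + n)).lt_of_ne' hn
  refine ⟨n, hn', fun m hm => ?_⟩
  by_contra hc
  exact hm (InGap.eq (gapBump_pos_inGap ((gapBump_nonneg x (y + m)).lt_of_ne' hc))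
    (gapBump_pos_inGap hn'))

theorem hasDerivAt_gapStep {k : ℕ} (hk : k ≠ 0) (x s : ℝ) :
    HasDerivAt (fun x => gapStep (bumpProfile k) (bumpMass k) (x, s))
      (gapBump x s ^ k * (gapWidth s)⁻¹) x := by
  have h := gapStep_eventuallyEq (isProfile_bumpProfile hk) (x, s)
  have hc : Tendsto (fun x' : ℝ => (x', s)) (𝓝 x) (𝓝 (x, s)) := by
    exact (Continuous.prodMk_left s).tendsto x
  refine HasDerivAt.congr_of_eventuallyEq ?_ (hc.eventually h)
  have h1 : HasDerivAt (fun x' : ℝ => (x' - gapEdge s - ⌊x - gapEdge s⌋) / gapWidth s)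
      (1 / gapWidth s) x := (((hasDerivAt_id' x).sub_const _).sub_const _).div_const _
  have h2 := ((hasDerivAt_bumpProfile k ((x - gapEdge s - ⌊x - gapEdge s⌋) / gapWidth s)).comp x
    h1).const_add (bumpMass k * ⌊x - gapEdge s⌋)
  rw [one_div] at h2
  exact h2

theorem gapStep_add_int (k : ℕ) (x s : ℝ) (m : ℤ) :
    gapStep (bumpProfile k) (bumpMass k) (x + m, s) =
      gapStep (bumpProfile k) (bumpMass k) (x, s) + bumpMass k * m := by
  simp only [gapStep]
  rw [show x + m - gapEdge s = x - gapEdge s + m by ring, Int.floor_add_intCast,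
    Int.fract_add_intCast]
  push_cast
  ring

/-- The oscillation of the `k`-th step function. -/
noncomputable def stepOsc (k : ℕ) : ℝ × ℝ → ℝ := gapOsc (bumpProfile k) (bumpMass k)

theorem isGapFun_stepOsc {k : ℕ} (hk : k ≠ 0) : IsGapFun (stepOsc k) :=
  isGapFun_gapOsc (isProfile_bumpProfile hk)

theorem stepOsc_add_int (k : ℕ) (x s : ℝ) (m : ℤ) : stepOsc k (x + m, s) = stepOsc k (x, s) := by
  simp only [stepOsc, gapOsc, gapStep_add_int]
  ring

theorem hasDerivAt_stepOsc {k : ℕ} (hk : k ≠ 0) (x s : ℝ) :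
    HasDerivAt (fun x => stepOsc k (x, s)) (gapBump x s ^ k * (gapWidth s)⁻¹ - bumpMass k) x := by
  have h := (hasDerivAt_gapStep hk x s).sub
    (((hasDerivAt_id' x).sub_const (leafSlope * s)).const_mul (bumpMass k))
  rw [mul_one] at h
  exact h

/-- The sum over all gaps of the oscillations of the `k`-th step functions with coefficients `c`. -/
noncomputable def gapPot (c : ℝ × ℝ × ℝ → ℝ) (k : ℕ) : ℝ × ℝ × ℝ → ℝ :=
  gapSum fun p => c p * stepOsc k p.2

theorem gapPot_add_int {c : ℝ × ℝ × ℝ → ℝ} (hc : ∀ t x s, c (t, x, s) = c (t, 0, s)) (k : ℕ)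
    (t x y : ℝ) (m n : ℤ) : gapPot c k (t, x + m, y + n) = gapPot c k (t, x, y) := by
  rw [gapPot, gapSum_add_int]
  refine tsum_congr fun n => ?_
  simp only
  rw [hc, stepOsc_add_int, hc t x]

theorem fderiv_apply_of_hasDerivAt {f : ℝ × ℝ × ℝ → ℝ} {p v : ℝ × ℝ × ℝ} {γ : ℝ → ℝ × ℝ × ℝ}
    {a d : ℝ} (hf : DifferentiableAt ℝ f p) (hγ : HasDerivAt γ v a) (hp : γ a = p)
    (h : HasDerivAt (fun a => f (γ a)) d a) : fderiv ℝ f p v = d := by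
  subst hp
  exact (hf.hasFDerivAt.comp_hasDerivAt a hγ).unique h

theorem hasDerivAt_line_x (t x y : ℝ) :
    HasDerivAt (fun x : ℝ => ((t, x, y) : ℝ × ℝ × ℝ)) (0, 1, 0) x :=
  (hasDerivAt_const x t).prodMk ((hasDerivAt_id' x).prodMk (hasDerivAt_const x y))

theorem hasDerivAt_line_t (t x y : ℝ) :
    HasDerivAt (fun t : ℝ => ((t, x, y) : ℝ × ℝ × ℝ)) (1, 0, 0) t :=
  (hasDerivAt_id' t).prodMk ((hasDerivAt_const t x).prodMk (hasDerivAt_const t y))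

theorem hasDerivAt_line_y (t x y : ℝ) :
    HasDerivAt (fun y : ℝ => ((t, x, y) : ℝ × ℝ × ℝ)) (0, 0, 1) y :=
  (hasDerivAt_const y t).prodMk ((hasDerivAt_const y x).prodMk (hasDerivAt_id' y))

/-- The derivative of a gap sum along a curve in a coordinate direction. -/
theorem IsGapSummand.hasDerivAt_comp {K : ℕ} {F : ℝ × ℝ × ℝ → ℝ} (hF : IsGapSummand K F)
    (hK : 1 ≤ K) {γ : ℝ → ℝ × ℝ × ℝ} {v : ℝ × ℝ × ℝ} {a : ℝ} (hγ : HasDerivAt γ v a) {d : ℤ → ℝ}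
    (hd : ∀ n : ℤ, HasDerivAt (fun a => F (γ a + ((0, 0, (n : ℝ)) : ℝ × ℝ × ℝ))) (d n) a) :
    ∃ D, HasDerivAt (fun a => gapSum F (γ a)) D a ∧ HasSum d D := by
  have h0 := (hF.hasFDerivAt hK (γ a)).comp_hasDerivAt a hγ
  refine ⟨_, h0, ?_⟩
  have h1 := hF.hasSum_fderiv_apply hK (γ a).1 (γ a).2.1 (γ a).2.2 v
  rw [(hF.hasFDerivAt hK _).fderiv] at h1
  convert h1 using 1
  funext n
  refine (fderiv_apply_of_hasDerivAt (hF.contDiff.differentiable two_ne_zero _)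
    (hγ.add_const ((0, 0, (n : ℝ)) : ℝ × ℝ × ℝ)) ?_ (hd n)).symm
  exact add_shift_eq _ _

theorem exists_hasDerivAt_gapPot {K : ℕ} (hK : 1 ≤ K) (hK2 : K ≤ 2) {c : ℝ × ℝ × ℝ → ℝ}
    (hcK : IsGapCoeff K c) (hc : ∀ t x s, c (t, x, s) = c (t, 0, s)) {k : ℕ} (hk : k ≠ 0)
    (t x y : ℝ) : ∃ D, HasDerivAt (fun x => gapPot c k (t, x, y)) D x ∧
      HasSum (fun n : ℤ => c (t, 0, y + n) *
        (gapBump x (y + n) ^ k * (gapWidth (y + n))⁻¹ - bumpMass k)) D := by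
  refine (hcK.isGapSummand hK2 (isGapFun_stepOsc hk)).hasDerivAt_comp hK (hasDerivAt_line_x t x y)
    fun n => ?_
  simp only [add_shift_eq]
  have e : (fun a : ℝ => c (t, a, y + n) * stepOsc k (a, y + n)) =
      fun a => c (t, 0, y + n) * stepOsc k (a, y + n) := funext fun a => by rw [hc]
  rw [e]
  exact (hasDerivAt_stepOsc hk x (y + n)).const_mul _

theorem IsGapCoeff.isGapSummand_self {K : ℕ} (hK : K ≤ 2) {c : ℝ × ℝ × ℝ → ℝ}
    (hc : IsGapCoeff K c) : IsGapSummand K c := by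
  simpa using hc.isGapSummand hK (isGapFun_const 1)

theorem IsGapCoeff.summable {K : ℕ} (hK : 1 ≤ K) (hK2 : K ≤ 2) {c : ℝ × ℝ × ℝ → ℝ}
    (hc : IsGapCoeff K c) (t x y : ℝ) : Summable fun n : ℤ => c (t, x, y + n) :=
  (hc.isGapSummand_self hK2).summable hK t x y

/-- The sum over all gaps of the `k`-th step functions with coefficients `c`, normalized. -/
noncomputable def gapPrim (c : ℝ → ℝ) (k : ℕ) (p : ℝ × ℝ) : ℝ :=
  gapPot (fun p => c p.2.2) k (0, p) + bumpMass k * p.1 * gapSum (fun p => c p.2.2) (0, 0, p.2)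

theorem contDiff_gapPrim {c : ℝ → ℝ} {k : ℕ} (hk : k ≠ 0) (hc : IsGapCoeff 2 fun p => c p.2.2) :
    ContDiff ℝ 2 (gapPrim c k) := by
  have h1 : ContDiff ℝ 2 (gapPot (fun p => c p.2.2) k) :=
    (hc.isGapSummand le_rfl (isGapFun_stepOsc hk)).contDiff_two
  have h2 := (hc.isGapSummand_self le_rfl).contDiff_two
  have e1 : ContDiff ℝ 2 fun p : ℝ × ℝ => ((0, p) : ℝ × ℝ × ℝ) := by fun_prop
  have e2 : ContDiff ℝ 2 fun p : ℝ × ℝ => ((0, 0, p.2) : ℝ × ℝ × ℝ) := by fun_prop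
  exact (h1.comp e1).add ((contDiff_const.mul contDiff_fst).mul (h2.comp e2))

/-- The linear term of `gapPrim` cancels the mean slope `bumpMass k` subtracted in `stepOsc`, at the
price of periodicity in `x`; what is left lives in the gaps. -/
theorem exists_hasDerivAt_gapPrim {c : ℝ → ℝ} {k : ℕ} (hk : k ≠ 0)
    (hc : IsGapCoeff 2 fun p => c p.2.2) (x y : ℝ) :
    ∃ D, HasDerivAt (fun x => gapPrim c k (x, y)) D x ∧
      HasSum (fun n : ℤ => c (y + n) * (gapBump x (y + n) ^ k * (gapWidth (y + n))⁻¹)) D := by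
  obtain ⟨D, h1, h2⟩ := exists_hasDerivAt_gapPot (by norm_num) le_rfl hc (fun _ _ _ => rfl) hk 0 x y
  have h3 := (hc.summable (by norm_num) le_rfl 0 0 y).hasSum
  refine ⟨_, h1.add (((hasDerivAt_id' x).const_mul (bumpMass k)).mul_const
    (gapSum (fun p => c p.2.2) (0, 0, y))), ?_⟩
  rw [mul_one]
  convert h2.add (h3.mul_left (bumpMass k)) using 1
  · funext n
    ring
  · rfl

theorem gapPrim_add_int (c : ℝ → ℝ) (k : ℕ) (x y : ℝ) (n : ℤ) :
    gapPrim c k (x, y + n) = gapPrim c k (x, y) := by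
  have h := gapPot_add_int (c := fun p => c p.2.2) (fun _ _ _ => rfl) k 0 x y 0 n
  simp only [Int.cast_zero, add_zero] at h
  simp only [gapPrim, h, gapSum_add_int]

end Bumps

/-! ### The vector field, the barrier, the flux and the potential -/

section Field

open Filter Real

/-- The sum of the powers of the bumps with coefficients `a`; at most one summand is nonzero. -/
noncomputable def gapSlope (a : ℝ → ℝ) (k : ℕ) (x y : ℝ) : ℝ :=
  ∑' n : ℤ, a (y + n) * gapBump x (y + n) ^ k

theorem gapSlope_of_mem {a : ℝ → ℝ} {k : ℕ} (hk : k ≠ 0) {x y : ℝ} (h : (x, y) ∈ denjoyPlane) :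
    gapSlope a k x y = 0 := by
  rw [gapSlope]
  simp only [mem_denjoyPlane_iff_gapBump.1 h, zero_pow hk, mul_zero, tsum_zero]

theorem gapSlope_of_single {a : ℝ → ℝ} {k : ℕ} (hk : k ≠ 0) {x y : ℝ} {n : ℤ}
    (h : ∀ m, m ≠ n → gapBump x (y + m) = 0) :
    gapSlope a k x y = a (y + n) * gapBump x (y + n) ^ k :=
  tsum_eq_single n fun m hm => by rw [h m hm, zero_pow hk, mul_zero]

/-- The function `h` of the Denjoy vector field on the plane. -/
noncomputable def fieldPlane (p : ℝ × ℝ) : ℝ :=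
  leafSlope + gapPot (fun p => deriv gapWidth p.2.2) 1 (0, p)

/-- The derivative of `fieldPlane` with respect to `x`. -/
noncomputable def fieldSlope : ℝ → ℝ → ℝ := gapSlope (fun s => deriv gapWidth s * (gapWidth s)⁻¹) 1

theorem contDiff_fieldPlane : ContDiff ℝ 1 fieldPlane := by
  have h : ContDiff ℝ 1 (gapPot (fun p => deriv gapWidth p.2.2) 1) :=
    (isGapCoeff_deriv.isGapSummand (by norm_num) (isGapFun_stepOsc one_ne_zero)).contDiff_one
  have e : ContDiff ℝ 1 fun p : ℝ × ℝ => ((0, p) : ℝ × ℝ × ℝ) := by fun_prop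
  exact contDiff_const.add (h.comp e)

theorem fieldPlane_add_int (x y : ℝ) (m n : ℤ) : fieldPlane (x + m, y + n) = fieldPlane (x, y) := by
  rw [fieldPlane, gapPot_add_int (fun _ _ _ => rfl), fieldPlane]

theorem hasSum_deriv_gapWidth (y : ℝ) : HasSum (fun n : ℤ => deriv gapWidth (y + n)) 0 := by
  have h1 := gapSeries_one_const 1 y (by norm_num)
  have h2 := (summable_gapSeries (k := 1) (e := fun _ => 1) (by norm_num) (by simp) y).hasSum
  rw [gapSeries] at h1
  rw [h1] at h2
  simpa using h2

/-- The mean slopes subtracted in the summands contribute minus the sum of the `deriv gapWidth (y +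
n)`, which is zero. -/
theorem hasDerivAt_fieldPlane (x y : ℝ) :
    HasDerivAt (fun x => fieldPlane (x, y)) (fieldSlope x y) x := by
  obtain ⟨D, h1, h2⟩ := exists_hasDerivAt_gapPot le_rfl (by norm_num) isGapCoeff_deriv
    (fun _ _ _ => rfl) one_ne_zero 0 x y
  refine (h1.const_add leafSlope).congr_deriv ?_
  have h3 := h2.add (hasSum_deriv_gapWidth y)
  rw [add_zero] at h3
  rw [← h3.tsum_eq]
  refine tsum_congr fun n => ?_
  simp only [bumpMass_one]
  ring

theorem fieldSlope_of_mem {x y : ℝ} (h : (x, y) ∈ denjoyPlane) : fieldSlope x y = 0 :=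
  gapSlope_of_mem one_ne_zero h

/-- At most one bump is nonzero at a point, so the square of the sum is the sum of the squares. -/
theorem hasDerivAt_energy (x y : ℝ) :
    HasDerivAt (fun x => gapPrim energyCoeff 2 (x, y)) (fieldSlope x y ^ 2) x := by
  obtain ⟨D, h1, h2⟩ := exists_hasDerivAt_gapPrim two_ne_zero isGapCoeff_energyCoeff x y
  refine h1.congr_deriv ?_
  have e : D = gapSlope (fun s => (deriv gapWidth s * (gapWidth s)⁻¹) ^ 2) 2 x y := by
    rw [← h2.tsum_eq]
    refine tsum_congr fun n => ?_
    simp only [energyCoeff]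
    ring
  rw [e]
  rcases gapBump_cases x y with h | ⟨-, n, -, h⟩
  · rw [gapSlope_of_mem two_ne_zero h, fieldSlope_of_mem h]; ring
  · rw [gapSlope_of_single two_ne_zero h, fieldSlope, gapSlope_of_single one_ne_zero h]; ring

theorem contDiff_integral_fieldSlope_sq :
    ContDiff ℝ 2 fun p : ℝ × ℝ => ∫ ξ in (0 : ℝ)..p.1, fieldSlope ξ p.2 ^ 2 := by
  have hc := contDiff_gapPrim two_ne_zero isGapCoeff_energyCoeff
  have h0 : ContDiff ℝ 2 fun p : ℝ × ℝ => ((0, p.2) : ℝ × ℝ) := by fun_prop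
  have hf := contDiff_fieldPlane
  have e : (fun p : ℝ × ℝ => ∫ ξ in (0 : ℝ)..p.1, fieldSlope ξ p.2 ^ 2) =
      fun p => gapPrim energyCoeff 2 p - gapPrim energyCoeff 2 (0, p.2) := by
    funext p
    have hcont : Continuous fun ξ => fieldSlope ξ p.2 := by
      have h1 : ContDiff ℝ 1 fun ξ => fieldPlane (ξ, p.2) := hf.comp (by fun_prop)
      have h2 := h1.continuous_deriv le_rfl
      rwa [funext fun ξ => (hasDerivAt_fieldPlane ξ p.2).deriv] at h2
    exact intervalIntegral.integral_eq_sub_of_hasDerivAt (fun x _ => hasDerivAt_energy x p.2)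
      ((hcont.pow 2).intervalIntegrable _ _)
  rw [e]
  exact hc.sub (hc.comp h0)

/-- The derivative of the barrier with respect to `x`. -/
noncomputable def barrierSlope : ℝ → ℝ → ℝ := gapSlope (fun s => (bracket s)⁻¹ * (bracket s)⁻¹) 1

theorem hasDerivAt_barrier (x y : ℝ) :
    HasDerivAt (fun x => gapPrim barrierCoeff 1 (x, y)) (barrierSlope x y) x := by
  obtain ⟨D, h1, h2⟩ := exists_hasDerivAt_gapPrim one_ne_zero isGapCoeff_barrierCoeff x y
  refine h1.congr_deriv ?_
  rw [← h2.tsum_eq]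
  refine tsum_congr fun n => ?_
  have := (gapWidth_pos (y + n)).ne'
  simp only [barrierCoeff]
  field_simp

theorem barrierSlope_pos {x y : ℝ} (h : (x, y) ∉ denjoyPlane) : 0 < barrierSlope x y := by
  rcases gapBump_cases x y with h' | ⟨-, n, hn, h'⟩
  · exact absurd h' h
  · rw [barrierSlope, gapSlope_of_single one_ne_zero h', pow_one]
    have := bracket_pos (y + n)
    positivity

theorem barrierSlope_of_mem {x y : ℝ} (h : (x, y) ∈ denjoyPlane) : barrierSlope x y = 0 :=
  gapSlope_of_mem one_ne_zero h

/-- In the gap, `(w'/w)²` is bounded by a multiple of `⟨s⟩⁻²`, the factor in the barrier, and the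
square of the bump by a multiple of the bump. This lets the barrier absorb the term `t ∂ₓ h`. -/
theorem exists_fieldSlope_sq_le :
    ∃ C, 0 < C ∧ ∀ x y, fieldSlope x y ^ 2 ≤ C * barrierSlope x y := by
  obtain ⟨C, hC, hb⟩ := exists_iteratedDeriv_gapWidth_le
  obtain ⟨M, hM, hM'⟩ := exists_bumpDensity_le
  refine ⟨C ^ 2 * M, by positivity, fun x y => ?_⟩
  rcases gapBump_cases x y with h | ⟨-, n, hn, h⟩
  · rw [fieldSlope_of_mem h, barrierSlope_of_mem h]; simp
  · rw [fieldSlope, barrierSlope, gapSlope_of_single one_ne_zero h,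
      gapSlope_of_single one_ne_zero h, pow_one]
    set s := y + (n : ℝ)
    have hw := gapWidth_pos s
    have hB := bracket_pos s
    have h1 := hb s 1 le_rfl (by norm_num)
    rw [iteratedDeriv_one] at h1
    have h2 : |deriv gapWidth s * (gapWidth s)⁻¹| ≤ C * (bracket s)⁻¹ := by
      rw [abs_mul, abs_inv, abs_of_pos hw, ← div_eq_mul_inv, div_le_iff₀ hw]
      exact h1.trans_eq (by ring)
    have h3 : gapBump x s ≤ M := hM' _
    have h4 := gapBump_nonneg x s
    rw [mul_pow, ← sq_abs]
    calc _ ≤ (C * (bracket s)⁻¹) ^ 2 * (gapBump x s * M) := by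
          rw [sq (gapBump x s)]; gcongr
      _ = _ := by ring

/-- The primitive of the vector field with respect to `t`. -/
noncomputable def flux (p : ℝ × ℝ × ℝ) : ℝ := leafSlope * p.1 + gapPot fluxCoeff 1 p

theorem contDiff_flux : ContDiff ℝ 2 flux :=
  (contDiff_const.mul contDiff_fst).add
    (isGapCoeff_fluxCoeff.isGapSummand le_rfl (isGapFun_stepOsc one_ne_zero)).contDiff_two

theorem flux_add_int (t x y : ℝ) (m n : ℤ) : flux (t, x + m, y + n) = flux (t, x, y) := by
  simp only [flux]
  rw [gapPot_add_int fun _ _ _ => rfl]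

theorem flux_zero (p : ℝ × ℝ) : flux (0, p) = 0 := by
  have : ∀ p : ℝ × ℝ, fluxCoeff (0, p) = 0 := fun p => by simp [fluxCoeff]
  simp [flux, gapPot, gapSum, this]

theorem hasDerivAt_fluxCoeff (x s : ℝ) :
    HasDerivAt (fun t => fluxCoeff (t, x, s)) (deriv gapWidth s) 0 := by
  have hb := (bracket_pos s).ne'
  have h1 := (((Real.hasDerivAt_sin 0).const_mul (bracket s)).sin).const_mul
    (deriv gapWidth s * (bracket s)⁻¹)
  refine h1.congr_deriv ?_
  rw [sin_zero, mul_zero, cos_zero]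
  field_simp

theorem hasDerivAt_flux (x y : ℝ) :
    HasDerivAt (fun t => flux (t, x, y)) (fieldPlane (x, y)) 0 := by
  obtain ⟨D, h1, h2⟩ := (isGapCoeff_fluxCoeff.isGapSummand le_rfl
    (isGapFun_stepOsc one_ne_zero)).hasDerivAt_comp (by norm_num) (hasDerivAt_line_t 0 x y)
    (d := fun n : ℤ => deriv gapWidth (y + n) * stepOsc 1 (x, y + n)) fun n => by
      simp only [add_shift_eq]
      exact (hasDerivAt_fluxCoeff x (y + n)).mul_const _
  refine (((hasDerivAt_id' (0 : ℝ)).const_mul leafSlope).add h1).congr_deriv ?_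
  rw [mul_one, ← h2.tsum_eq]
  rfl

theorem abs_sub_sin_le_sq (u : ℝ) : |u - sin u| ≤ u ^ 2 := by
  have key : ∀ v : ℝ, 0 ≤ v → |v - sin v| ≤ v ^ 2 := fun v hv => by
    have h1 := sin_le hv
    rw [abs_of_nonneg (by linarith)]
    rcases le_or_gt v 6 with h | h
    · rcases hv.eq_or_lt with rfl | h0
      · simp
      · have := sin_gt_sub_cube h0
        nlinarith [mul_pos h0 h0]
    · nlinarith [neg_one_le_sin v, sin_le hv]
  rcases le_total 0 u with h | h
  · exact key u h
  · have := key (-u) (by linarith)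
    rwa [sin_neg, neg_sub_neg, neg_sq, abs_sub_comm] at this

/-- The error of `⟨s⟩⁻¹ sin (⟨s⟩ τ)` against `τ` is at most `⟨s⟩ τ²`; the extra bracket is cancelled
by `deriv gapWidth`. -/
theorem exists_abs_fluxCoeff_sub_le : ∃ C, 0 < C ∧ ∀ t x s,
    |fluxCoeff (t, x, s) - t * deriv gapWidth s| ≤ C * t ^ 2 * gapWidth s := by
  obtain ⟨C, hC, h⟩ := exists_iteratedDeriv_gapWidth_le
  refine ⟨2 * C, by positivity, fun t x s => ?_⟩
  have hb := bracket_pos s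
  have hb1 := one_le_bracket s
  have hw := gapWidth_pos s
  have h1 := h s 1 le_rfl (by norm_num)
  rw [iteratedDeriv_one] at h1
  have e : fluxCoeff (t, x, s) - t * deriv gapWidth s = -(deriv gapWidth s *
      ((bracket s)⁻¹ * (bracket s * sin t - sin (bracket s * sin t)) + (t - sin t))) := by
    simp only [fluxCoeff]
    field_simp
    ring
  have h2 := abs_sub_sin_le_sq (bracket s * sin t)
  have h3 := abs_sub_sin_le_sq t
  have h4 : sin t ^ 2 ≤ t ^ 2 := sq_le_sq.2 (abs_sin_le_abs)
  rw [e, abs_neg, abs_mul]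
  calc _ ≤ C * (gapWidth s / bracket s) * ((bracket s)⁻¹ * (bracket s * sin t) ^ 2 + t ^ 2) := by
        gcongr
        refine (abs_add_le _ _).trans (add_le_add ?_ h3)
        rw [abs_mul, abs_of_pos (inv_pos.2 hb)]
        gcongr
    _ = C * (gapWidth s / bracket s) * (bracket s * sin t ^ 2 + t ^ 2) := by
        congr 2; field_simp
    _ ≤ C * (gapWidth s / bracket s) * (bracket s * t ^ 2 + bracket s * t ^ 2) := by
        gcongr
        nlinarith [sq_nonneg t]
    _ = _ := by field_simp; ring

/-- Termwise the error is at most `C t² w (bump / w + 1)`. The bumps sum to at most `M`, having one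
nonzero term, and the widths sum to `1/2`. -/
theorem exists_hasDerivAt_flux_left : ∃ C, 0 < C ∧ ∀ t x y,
    ∃ D, HasDerivAt (fun x => flux (t, x, y)) D x ∧ |D - t * fieldSlope x y| ≤ C * t ^ 2 := by
  obtain ⟨C, hC, h⟩ := exists_abs_fluxCoeff_sub_le
  obtain ⟨M, hM, hM'⟩ := exists_bumpDensity_le
  refine ⟨C * (M + 1 / 2), by positivity, fun t x y => ?_⟩
  obtain ⟨D₁, h1, h2⟩ := exists_hasDerivAt_gapPot (by norm_num) le_rfl isGapCoeff_fluxCoeff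
    (fun _ _ _ => rfl) one_ne_zero t x y
  obtain ⟨D₂, h3, h4⟩ := exists_hasDerivAt_gapPot le_rfl (by norm_num) isGapCoeff_deriv
    (fun _ _ _ => rfl) one_ne_zero 0 x y
  have e2 : fieldSlope x y = D₂ := (hasDerivAt_fieldPlane x y).unique (h3.const_add leafSlope)
  refine ⟨D₁, h1.const_add (leafSlope * t), ?_⟩
  rw [e2]
  have hsupp : ∃ b, b ≤ M ∧ HasSum (fun n : ℤ => gapBump x (y + n)) b := by
    rcases gapBump_cases x y with hc | ⟨-, n, hn, hc⟩
    · refine ⟨0, hM.le, ?_⟩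
      simp only [mem_denjoyPlane_iff_gapBump.1 hc]
      exact hasSum_zero
    · exact ⟨_, hM' _, hasSum_single n hc⟩
  obtain ⟨b, hbM, hb⟩ := hsupp
  have hS := (hb.mul_left (C * t ^ 2)).add ((hasSum_gapWidth y).mul_left (C * t ^ 2))
  have hd := h2.sub (h4.mul_left t)
  have h5 : |D₁ - t * D₂| ≤ C * t ^ 2 * b + C * t ^ 2 * (1 / 2) := by
    rw [← norm_eq_abs, ← hd.tsum_eq]
    refine tsum_of_norm_bounded hS fun n => ?_
    have hw := gapWidth_pos (y + n)
    have hg := gapBump_nonneg x (y + n)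
    simp only [bumpMass_one, pow_one, ← mul_assoc]
    rw [← sub_mul, norm_mul, norm_eq_abs, norm_eq_abs]
    have hx : |gapBump x (y + n) * (gapWidth (y + n))⁻¹ - 1| ≤
        gapBump x (y + n) * (gapWidth (y + n))⁻¹ + 1 := by
      refine (abs_sub _ _).trans_eq ?_
      rw [abs_one, abs_of_nonneg (by positivity)]
    calc _ ≤ C * t ^ 2 * gapWidth (y + n) * (gapBump x (y + n) * (gapWidth (y + n))⁻¹ + 1) :=
          mul_le_mul (h t 0 (y + n)) hx (abs_nonneg _) (by positivity)
      _ = _ := by field_simp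
  refine h5.trans ?_
  have : C * t ^ 2 * b ≤ C * t ^ 2 * M := by gcongr
  linarith

/-- A function of the flow-box coordinates whose level sets resolve the Denjoy continuum. -/
structure IsPotential (M : ℝ × ℝ × ℝ → ℝ) : Prop where
  contDiff : ContDiff ℝ 2 M
  add_int : ∀ (t x y : ℝ) (n : ℤ), M (t, x, y + n) = M (t, x, y)
  hasDerivAt_left : ∀ t x y, ∃ D, HasDerivAt (fun x => M (t, x, y)) D x ∧ 0 ≤ D ∧
    (¬ (t = 0 ∧ (x, y) ∈ denjoyPlane) → 0 < D) ∧ (t = 0 ∧ (x, y) ∈ denjoyPlane → D = 0)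
  hasDerivAt_zero : ∀ x y, HasDerivAt (fun t => M (t, x, y)) (-fieldPlane (x, y)) 0

theorem exists_isPotential_barrier {κ : ℝ} (hκ : 0 < κ) : ∃ C, IsPotential fun p =>
    κ * gapPrim barrierCoeff 1 p.2 + C * p.1 ^ 2 * p.2.1 - flux p := by
  obtain ⟨C₁, hC₁, h₁⟩ := exists_hasDerivAt_flux_left
  obtain ⟨C₂, hC₂, h₂⟩ := exists_fieldSlope_sq_le
  have hB := contDiff_gapPrim one_ne_zero isGapCoeff_barrierCoeff
  have hH := contDiff_flux
  -- `C₁` absorbs the error of the flux, `C₂ / (2 * κ)` the quadratic term of Young's inequality,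
  -- and `1` leaves `t ^ 2` for positivity off `t = 0`.
  refine ⟨C₁ + C₂ / (2 * κ) + 1, ?_, ?_, ?_, ?_⟩
  · exact ((contDiff_const.mul (hB.comp contDiff_snd)).add (by fun_prop)).sub hH
  · intro t x y n
    have := flux_add_int t x y 0 n
    simp only [Int.cast_zero, add_zero] at this
    simp only [gapPrim_add_int, this]
  · intro t x y
    obtain ⟨D, hD, hDt⟩ := h₁ t x y
    have h3 : |t * fieldSlope x y| ≤ κ / 2 * barrierSlope x y + C₂ / (2 * κ) * t ^ 2 := by
      have h4 := h₂ x y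
      have h5 : κ / (2 * C₂) * fieldSlope x y ^ 2 ≤ κ / 2 * barrierSlope x y := by
        calc _ ≤ κ / (2 * C₂) * (C₂ * barrierSlope x y) := by gcongr
          _ = _ := by field_simp
      refine le_trans ?_ (add_le_add_left h5 _)
      -- Completing the square, with weights such that half of the barrier term remains.
      have e : κ / (2 * C₂) * fieldSlope x y ^ 2 + C₂ / (2 * κ) * t ^ 2 - |t * fieldSlope x y| =
          (κ * |fieldSlope x y| - C₂ * |t|) ^ 2 / (2 * κ * C₂) := by
        rw [abs_mul, ← sq_abs (fieldSlope x y), ← sq_abs t]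
        field_simp
        ring
      have : 0 ≤ (κ * |fieldSlope x y| - C₂ * |t|) ^ 2 / (2 * κ * C₂) := by positivity
      linarith
    have h0 : 0 ≤ barrierSlope x y := by
      by_cases hm : (x, y) ∈ denjoyPlane
      · exact (barrierSlope_of_mem hm).ge
      · exact (barrierSlope_pos hm).le
    have hlow : κ / 2 * barrierSlope x y + t ^ 2 ≤
        κ * barrierSlope x y + (C₁ + C₂ / (2 * κ) + 1) * t ^ 2 - D := by
      have := abs_le.1 h3
      have := abs_le.1 hDt
      nlinarith
    refine ⟨κ * barrierSlope x y + (C₁ + C₂ / (2 * κ) + 1) * t ^ 2 * 1 - D,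
      (((hasDerivAt_barrier x y).const_mul κ).add
        ((hasDerivAt_id' x).const_mul ((C₁ + C₂ / (2 * κ) + 1) * t ^ 2))).sub hD, ?_, ?_, ?_⟩
    · have : 0 ≤ κ / 2 * barrierSlope x y := by positivity
      nlinarith [sq_nonneg t]
    · intro h
      rw [mul_one]
      refine lt_of_lt_of_le ?_ hlow
      by_cases ht : t = 0
      · have := barrierSlope_pos fun hm => h ⟨ht, hm⟩
        positivity
      · have : 0 < t ^ 2 := by positivity
        have : 0 ≤ κ / 2 * barrierSlope x y := by positivity
        linarith
    · rintro ⟨rfl, hm⟩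
      have hD0 : D = 0 := by simpa using hDt
      rw [barrierSlope_of_mem hm, hD0]
      ring
  · intro x y
    have h := (((hasDerivAt_pow 2 (0 : ℝ)).const_mul (C₁ + C₂ / (2 * κ) + 1)).mul_const x).const_add
      (κ * gapPrim barrierCoeff 1 (x, y))
    refine (h.sub (hasDerivAt_flux x y)).congr_deriv ?_
    simp

/-- At `t = 0` the flux and the quadratic term vanish, so the potential is `κ` times the barrier,
small on a compact set for small `κ`. The tube lemma extends this to small `t`, and periodicity in
`y` to all levels. -/
theorem exists_isPotential (R : ℝ) {η : ℝ} (hη : 0 < η) : ∃ M, IsPotential M ∧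
    ∃ τ, 0 < τ ∧ ∀ t x y, |t| < τ → |x| ≤ R → |M (t, x, y)| < η := by
  have hB := (contDiff_gapPrim one_ne_zero isGapCoeff_barrierCoeff).continuous
  obtain ⟨b, hb⟩ := ((isCompact_Icc (a := -R) (b := R)).prod
    (isCompact_Icc (a := (0 : ℝ)) (b := 1))).exists_bound_of_continuousOn hB.continuousOn
  set κ := η / (|b| + 1) with hκ
  have hκ0 : 0 < κ := by positivity
  obtain ⟨C, hM⟩ := exists_isPotential_barrier hκ0
  refine ⟨_, hM, ?_⟩
  set M : ℝ × ℝ × ℝ → ℝ :=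
    fun p => κ * gapPrim barrierCoeff 1 p.2 + C * p.1 ^ 2 * p.2.1 - flux p with hMd
  have hcM : Continuous M := hM.contDiff.continuous
  have h0 : ∀ p ∈ Icc (-R) R ×ˢ Icc (0 : ℝ) 1, |M (0, p)| < η := fun p hp => by
    have h1 : M (0, p) = κ * gapPrim barrierCoeff 1 p := by
      simp only [hMd, flux_zero]; ring
    have h2 : |gapPrim barrierCoeff 1 p| ≤ |b| := (hb p hp).trans (le_abs_self b)
    rw [h1, abs_mul, abs_of_pos hκ0, hκ, div_mul_eq_mul_div, div_lt_iff₀ (by positivity)]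
    nlinarith
  have hopen : IsOpen {p : ℝ × ℝ × ℝ | |M p| < η} := isOpen_lt hcM.abs continuous_const
  obtain ⟨u, v, hu, -, h0u, hKv, huv⟩ := generalized_tube_lemma (isCompact_singleton (x := (0 : ℝ)))
    ((isCompact_Icc (a := -R) (b := R)).prod (isCompact_Icc (a := (0 : ℝ)) (b := 1))) hopen (by
      rintro ⟨t, p⟩ ⟨ht, hp⟩
      obtain rfl : t = 0 := ht
      exact h0 p hp)
  obtain ⟨τ, hτ, hball⟩ := Metric.isOpen_iff.1 hu 0 (h0u rfl)
  refine ⟨τ, hτ, fun t x y ht hx => ?_⟩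
  have h1 := hM.add_int t x (Int.fract y) ⌊y⌋
  rw [Int.fract_add_floor] at h1
  show |M (t, x, y)| < η
  rw [h1]
  exact huv ⟨hball (by simpa using ht), hKv ⟨abs_le.1 hx, Int.fract_nonneg y,
    (Int.fract_lt_one y).le⟩⟩

end Field

/-! ### Hölder estimate for the contribution of one gap -/

section Holder

open Filter Real

/-- The lattice periodic functions on the plane. -/
def IsDoublyPeriodic {F : Type*} (f : ℝ × ℝ → F) : Prop :=
  ∀ (x y : ℝ) (m n : ℤ), f (x + m, y + n) = f (x, y)

theorem IsDoublyPeriodic.exists_bound {F : Type*} [NormedAddCommGroup F] {f : ℝ × ℝ → F}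
    (hf : IsDoublyPeriodic f) (hc : Continuous f) : ∃ C, 0 < C ∧ ∀ p, ‖f p‖ ≤ C := by
  obtain ⟨C, hC⟩ := ((isCompact_Icc (a := (0 : ℝ)) (b := 1)).prod
    (isCompact_Icc (a := (0 : ℝ)) (b := 1))).exists_bound_of_continuousOn hc.continuousOn
  refine ⟨|C| + 1, by positivity, fun p => ?_⟩
  have h := hf (Int.fract p.1) (Int.fract p.2) ⌊p.1⌋ ⌊p.2⌋
  rw [Int.fract_add_floor, Int.fract_add_floor] at h
  rw [← Prod.mk.eta (p := p), h]
  exact (hC _ ⟨⟨Int.fract_nonneg _, (Int.fract_lt_one _).le⟩,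
    ⟨Int.fract_nonneg _, (Int.fract_lt_one _).le⟩⟩).trans (by linarith [le_abs_self C])

theorem IsDoublyPeriodic.fderiv {f : ℝ × ℝ → ℝ} (hf : IsDoublyPeriodic f) :
    IsDoublyPeriodic (fderiv ℝ f) := fun x y m n => by
  have h : (fun p : ℝ × ℝ => f (p + ((m, n) : ℝ × ℝ))) = f := funext fun p => hf p.1 p.2 m n
  have := fderiv_comp_add_right (𝕜 := ℝ) (f := f) (x := (x, y)) ((m, n) : ℝ × ℝ)
  rw [h] at this
  exact this.symm

theorem IsDoublyPeriodic.exists_lipschitz {f : ℝ × ℝ → ℝ} (hf : IsDoublyPeriodic f)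
    (hc : ContDiff ℝ 1 f) : ∃ C, 0 < C ∧ ∀ p q, |f p - f q| ≤ C * ‖p - q‖ := by
  obtain ⟨C, hC, h⟩ := hf.fderiv.exists_bound (hc.continuous_fderiv one_ne_zero)
  refine ⟨C, hC, fun p q => ?_⟩
  exact Convex.norm_image_sub_le_of_norm_fderiv_le
    (fun x _ => hc.differentiable one_ne_zero x) (fun x _ => h x) convex_univ (mem_univ q)
    (mem_univ p)

theorem min_le_rpow {a d α : ℝ} (ha : 1 ≤ a) (hd : 0 ≤ d) (hα : 0 < α) (hα1 : α < 1) :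
    min 1 (a * d) ≤ a ^ α * d ^ α := by
  rw [← mul_rpow (by linarith) hd]
  rcases le_total 1 (a * d) with h | h
  · rw [min_eq_left h]
    exact one_le_rpow h hα.le
  · rw [min_eq_right h]
    exact self_le_rpow_of_le_one (by positivity) h hα1.le

/-- Boundedness and a Lipschitz estimate at small distances give Hölder estimates. -/
theorem le_rpow_of_bounded_of_lipschitz {A C d α x : ℝ} (hA : 0 ≤ A) (hC : 0 ≤ C) (hd : 0 ≤ d)
    (hα : 0 < α) (hα1 : α < 1) (h1 : x ≤ A) (h2 : x ≤ C * d) : x ≤ (A + C) * d ^ α := by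
  have h := min_le_rpow (a := 1) le_rfl hd hα hα1
  rw [one_mul, one_rpow, one_mul] at h
  have hd' := rpow_nonneg hd α
  rcases min_le_iff.1 h with h | h
  · nlinarith
  · nlinarith

/-- The contribution of the gap at time `s` to the differential of the vector field. -/
noncomputable def gapForm (p : ℝ × ℝ) : ℝ × ℝ →L[ℝ] ℝ :=
  deriv gapWidth p.2 • fderiv ℝ (gapStep (bumpProfile 1) (bumpMass 1)) p

theorem contDiff_gapStep_bump : ContDiff ℝ 2 (gapStep (bumpProfile 1) (bumpMass 1)) :=
  contDiff_gapStep (isProfile_bumpProfile one_ne_zero)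

theorem contDiff_gapForm : ContDiff ℝ 1 gapForm := by
  have h1 : ContDiff ℝ 1 fun p : ℝ × ℝ => deriv gapWidth p.2 :=
    (contDiff_deriv_gapWidth.of_le one_le_two).comp contDiff_snd
  have h2 : ContDiff ℝ 1 (fderiv ℝ (gapStep (bumpProfile 1) (bumpMass 1))) :=
    contDiff_gapStep_bump.fderiv_right (by norm_num)
  exact h1.smul h2

theorem gapForm_of_not_inGap {p : ℝ × ℝ} (h : ¬ InGap p.1 p.2) : gapForm p = 0 := by
  obtain ⟨c, hc⟩ := gapStep_eventuallyEq_const (isProfile_bumpProfile one_ne_zero) h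
  rw [gapForm, hc.fderiv_eq, fderiv_fun_const, Pi.zero_apply, smul_zero]

theorem norm_fderiv_smul_le {E F : Type*} [NormedAddCommGroup E] [NormedSpace ℝ E]
    [NormedAddCommGroup F] [NormedSpace ℝ F] {c : E → ℝ} {f : E → F} {p : E}
    (hc : DifferentiableAt ℝ c p) (hf : DifferentiableAt ℝ f p) :
    ‖fderiv ℝ (fun x => c x • f x) p‖ ≤ |c p| * ‖fderiv ℝ f p‖ + ‖fderiv ℝ c p‖ * ‖f p‖ := by
  rw [(hc.hasFDerivAt.fun_smul hf.hasFDerivAt).fderiv]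
  refine (norm_add_le _ _).trans (add_le_add ?_ ?_)
  · rw [norm_smul, norm_eq_abs]
  · rw [ContinuousLinearMap.norm_smulRight_apply]

/-- The factor `deriv gapWidth` is `O(w / ⟨s⟩)`, and each derivative of the step costs `1 / w`. -/
theorem exists_norm_gapForm_le : ∃ C, 0 < C ∧ ∀ p : ℝ × ℝ, ‖gapForm p‖ ≤ C * (bracket p.2)⁻¹ ∧
    ‖fderiv ℝ gapForm p‖ ≤ C * ((bracket p.2)⁻¹ * (gapWidth p.2)⁻¹) := by
  obtain ⟨C₁, hC₁, h₁⟩ := exists_iteratedDeriv_gapWidth_le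
  obtain ⟨C₂, hC₂, h₂⟩ := exists_bound_iteratedFDeriv_gapStep
    (isProfile_bumpProfile (k := 1) one_ne_zero)
  refine ⟨2 * (C₁ * C₂), by positivity, fun p => ?_⟩
  set T := gapStep (bumpProfile 1) (bumpMass 1)
  have hT : ContDiff ℝ 2 T := contDiff_gapStep_bump
  have hb := bracket_pos p.2
  have hw := gapWidth_pos p.2
  have hwi := one_le_inv_gapWidth p.2
  have ind : ∀ i : ℕ, {p : ℝ × ℝ | InGap p.1 p.2}.indicator (fun p => (gapWidth p.2)⁻¹ ^ i) p ≤
      (gapWidth p.2)⁻¹ ^ i := fun i =>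
    indicator_le_self' (fun a _ => by have := gapWidth_pos a.2; positivity) p
  have hT1 : ‖fderiv ℝ T p‖ ≤ C₂ * (gapWidth p.2)⁻¹ := by
    rw [← norm_iteratedFDeriv_one]
    refine (h₂ p 1 le_rfl (by norm_num)).trans ?_
    have := ind 1
    rw [pow_one] at this
    gcongr
  have hT2 : ‖fderiv ℝ (fderiv ℝ T) p‖ ≤ C₂ * (gapWidth p.2)⁻¹ ^ 2 := by
    rw [← norm_iteratedFDeriv_one, norm_iteratedFDeriv_fderiv]
    refine (h₂ p 2 (by norm_num) le_rfl).trans ?_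
    have := ind 2
    gcongr
  have hw1 := h₁ p.2 1 le_rfl (by norm_num)
  have hw2 := h₁ p.2 2 (by norm_num) (by norm_num)
  rw [iteratedDeriv_one] at hw1
  constructor
  · rw [gapForm, norm_smul, norm_eq_abs]
    calc _ ≤ C₁ * (gapWidth p.2 / bracket p.2) * (C₂ * (gapWidth p.2)⁻¹) := by gcongr
      _ = C₁ * C₂ * (bracket p.2)⁻¹ := by field_simp
      _ ≤ _ := by
        have : 0 < C₁ * C₂ * (bracket p.2)⁻¹ := by positivity
        linarith
  · have hd1 : HasFDerivAt (fun p : ℝ × ℝ => deriv gapWidth p.2)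
        (deriv (deriv gapWidth) p.2 • ContinuousLinearMap.snd ℝ ℝ ℝ) p := by
      have h := (contDiff_deriv_gapWidth.differentiable two_ne_zero p.2).hasDerivAt
      exact h.comp_hasFDerivAt p hasFDerivAt_snd
    have hd2 : HasFDerivAt (fderiv ℝ T) (fderiv ℝ (fderiv ℝ T) p) p :=
      ((hT.fderiv_right (m := 1) (by norm_num)).differentiable one_ne_zero p).hasFDerivAt
    have hsnd := ContinuousLinearMap.norm_snd_le ℝ ℝ ℝ
    refine (norm_fderiv_smul_le hd1.differentiableAt hd2.differentiableAt).trans ?_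
    rw [hd1.fderiv]
    have e1 : |deriv gapWidth p.2| * ‖fderiv ℝ (fderiv ℝ T) p‖ ≤
        C₁ * (gapWidth p.2 / bracket p.2) * (C₂ * (gapWidth p.2)⁻¹ ^ 2) := by
      gcongr
    have e2 : ‖deriv (deriv gapWidth) p.2 • ContinuousLinearMap.snd ℝ ℝ ℝ‖ * ‖fderiv ℝ T p‖ ≤
        C₁ * (gapWidth p.2 / bracket p.2) * 1 * (C₂ * (gapWidth p.2)⁻¹) := by
      rw [norm_smul, norm_eq_abs]
      rw [iteratedDeriv_succ, iteratedDeriv_one] at hw2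
      gcongr
    refine (add_le_add e1 e2).trans ?_
    have e3 : C₁ * (gapWidth p.2 / bracket p.2) * (C₂ * (gapWidth p.2)⁻¹ ^ 2) =
      C₁ * C₂ * ((bracket p.2)⁻¹ * (gapWidth p.2)⁻¹) := by field_simp
    have e4 : C₁ * (gapWidth p.2 / bracket p.2) * 1 * (C₂ * (gapWidth p.2)⁻¹) =
      C₁ * C₂ * ((bracket p.2)⁻¹ * 1) := by field_simp
    rw [e3, e4]
    have : C₁ * C₂ * ((bracket p.2)⁻¹ * 1) ≤ C₁ * C₂ * ((bracket p.2)⁻¹ * (gapWidth p.2)⁻¹) := by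
      gcongr
    linarith

/-- With `b = 1 / ⟨s⟩` and `W = 1 / w`, the difference is at most a multiple of `b * min 1 (W d)`,
hence of `b * W ^ α * d ^ α`. The bound on the inverse width with exponent `1 / α > 1` turns `W ^ α`
into a multiple of `b⁻¹`. -/
theorem exists_gapForm_holder {α : ℝ} (hα : 0 < α) (hα1 : α < 1) :
    ∃ C, 0 < C ∧ ∀ p q, ‖gapForm p - gapForm q‖ ≤ C * ‖p - q‖ ^ α := by
  obtain ⟨C₁, hC₁, h₁⟩ := exists_norm_gapForm_le
  obtain ⟨C₂, hC₂, h₂⟩ := exists_gapWidth_le_exp_mul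
  obtain ⟨C₃, hC₃, h₃⟩ := exists_inv_gapWidth_le (p := 1 / α) (by rw [lt_div_iff₀ hα]; linarith)
  set A := 2 * C₁ * exp (1 + C₂) with hA
  have hA0 : 0 < A := by positivity
  have hA1 : 2 * C₁ ≤ A := by
    have : 1 ≤ exp (1 + C₂) := one_le_exp (by positivity)
    nlinarith
  refine ⟨A * C₃ ^ α + A, by positivity, fun p q => ?_⟩
  have hd0 := norm_nonneg (p - q)
  have hbound : ‖gapForm p - gapForm q‖ ≤ C₁ * (bracket p.2)⁻¹ + C₁ * (bracket q.2)⁻¹ :=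
    (norm_sub_le _ _).trans (add_le_add (h₁ p).1 (h₁ q).1)
  have hbp : (bracket p.2)⁻¹ ≤ 1 := inv_le_one_of_one_le₀ (one_le_bracket _)
  have hbq : (bracket q.2)⁻¹ ≤ 1 := inv_le_one_of_one_le₀ (one_le_bracket _)
  rcases le_or_gt 1 ‖p - q‖ with h1 | h1
  · have : 1 ≤ ‖p - q‖ ^ α := one_le_rpow h1 hα.le
    have h4 : 0 < A * C₃ ^ α := by positivity
    nlinarith
  have hs : |q.2 - p.2| ≤ ‖p - q‖ := by
    rw [abs_sub_comm, ← norm_eq_abs]; exact norm_snd_le (p - q)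
  set b := (bracket p.2)⁻¹ with hb
  have hb0 : 0 < b := inv_pos.2 (bracket_pos _)
  set W := (gapWidth p.2)⁻¹ with hW
  have hW1 : 1 ≤ W := one_le_inv_gapWidth _
  -- For points at distance below one, the bracket and the width may be frozen at `p`.
  have hshift : ∀ z : ℝ × ℝ, |z.2 - p.2| ≤ 1 → (bracket z.2)⁻¹ ≤ exp 1 * b ∧
      (gapWidth z.2)⁻¹ ≤ exp C₂ * W := fun z hz => by
    have hbz := bracket_pos z.2
    have hwz := gapWidth_pos z.2
    have hbp := bracket_pos p.2
    have hwp := gapWidth_pos p.2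
    constructor
    · rw [hb, ← div_eq_mul_inv, le_div_iff₀ hbp, inv_mul_le_iff₀ hbz, mul_comm]
      refine (bracket_le_exp_mul z.2 p.2).trans ?_
      rw [abs_sub_comm] at hz
      gcongr
    · rw [hW, ← div_eq_mul_inv, le_div_iff₀ hwp, inv_mul_le_iff₀ hwz, mul_comm]
      refine (h₂ z.2 p.2).trans ?_
      rw [abs_sub_comm] at hz
      gcongr
      nlinarith
  have b1 : ‖gapForm p - gapForm q‖ ≤ A * b * 1 := by
    have h4 := (hshift q (hs.trans h1.le)).1
    have h5 : exp 1 ≤ exp (1 + C₂) := exp_le_exp.2 (by linarith)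
    have h6 : 1 ≤ exp (1 + C₂) := one_le_exp (by positivity)
    calc _ ≤ C₁ * b + C₁ * (exp 1 * b) := hbound.trans (by gcongr)
      _ ≤ C₁ * (exp (1 + C₂) * b) + C₁ * (exp (1 + C₂) * b) := by
          gcongr
          nlinarith
      _ = _ := by rw [hA]; ring
  have b2 : ‖gapForm p - gapForm q‖ ≤ A * b * (W * ‖p - q‖) := by
    have h4 := Convex.norm_image_sub_le_of_norm_fderiv_le (𝕜 := ℝ) (f := gapForm)
      (C := C₁ * ((exp 1 * b) * (exp C₂ * W))) (s := segment ℝ q p)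
      (fun x _ => contDiff_gapForm.differentiable one_ne_zero x) (fun z hz => ?_)
      (convex_segment q p) (left_mem_segment ℝ q p) (right_mem_segment ℝ q p)
    · refine h4.trans ?_
      rw [hA, exp_add]
      have : 0 ≤ C₁ * (exp 1 * b * (exp C₂ * W)) * ‖p - q‖ := by positivity
      linarith
    · have hz2 : |z.2 - p.2| ≤ 1 := by
        obtain ⟨a, c, ha, hc, hac, rfl⟩ := hz
        have e : (a • q + c • p).2 - p.2 = a * (q.2 - p.2) := by
          simp only [Prod.snd_add, Prod.smul_snd, smul_eq_mul]
          linear_combination (p.2) * hac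
        rw [e, abs_mul, abs_of_nonneg ha]
        exact mul_le_one₀ (by linarith) (abs_nonneg _) (hs.trans h1.le)
      obtain ⟨h5, h6⟩ := hshift z hz2
      refine (h₁ z).2.trans ?_
      have := bracket_pos z.2
      have := gapWidth_pos z.2
      gcongr
  have h4 : ‖gapForm p - gapForm q‖ ≤ A * b * (W ^ α * ‖p - q‖ ^ α) := by
    refine le_trans ?_ (mul_le_mul_of_nonneg_left (min_le_rpow hW1 hd0 hα hα1) (by positivity))
    rcases le_total 1 (W * ‖p - q‖) with h | h
    · rw [min_eq_left h]; exact b1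
    · rw [min_eq_right h]; exact b2
  have h5 : W ^ α ≤ C₃ ^ α * b⁻¹ := by
    have hbb := bracket_pos p.2
    calc W ^ α ≤ (C₃ * bracket p.2 ^ (1 / α)) ^ α := by
          refine rpow_le_rpow (by positivity) (h₃ p.2) hα.le
      _ = C₃ ^ α * b⁻¹ := by
          rw [mul_rpow hC₃.le (by positivity), ← rpow_mul hbb.le, one_div, inv_mul_cancel₀ hα.ne',
            rpow_one, hb, inv_inv]
  calc _ ≤ A * b * (W ^ α * ‖p - q‖ ^ α) := h4
    _ ≤ A * b * (C₃ ^ α * b⁻¹ * ‖p - q‖ ^ α) := by gcongr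
    _ = A * C₃ ^ α * ‖p - q‖ ^ α := by field_simp
    _ ≤ _ := by
      have := rpow_nonneg hd0 α
      gcongr
      linarith

end Holder

/-! ### Differential of the field, and the passage to the torus -/

section FieldHolder

open Filter Real

theorem exists_gapForm_eq_zero (p : ℝ × ℝ) :
    ∃ n : ℤ, ∀ m : ℤ, m ≠ n → gapForm (p.1, p.2 + m) = 0 := by
  by_cases h : ∃ n : ℤ, InGap p.1 (p.2 + n)
  · obtain ⟨n, hn⟩ := h
    exact ⟨n, fun m hm => gapForm_of_not_inGap fun hc => hm (InGap.eq hc hn)⟩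
  · push Not at h
    exact ⟨0, fun m _ => gapForm_of_not_inGap (h m)⟩

/-- The sum of the contributions of all gaps to the differential of the vector field. -/
noncomputable def formSum (p : ℝ × ℝ) : ℝ × ℝ →L[ℝ] ℝ := ∑' n : ℤ, gapForm (p.1, p.2 + n)

theorem hasSum_formSum (p : ℝ × ℝ) :
    HasSum (fun n : ℤ => gapForm (p.1, p.2 + n)) (formSum p) := by
  obtain ⟨n, hn⟩ := exists_gapForm_eq_zero p
  exact (hasSum_single n hn).summable.hasSum

theorem formSum_eq {p : ℝ × ℝ} {n : ℤ} (h : ∀ m : ℤ, m ≠ n → gapForm (p.1, p.2 + m) = 0) :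
    formSum p = gapForm (p.1, p.2 + n) := tsum_eq_single n h

/-- Each point sees at most one gap. If the two gaps differ, each form vanishes at the other point,
so two estimates for single gaps suffice; hence the factor `2`. -/
theorem exists_formSum_holder {α : ℝ} (hα : 0 < α) (hα1 : α < 1) :
    ∃ C, 0 < C ∧ ∀ p q, ‖formSum p - formSum q‖ ≤ C * ‖p - q‖ ^ α := by
  obtain ⟨C, hC, h⟩ := exists_gapForm_holder hα hα1
  refine ⟨2 * C, by positivity, fun p q => ?_⟩
  obtain ⟨n, hn⟩ := exists_gapForm_eq_zero p
  obtain ⟨m, hm⟩ := exists_gapForm_eq_zero q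
  have hk : ∀ k : ℤ, ‖gapForm (p.1, p.2 + k) - gapForm (q.1, q.2 + k)‖ ≤ C * ‖p - q‖ ^ α :=
    fun k => by
      have := h (p.1, p.2 + k) (q.1, q.2 + k)
      rwa [show ((p.1, p.2 + (k : ℝ)) : ℝ × ℝ) - (q.1, q.2 + (k : ℝ)) = p - q by
        ext <;> simp] at this
  have hnn := rpow_nonneg (norm_nonneg (p - q)) α
  rw [formSum_eq hn, formSum_eq hm]
  by_cases hnm : n = m
  · subst hnm
    nlinarith [hk n]
  · have e : gapForm (p.1, p.2 + n) - gapForm (q.1, q.2 + m) =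
        (gapForm (p.1, p.2 + n) - gapForm (q.1, q.2 + n)) +
          (gapForm (p.1, p.2 + m) - gapForm (q.1, q.2 + m)) := by
      rw [hm n hnm, hn m (Ne.symm hnm)]; abel
    rw [e]
    refine (norm_add_le _ _).trans ?_
    linarith [hk n, hk m]

/-- The smooth part of the differential of the vector field. -/
noncomputable def fieldDrift (p : ℝ × ℝ) : ℝ :=
  gapPot (fun p => deriv (deriv gapWidth) p.2.2) 1 (0, p)

theorem contDiff_fieldDrift : ContDiff ℝ 1 fieldDrift := by
  have h : ContDiff ℝ 1 (gapPot (fun p => deriv (deriv gapWidth) p.2.2) 1) :=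
    (isGapCoeff_deriv_deriv.isGapSummand (by norm_num) (isGapFun_stepOsc one_ne_zero)).contDiff_one
  have e : ContDiff ℝ 1 fun p : ℝ × ℝ => ((0, p) : ℝ × ℝ × ℝ) := by fun_prop
  exact h.comp e

theorem isDoublyPeriodic_fieldDrift : IsDoublyPeriodic fieldDrift := fun x y m n => by
  rw [fieldDrift, gapPot_add_int (fun _ _ _ => rfl), fieldDrift]

theorem isDoublyPeriodic_fieldPlane : IsDoublyPeriodic fieldPlane := fieldPlane_add_int

theorem hasDerivAt_stepOsc_right (x s : ℝ) :
    HasDerivAt (fun s => stepOsc 1 (x, s))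
      (fderiv ℝ (gapStep (bumpProfile 1) (bumpMass 1)) (x, s) (0, 1) + leafSlope) s := by
  have h1 : HasDerivAt (fun s : ℝ => ((x, s) : ℝ × ℝ)) (0, 1) s :=
    (hasDerivAt_const s x).prodMk (hasDerivAt_id' s)
  have h2 := (contDiff_gapStep_bump.differentiable two_ne_zero (x, s)).hasFDerivAt.comp_hasDerivAt
    s h1
  have h3 := h2.sub ((((hasDerivAt_id' s).const_mul leafSlope).const_sub x).const_mul (bumpMass 1))
  refine h3.congr_deriv ?_
  rw [bumpMass_one]
  ring

theorem hasSum_formSum_apply (x y : ℝ) (v : ℝ × ℝ) :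
    HasSum (fun n : ℤ => gapForm (x, y + n) v) (formSum (x, y) v) := by
  have h := (ContinuousLinearMap.apply ℝ ℝ v).hasSum (hasSum_formSum (x, y))
  simpa only [ContinuousLinearMap.apply_apply] using h

theorem formSum_apply_left (x y : ℝ) : formSum (x, y) (1, 0) = fieldSlope x y := by
  rw [← (hasSum_formSum_apply x y (1, 0)).tsum_eq]
  refine tsum_congr fun n => ?_
  have h2 : HasDerivAt (fun x : ℝ => ((x, y + n) : ℝ × ℝ)) (1, 0) x :=
    (hasDerivAt_id' x).prodMk (hasDerivAt_const x (y + (n : ℝ)))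
  have h3 := ((contDiff_gapStep_bump.differentiable two_ne_zero
    (x, y + n)).hasFDerivAt.comp_hasDerivAt x h2).unique
    (hasDerivAt_gapStep one_ne_zero x (y + n))
  rw [gapForm, smul_apply, h3, smul_eq_mul]
  ring

theorem hasDerivAt_driftSummand (x y : ℝ) (n : ℤ) :
    HasDerivAt (fun s : ℝ => deriv gapWidth (s + n) * stepOsc 1 (x, s + n))
      (deriv (deriv gapWidth) (y + n) * stepOsc 1 (x, y + n) +
        deriv gapWidth (y + n) * (fderiv ℝ (gapStep (bumpProfile 1) (bumpMass 1))
          (x, y + n) (0, 1) + leafSlope)) y := by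
  have h4 : HasDerivAt (fun s : ℝ => deriv gapWidth (s + n)) (deriv (deriv gapWidth) (y + n)) y :=
    ((contDiff_deriv_gapWidth.differentiable two_ne_zero (y + n)).hasDerivAt).comp_add_const y n
  have h5 := (hasDerivAt_stepOsc_right x (y + n)).comp_add_const y n
  exact h4.mul h5

theorem hasDerivAt_fieldPlane_right (x y : ℝ) :
    HasDerivAt (fun y => fieldPlane (x, y)) (fieldDrift (x, y) + formSum (x, y) (0, 1)) y := by
  obtain ⟨D, h2, h3⟩ := (isGapCoeff_deriv.isGapSummand (by norm_num)
    (isGapFun_stepOsc one_ne_zero)).hasDerivAt_comp le_rfl (hasDerivAt_line_y 0 x y)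
    (d := fun n : ℤ => deriv (deriv gapWidth) (y + n) * stepOsc 1 (x, y + n) +
      deriv gapWidth (y + n) * (fderiv ℝ (gapStep (bumpProfile 1) (bumpMass 1))
        (x, y + n) (0, 1) + leafSlope)) fun n => by
      simp only [add_shift_eq]
      exact hasDerivAt_driftSummand x y n
  have h6 : HasSum (fun n : ℤ => deriv (deriv gapWidth) (y + n) * stepOsc 1 (x, y + n))
      (fieldDrift (x, y)) :=
    ((isGapCoeff_deriv_deriv.isGapSummand (by norm_num)
      (isGapFun_stepOsc one_ne_zero)).summable le_rfl 0 x y).hasSum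
  have h7 := (h6.add (hasSum_formSum_apply x y (0, 1))).add
    ((hasSum_deriv_gapWidth y).mul_right leafSlope)
  rw [zero_mul, add_zero] at h7
  have h8 : D = fieldDrift (x, y) + formSum (x, y) (0, 1) := by
    refine h3.unique (h7.congr_fun fun n => ?_)
    rw [gapForm, smul_apply, smul_eq_mul]
    ring
  rw [← h8]
  exact h2.const_add leafSlope

/-- The differential splits into a `C¹` part, where the derivative falls on the coefficients, and
the sum of the `gapForm`s, which is only Hölder. The contributions of the linear parts of `stepOsc`
cancel because the derivatives of the widths sum to zero. -/
theorem fderiv_fieldPlane (p : ℝ × ℝ) :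
    fderiv ℝ fieldPlane p = fieldDrift p • ContinuousLinearMap.snd ℝ ℝ ℝ + formSum p := by
  obtain ⟨x, y⟩ := p
  have hdiff := (contDiff_fieldPlane.differentiable one_ne_zero (x, y)).hasFDerivAt
  have hx : fderiv ℝ fieldPlane (x, y) (1, 0) = formSum (x, y) (1, 0) := by
    have h1 : HasDerivAt (fun x : ℝ => ((x, y) : ℝ × ℝ)) (1, 0) x :=
      (hasDerivAt_id' x).prodMk (hasDerivAt_const x y)
    rw [formSum_apply_left]
    have h2 : HasDerivAt (fun x => fieldPlane (x, y)) (fderiv ℝ fieldPlane (x, y) (1, 0)) x :=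
      hdiff.comp_hasDerivAt_of_eq x h1 rfl
    exact h2.unique (hasDerivAt_fieldPlane x y)
  have hy : fderiv ℝ fieldPlane (x, y) (0, 1) = fieldDrift (x, y) + formSum (x, y) (0, 1) := by
    have h1 : HasDerivAt (fun y : ℝ => ((x, y) : ℝ × ℝ)) (0, 1) y :=
      (hasDerivAt_const y x).prodMk (hasDerivAt_id' y)
    have h2 : HasDerivAt (fun y => fieldPlane (x, y)) (fderiv ℝ fieldPlane (x, y) (0, 1)) y :=
      hdiff.comp_hasDerivAt_of_eq y h1 rfl
    exact h2.unique (hasDerivAt_fieldPlane_right x y)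
  refine ContinuousLinearMap.ext fun v => ?_
  have hv : v = v.1 • ((1, 0) : ℝ × ℝ) + v.2 • ((0, 1) : ℝ × ℝ) := by ext <;> simp
  rw [hv, map_add, map_add, map_smul, map_smul, map_smul, map_smul, hx, hy]
  simp

theorem exists_fderiv_fieldPlane_holder {α : ℝ} (hα : 0 < α) (hα1 : α < 1) :
    ∃ C, 0 < C ∧ ∀ p q, ‖fderiv ℝ fieldPlane p - fderiv ℝ fieldPlane q‖ ≤ C * ‖p - q‖ ^ α := by
  obtain ⟨C₁, hC₁, h₁⟩ := exists_formSum_holder hα hα1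
  obtain ⟨C₂, hC₂, h₂⟩ := isDoublyPeriodic_fieldDrift.exists_bound contDiff_fieldDrift.continuous
  obtain ⟨C₃, hC₃, h₃⟩ := isDoublyPeriodic_fieldDrift.exists_lipschitz contDiff_fieldDrift
  refine ⟨C₂ + C₂ + C₃ + C₁, by positivity, fun p q => ?_⟩
  have h4 := le_rpow_of_bounded_of_lipschitz (by positivity) hC₃.le (norm_nonneg (p - q)) hα hα1
    ((norm_sub_le _ _).trans (add_le_add (h₂ p) (h₂ q))) (h₃ p q)
  have e : fderiv ℝ fieldPlane p - fderiv ℝ fieldPlane q =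
      (fieldDrift p - fieldDrift q) • ContinuousLinearMap.snd ℝ ℝ ℝ + (formSum p - formSum q) := by
    rw [fderiv_fieldPlane, fderiv_fieldPlane]
    refine ContinuousLinearMap.ext fun v => ?_
    simp only [sub_apply, add_apply,
      smul_apply, smul_eq_mul]
    ring
  rw [e, add_mul]
  refine (norm_add_le _ _).trans (add_le_add ?_ (h₁ p q))
  rw [norm_smul]
  exact (mul_le_of_le_one_right (norm_nonneg _) (ContinuousLinearMap.norm_snd_le ℝ ℝ ℝ)).trans h4

theorem toT2_eq_iff {p q : ℝ × ℝ} :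
    toT2 p = toT2 q ↔ ∃ m n : ℤ, p.1 = q.1 + m ∧ p.2 = q.2 + n := by
  have h : ∀ a b : ℝ, ((a : S1) = (b : S1)) ↔ ∃ m : ℤ, a = b + m := fun a b => by
    rw [QuotientAddGroup.eq_iff_sub_mem, AddSubgroup.mem_zmultiples_iff]
    simp only [zsmul_eq_mul, mul_one, eq_sub_iff_add_eq']
    exact exists_congr fun m => eq_comm
  simp only [toT2, Prod.mk.injEq, h]
  exact ⟨fun ⟨⟨m, hm⟩, n, hn⟩ => ⟨m, n, hm, hn⟩, fun ⟨m, n, hm, hn⟩ => ⟨⟨m, hm⟩, n, hn⟩⟩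

theorem toT2_surjective : Function.Surjective toT2 := fun ⟨a, b⟩ => by
  obtain ⟨x, rfl⟩ := QuotientAddGroup.mk_surjective a
  obtain ⟨y, rfl⟩ := QuotientAddGroup.mk_surjective b
  exact ⟨(x, y), rfl⟩

theorem toT2_add_int (x y : ℝ) (m n : ℤ) : toT2 (x + m, y + n) = toT2 (x, y) :=
  toT2_eq_iff.2 ⟨m, n, rfl, rfl⟩

/-- The function on the torus induced by a function on the plane. -/
noncomputable def descend (f : ℝ × ℝ → ℝ) (z : T2) : ℝ := f (Function.surjInv toT2_surjective z)

theorem IsDoublyPeriodic.onPlane_descend {f : ℝ × ℝ → ℝ} (hf : IsDoublyPeriodic f) :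
    onPlane (descend f) = f := funext fun p => by
  obtain ⟨m, n, h1, h2⟩ := toT2_eq_iff.1 (Function.surjInv_eq toT2_surjective (toT2 p))
  rw [onPlane, descend, ← Prod.mk.eta (p := Function.surjInv toT2_surjective (toT2 p)), h1, h2, hf]

/-- The function `h` of the Denjoy vector field on the torus. -/
noncomputable def denjoyField : T2 → ℝ := descend fieldPlane

theorem onPlane_denjoyField : onPlane denjoyField = fieldPlane :=
  isDoublyPeriodic_fieldPlane.onPlane_descend

theorem dx_denjoyField (x y : ℝ) : dx denjoyField x y = fieldSlope x y := by
  rw [dx, onPlane_denjoyField]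
  exact (hasDerivAt_fieldPlane x y).deriv

theorem isC1AlphaForAll_denjoyField : IsC1AlphaForAll denjoyField := by
  refine ⟨by rw [onPlane_denjoyField]; exact contDiff_fieldPlane, fun α hα hα1 => ?_⟩
  obtain ⟨C, hC, h⟩ := exists_fderiv_fieldPlane_holder (α := α) (by exact_mod_cast hα)
    (by exact_mod_cast hα1)
  lift C to NNReal using hC.le
  refine ⟨C, fun p q => ?_⟩
  rw [onPlane_denjoyField, edist_dist, edist_dist, ENNReal.ofReal_rpow_of_nonneg dist_nonneg α.coe_nonneg,
    ← ENNReal.ofReal_coe_nnreal, ← ENNReal.ofReal_mul C.coe_nonneg]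
  refine ENNReal.ofReal_le_ofReal ?_
  rw [dist_eq_norm, dist_eq_norm]
  exact h p q

/-- The Denjoy continuum. -/
def denjoySet : Set T2 := toT2 '' denjoyPlane

theorem denjoyPlane_add_int (x y : ℝ) (m n : ℤ) :
    (x + m, y + n) ∈ denjoyPlane ↔ (x, y) ∈ denjoyPlane := by
  have h : ∀ (x y : ℝ) (m n : ℤ), (x, y) ∈ denjoyPlane → (x + m, y + n) ∈ denjoyPlane :=
    fun x y m n h i k hk => by
      refine h (n + i) (k - m) ?_
      push_cast
      simp only at hk ⊢
      rwa [← add_assoc, show x - (k - m : ℝ) = x + m - k by ring]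
  refine ⟨fun hc => ?_, h x y m n⟩
  have := h _ _ (-m) (-n) hc
  push_cast at this
  simpa using this

theorem toT2_mem_denjoySet {p : ℝ × ℝ} : toT2 p ∈ denjoySet ↔ p ∈ denjoyPlane := by
  refine ⟨?_, fun h => ⟨p, h, rfl⟩⟩
  rintro ⟨q, hq, h⟩
  obtain ⟨m, n, h1, h2⟩ := toT2_eq_iff.1 h.symm
  rw [← Prod.mk.eta (p := p), h1, h2, denjoyPlane_add_int]
  exact hq

theorem isQuotientMap_toT2 : IsQuotientMap toT2 := by
  have h : IsOpenMap toT2 :=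
    (QuotientAddGroup.isOpenMap_coe (N := AddSubgroup.zmultiples (1 : ℝ))).prodMap
      (QuotientAddGroup.isOpenMap_coe (N := AddSubgroup.zmultiples (1 : ℝ)))
  refine h.isQuotientMap ?_ toT2_surjective
  exact (continuous_quotient_mk'.comp continuous_fst).prodMk
    (continuous_quotient_mk'.comp continuous_snd)

theorem continuous_toT2 : Continuous toT2 := isQuotientMap_toT2.continuous

theorem isClosed_denjoySet : IsClosed denjoySet := by
  rw [← isQuotientMap_toT2.isClosed_preimage]
  have : toT2 ⁻¹' denjoySet = denjoyPlane := ext fun p => toT2_mem_denjoySet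
  rw [this]
  exact isClosed_denjoyPlane

end FieldHolder

/-! ### Integral curves of the field -/

section Solutions

open Filter Real

/-- The solutions of `x' = v (x, y)`. -/
def IsPlaneSolution (v : ℝ × ℝ → ℝ) (u : ℝ → ℝ) : Prop := ∀ s, HasDerivAt u (v (u s, s)) s

section GlobalExistence

variable {v : ℝ × ℝ → ℝ} {C K : ℝ}

theorem lipschitzWith_slice (hlip : ∀ p q, |v p - v q| ≤ K * ‖p - q‖) (t : ℝ) :
    LipschitzWith K.toNNReal fun x => v (x, t) := by
  refine LipschitzWith.of_dist_le' fun x y => ?_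
  refine (hlip (x, t) (y, t)).trans_eq ?_
  rw [dist_eq_norm]
  simp [Prod.norm_def]

theorem IsPlaneSolution.unique (hlip : ∀ p q, |v p - v q| ≤ K * ‖p - q‖)
    {u w : ℝ → ℝ} (hu : IsPlaneSolution v u) (hw : IsPlaneSolution v w) {s : ℝ}
    (h : u s = w s) : u = w :=
  ODE_solution_unique_univ (v := fun t x => v (x, t)) (s := fun _ => univ)
    (fun t => (lipschitzWith_slice hlip t).lipschitzOnWith)
    (fun t => ⟨hu t, mem_univ _⟩) (fun t => ⟨hw t, mem_univ _⟩) h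

theorem exists_solution_Icc (hC : 0 ≤ C) (hbd : ∀ p, |v p| ≤ C) (hv : Continuous v)
    (hlip : ∀ p q, |v p - v q| ≤ K * ‖p - q‖) (x₀ : ℝ) (N : ℕ) :
    ∃ α : ℝ → ℝ, α 0 = x₀ ∧ ∀ t ∈ Icc (-((N : ℝ) + 1)) (N + 1),
      HasDerivWithinAt α (v (α t, t)) (Icc (-((N : ℝ) + 1)) (N + 1)) t := by
  have h0 : (0 : ℝ) ∈ Icc (-((N : ℝ) + 1)) (N + 1) := ⟨by linarith [N.cast_nonneg (α := ℝ)],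
    by positivity⟩
  -- The field is bounded by `C`, so a ball of radius `C * (N + 1)` cannot be left during this time.
  have hpl : IsPicardLindelof (fun t x => v (x, t)) (tmin := -((N : ℝ) + 1)) (tmax := N + 1)
      ⟨0, h0⟩ x₀ (C.toNNReal * ((N : NNReal) + 1)) 0 C.toNNReal K.toNNReal := by
    refine ⟨fun t _ => (lipschitzWith_slice hlip t).lipschitzOnWith, fun x _ => ?_,
      fun t _ x _ => ?_, ?_⟩
    · exact (hv.comp (Continuous.prodMk_right x)).continuousOn
    · rw [Real.coe_toNNReal _ hC]; exact hbd _
    · simp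
  exact hpl.exists_eq_forall_mem_Icc_hasDerivWithinAt₀

theorem exists_isPlaneSolution (hC : 0 ≤ C) (hbd : ∀ p, |v p| ≤ C)
    (hv : Continuous v) (hlip : ∀ p q, |v p - v q| ≤ K * ‖p - q‖) (x₀ : ℝ) :
    ∃ u, IsPlaneSolution v u ∧ u 0 = x₀ := by
  choose α h0 hα using exists_solution_Icc hC hbd hv hlip x₀
  have hd : ∀ N : ℕ, ∀ t ∈ Ioo (-((N : ℝ) + 1)) (N + 1), HasDerivAt (α N) (v (α N t, t)) t :=
    fun N t ht => (hα N t (Ioo_subset_Icc_self ht)).hasDerivAt (Icc_mem_nhds ht.1 ht.2)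
  have heq : ∀ N M : ℕ, N ≤ M → EqOn (α N) (α M) (Icc (-((N : ℝ) + 1)) (N + 1)) := fun N M hNM => by
    have hNM' : (N : ℝ) ≤ M := by exact_mod_cast hNM
    have hsub : Icc (-((N : ℝ) + 1)) (N + 1) ⊆ Icc (-((M : ℝ) + 1)) (M + 1) :=
      Icc_subset_Icc (by linarith) (by linarith)
    have hsub' : Ioo (-((N : ℝ) + 1)) (N + 1) ⊆ Ioo (-((M : ℝ) + 1)) (M + 1) :=
      Ioo_subset_Ioo (by linarith) (by linarith)
    exact ODE_solution_unique_of_mem_Icc (v := fun t x => v (x, t)) (s := fun _ => univ) (t₀ := 0)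
      (fun t _ => (lipschitzWith_slice hlip t).lipschitzOnWith)
      ⟨by linarith [N.cast_nonneg (α := ℝ)], by positivity⟩
      (fun t ht => (hα N t ht).continuousWithinAt) (hd N) (fun _ _ => mem_univ _)
      (fun t ht => ((hα M t (hsub ht)).mono hsub).continuousWithinAt)
      (fun t ht => hd M t (hsub' ht)) (fun _ _ => mem_univ _) ((h0 N).trans (h0 M).symm)
  refine ⟨fun t => α ⌊|t|⌋₊ t, fun t => ?_, ?_⟩
  · have hu : ∀ s : ℝ, |s| < ⌊|t|⌋₊ + 1 → α ⌊|s|⌋₊ s = α ⌊|t|⌋₊ s := fun s hs => by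
      refine heq _ _ ?_ (abs_le.1 (Nat.lt_floor_add_one |s|).le)
      have : ⌊|s|⌋₊ < ⌊|t|⌋₊ + 1 := (Nat.floor_lt (abs_nonneg s)).2 (by exact_mod_cast hs)
      omega
    have ht : |t| < ⌊|t|⌋₊ + 1 := Nat.lt_floor_add_one |t|
    refine (hd ⌊|t|⌋₊ t (abs_lt.1 ht)).congr_of_eventuallyEq ?_
    filter_upwards [(isOpen_lt continuous_abs continuous_const).mem_nhds ht] with s hs
    exact hu s hs
  · exact h0 _

theorem IsPlaneSolution.continuous {u : ℝ → ℝ} (hu : IsPlaneSolution v u) : Continuous u :=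
  continuous_iff_continuousAt.2 fun s => (hu s).continuousAt

/-- Otherwise the two curves would meet, by the intermediate value theorem, and coincide by
uniqueness. -/
theorem IsPlaneSolution.lt (hlip : ∀ p q, |v p - v q| ≤ K * ‖p - q‖)
    {u w : ℝ → ℝ} (hu : IsPlaneSolution v u) (hw : IsPlaneSolution v w) {s : ℝ}
    (h : u s < w s) (t : ℝ) : u t < w t := by
  by_contra hc
  obtain ⟨r, hr⟩ := mem_range_of_exists_le_of_exists_ge (hu.continuous.sub hw.continuous)
    ⟨s, sub_nonpos.2 h.le⟩ ⟨t, sub_nonneg.2 (not_lt.1 hc)⟩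
  have := hu.unique hlip hw (sub_eq_zero.1 hr)
  rw [this] at h
  exact lt_irrefl _ h

theorem IsPlaneSolution.add_int (hv : IsDoublyPeriodic v) {u : ℝ → ℝ} (hu : IsPlaneSolution v u)
    (k : ℤ) : IsPlaneSolution v fun s => u s + k := fun s => by
  have := hv (u s) s k 0
  rw [Int.cast_zero, add_zero] at this
  rw [this]
  exact (hu s).add_const _

theorem IsPlaneSolution.shift_int (hv : IsDoublyPeriodic v) {u : ℝ → ℝ} (hu : IsPlaneSolution v u)
    (k : ℤ) : IsPlaneSolution v fun s => u (s + k) := fun s => by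
  have := hv (u (s + k)) s 0 k
  rw [Int.cast_zero, add_zero] at this
  rw [← this]
  exact (hu (s + k)).comp_add_const s k

end GlobalExistence

theorem exists_fieldPlane_bounds : ∃ C K, 0 ≤ C ∧ (∀ p, |fieldPlane p| ≤ C) ∧
    ∀ p q, |fieldPlane p - fieldPlane q| ≤ K * ‖p - q‖ := by
  obtain ⟨C, hC, h1⟩ := isDoublyPeriodic_fieldPlane.exists_bound contDiff_fieldPlane.continuous
  obtain ⟨K, -, h2⟩ := isDoublyPeriodic_fieldPlane.exists_lipschitz contDiff_fieldPlane
  exact ⟨C, K, hC.le, h1, h2⟩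

theorem fieldSolution_unique {u w : ℝ → ℝ} (hu : IsPlaneSolution fieldPlane u)
    (hw : IsPlaneSolution fieldPlane w) {s : ℝ} (h : u s = w s) : u = w := by
  obtain ⟨C, K, -, -, hlip⟩ := exists_fieldPlane_bounds
  exact hu.unique hlip hw h

theorem fieldSolution_lt {u w : ℝ → ℝ} (hu : IsPlaneSolution fieldPlane u)
    (hw : IsPlaneSolution fieldPlane w) {s : ℝ} (h : u s < w s) (t : ℝ) : u t < w t := by
  obtain ⟨C, K, -, -, hlip⟩ := exists_fieldPlane_bounds
  exact hu.lt hlip hw h t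

theorem exists_fieldSolution (x : ℝ) : ∃ u, IsPlaneSolution fieldPlane u ∧ u 0 = x := by
  obtain ⟨C, K, hC, hbd, hlip⟩ := exists_fieldPlane_bounds
  exact exists_isPlaneSolution hC hbd contDiff_fieldPlane.continuous hlip x

theorem isSolution_denjoyField_iff {u : ℝ → ℝ} :
    IsSolution denjoyField u ↔ IsPlaneSolution fieldPlane u := by
  simp only [IsSolution, IsPlaneSolution, onPlane_denjoyField]

/-! ### The leaves are solutions -/

theorem gapStep_leafL (θ y : ℝ) (n : ℤ) :
    gapStep (bumpProfile 1) (bumpMass 1) (leafL θ y, y + n) = ⌈θ - leafSlope * n⌉ := by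
  -- The last integer for which the gap labelled `leafSlope * n + k` lies strictly to the left of
  -- `θ`.
  set k := ⌈θ - leafSlope * n⌉ - 1 with hk
  have hσ := isProfile_bumpProfile (k := 1) one_ne_zero
  have hw := gapWidth_pos (y + n)
  have h1 : leafSlope * n + k < θ := by
    have := Int.ceil_lt_add_one (θ - leafSlope * n)
    rw [hk]; push_cast; linarith
  have h2 : θ ≤ leafSlope * n + (k + 1 : ℤ) := by
    have := Int.le_ceil (θ - leafSlope * n)
    rw [hk]; push_cast; linarith
  have h3 := leafL_jump h1 y
  have h4 := leafL_mono y h2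
  simp only [leafL_add_int] at h3 h4
  rw [← gapEdge_add_int] at h3 h4
  simp only [gapStep, bumpMass_one, one_mul]
  have h5 : (⌈θ - leafSlope * n⌉ : ℝ) = k + 1 := by rw [hk]; push_cast; ring
  rw [h5]
  -- In the equality case the leaf is the left edge of the next gap: the floor has already jumped,
  -- but the profile is still zero.
  rcases h4.eq_or_lt with h | h
  · have e : leafL θ y - gapEdge (y + n) = ((k + 1 : ℤ) : ℝ) := by rw [h]; ring
    rw [e, Int.floor_intCast, Int.fract_intCast, zero_div, hσ.zero 0 le_rfl]
    push_cast; ring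
  · push_cast at h
    have e : ⌊leafL θ y - gapEdge (y + n)⌋ = k := by
      rw [Int.floor_eq_iff]
      constructor <;> linarith
    rw [Int.fract, e, hσ.one, bumpMass_one]
    rw [le_div_iff₀ hw]
    linarith

theorem gapStep_leafR (θ y : ℝ) (n : ℤ) :
    gapStep (bumpProfile 1) (bumpMass 1) (leafR θ y, y + n) = ⌊θ - leafSlope * n⌋ + 1 := by
  have h1 : Tendsto (fun θ' => gapStep (bumpProfile 1) (bumpMass 1) (leafL θ' y, y + n)) (𝓝[>] θ)
      (𝓝 (gapStep (bumpProfile 1) (bumpMass 1) (leafR θ y, y + n))) :=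
    (contDiff_gapStep_bump.continuous.tendsto _).comp
      ((tendsto_leaf_right θ y).1.prodMk_nhds tendsto_const_nhds)
  have h2 : Tendsto (fun θ' => gapStep (bumpProfile 1) (bumpMass 1) (leafL θ' y, y + n)) (𝓝[>] θ)
      (𝓝 (⌊θ - leafSlope * n⌋ + 1 : ℝ)) := by
    refine tendsto_const_nhds.congr' ?_
    filter_upwards [eventually_saw_right θ (leafSlope * n)] with θ' h
    have h3 := h.1
    rw [saw, sub_left_inj] at h3
    rw [gapStep_leafL, h3]
  exact tendsto_nhds_unique h1 h2

/-- On such a curve every `stepOsc` differs from `e n` by `θ + leafSlope * y - u y`, which does not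
depend on `n` and drops out since the derivatives of the widths sum to zero. What remains of the
field is the derivative of `gapSeries 0 e`. -/
theorem isPlaneSolution_of_gapStep {u : ℝ → ℝ} {e : ℤ → ℝ} {θ : ℝ} (he : ∀ n, |e n| ≤ 1)
    (hu : ∀ y, u y = θ + leafSlope * y + gapSeries 0 e y)
    (h : ∀ (y : ℝ) (n : ℤ), gapStep (bumpProfile 1) (bumpMass 1) (u y, y + n) =
      e n + (θ - leafSlope * n)) : IsPlaneSolution fieldPlane u := fun y => by
  have hd : HasDerivAt u (leafSlope * 1 + gapSeries (0 + 1) e y) y := by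
    rw [show u = fun y => θ + leafSlope * y + gapSeries 0 e y from funext hu]
    exact (((hasDerivAt_id' y).const_mul leafSlope).const_add θ).add
      (hasDerivAt_gapSeries (k := 0) (by norm_num) he y)
  refine hd.congr_deriv ?_
  rw [mul_one, fieldPlane]
  congr 1
  have h1 := (summable_gapSeries (k := 1) (by norm_num) he y).hasSum
  have h2 := h1.add ((hasSum_deriv_gapWidth y).mul_right (θ + leafSlope * y - u y))
  rw [zero_mul, add_zero] at h2
  rw [show gapSeries (0 + 1) e y = ∑' n : ℤ, e n * iteratedDeriv 1 gapWidth (y + n) from rfl,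
    ← h2.tsum_eq, gapPot, gapSum]
  refine tsum_congr fun n => ?_
  have hn := h y n
  rw [bumpMass_one] at hn
  simp only [stepOsc, gapOsc, bumpMass_one, hn, iteratedDeriv_one]
  ring

theorem isPlaneSolution_leafL (θ : ℝ) : IsPlaneSolution fieldPlane (leafL θ) :=
  isPlaneSolution_of_gapStep (fun n => abs_saw_le (θ - leafSlope * n)) (fun y => rfl) fun y n => by
    rw [gapStep_leafL, saw]; ring

theorem isPlaneSolution_leafR (θ : ℝ) : IsPlaneSolution fieldPlane (leafR θ) :=
  isPlaneSolution_of_gapStep (fun n => abs_sawR_le (θ - leafSlope * n)) (fun y => rfl) fun y n => by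
    rw [gapStep_leafR, sawR]; ring

theorem eq_leaf_of_mem {u : ℝ → ℝ} (hu : IsPlaneSolution fieldPlane u) {s : ℝ}
    (h : (u s, s) ∈ denjoyPlane) : ∃ θ, u = leafL θ ∨ u = leafR θ := by
  obtain ⟨θ, hθ | hθ⟩ := mem_denjoyPlane_iff.1 h
  · exact ⟨θ, Or.inl (fieldSolution_unique hu (isPlaneSolution_leafL θ) hθ)⟩
  · exact ⟨θ, Or.inr (fieldSolution_unique hu (isPlaneSolution_leafR θ) hθ)⟩

theorem mem_denjoyPlane_of_solution {u : ℝ → ℝ} (hu : IsPlaneSolution fieldPlane u) {s : ℝ}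
    (h : (u s, s) ∈ denjoyPlane) (t : ℝ) : (u t, t) ∈ denjoyPlane := by
  obtain ⟨θ, rfl | rfl⟩ := eq_leaf_of_mem hu h
  · exact leafL_mem_denjoyPlane θ t
  · exact leafR_mem_denjoyPlane θ t

/-- The orbit of a leaf comes back to every level with a dense set of labels. -/
theorem frequently_label_left (c θ : ℝ) : ∃ᶠ θ' in 𝓝[<] θ, ∃ n k : ℤ, θ' = c + leafSlope * n + k :=
  (nhdsLT_basis θ).frequently_iff.2 fun a ha => by
    obtain ⟨n, k, h⟩ := exists_leafSlope_mem_Ioo ha c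
    exact ⟨_, h, n, k, rfl⟩

theorem frequently_label_right (c θ : ℝ) : ∃ᶠ θ' in 𝓝[>] θ, ∃ n k : ℤ, θ' = c + leafSlope * n + k :=
  (nhdsGT_basis θ).frequently_iff.2 fun a ha => by
    obtain ⟨n, k, h⟩ := exists_leafSlope_mem_Ioo ha c
    exact ⟨_, h, n, k, rfl⟩

theorem toT2_mem_orbitOf {ℓ : ℝ → ℝ → ℝ} (h1 : ∀ θ y k, ℓ (θ + (k : ℤ)) y = ℓ θ y + k)
    (h2 : ∀ θ y m, ℓ θ (y + (m : ℤ)) = ℓ (θ + leafSlope * m) y) (c y : ℝ) (n k : ℤ) :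
    toT2 (ℓ (c + leafSlope * n + k) y, y) ∈ orbitOf (ℓ c) := by
  refine ⟨y + n, ?_⟩
  show toT2 (ℓ c (y + n), y + n) = _
  rw [h1, h2]
  refine toT2_eq_iff.2 ⟨-k, n, ?_, rfl⟩
  push_cast; ring

/-- The orbit of the leaf `c` returns to level `y` with the labels `c + leafSlope * n + k`, which
are dense. Approaching `θ` through them from the left gives `leafL θ`, from the right `leafR θ`,
whichever edge the orbit follows. -/
theorem denjoySet_subset_closure_orbitOf {u : ℝ → ℝ} (hu : IsPlaneSolution fieldPlane u)
    (h : (u 0, 0) ∈ denjoyPlane) : denjoySet ⊆ closure (orbitOf u) := by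
  rintro _ ⟨⟨x, y⟩, hxy, rfl⟩
  obtain ⟨θ, hθ⟩ := mem_denjoyPlane_iff.1 hxy
  have key : ∀ (ℓ : ℝ → ℝ → ℝ) (c : ℝ), (∀ θ y k, ℓ (θ + (k : ℤ)) y = ℓ θ y + k) →
      (∀ θ y m, ℓ θ (y + (m : ℤ)) = ℓ (θ + leafSlope * m) y) →
      Tendsto (fun θ' => ℓ θ' y) (𝓝[<] θ) (𝓝 (leafL θ y)) →
      Tendsto (fun θ' => ℓ θ' y) (𝓝[>] θ) (𝓝 (leafR θ y)) →
      toT2 (x, y) ∈ closure (orbitOf (ℓ c)) := fun ℓ c h1 h2 hl hr => by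
    rcases hθ with rfl | rfl
    · refine mem_closure_of_frequently_of_tendsto (f := fun θ' => toT2 (ℓ θ' y, y))
        ((frequently_label_left c θ).mono ?_)
        ((continuous_toT2.tendsto _).comp (hl.prodMk_nhds tendsto_const_nhds))
      rintro _ ⟨n, k, rfl⟩
      exact toT2_mem_orbitOf h1 h2 c y n k
    · refine mem_closure_of_frequently_of_tendsto (f := fun θ' => toT2 (ℓ θ' y, y))
        ((frequently_label_right c θ).mono ?_)
        ((continuous_toT2.tendsto _).comp (hr.prodMk_nhds tendsto_const_nhds))
      rintro _ ⟨n, k, rfl⟩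
      exact toT2_mem_orbitOf h1 h2 c y n k
  obtain ⟨c, rfl | rfl⟩ := eq_leaf_of_mem hu h
  · exact key leafL c leafL_add_int leafL_add_level (tendsto_leaf_left θ y).1
      (tendsto_leaf_right θ y).1
  · exact key leafR c leafR_add_int leafR_add_level (tendsto_leaf_left θ y).2
      (tendsto_leaf_right θ y).2

theorem isMinimalSetOf_denjoySet : IsMinimalSetOf denjoyField denjoySet where
  nonempty := ⟨_, _, leafL_mem_denjoyPlane 0 0, rfl⟩
  closed := isClosed_denjoySet
  invariant u hu s hs := by
    rw [isSolution_denjoyField_iff] at hu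
    rintro _ ⟨t, rfl⟩
    exact toT2_mem_denjoySet.2 (mem_denjoyPlane_of_solution hu (toT2_mem_denjoySet.1 hs) t)
  dense u hu h := by
    rw [isSolution_denjoyField_iff] at hu
    exact denjoySet_subset_closure_orbitOf hu (toT2_mem_denjoySet.1 (h ⟨0, rfl⟩))

/-! ### The first return map -/

/-- The solution with value `x` at time zero. -/
noncomputable def fieldFlow (x : ℝ) : ℝ → ℝ := (exists_fieldSolution x).choose

theorem isPlaneSolution_fieldFlow (x : ℝ) : IsPlaneSolution fieldPlane (fieldFlow x) :=
  (exists_fieldSolution x).choose_spec.1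

theorem fieldFlow_zero (x : ℝ) : fieldFlow x 0 = x := (exists_fieldSolution x).choose_spec.2

theorem eq_fieldFlow {u : ℝ → ℝ} (hu : IsPlaneSolution fieldPlane u) : u = fieldFlow (u 0) :=
  fieldSolution_unique hu (isPlaneSolution_fieldFlow _) (fieldFlow_zero _).symm

theorem fieldFlow_strictMono : StrictMono fun x => fieldFlow x 1 := fun x y h =>
  fieldSolution_lt (isPlaneSolution_fieldFlow x) (isPlaneSolution_fieldFlow y) (s := 0)
    (by rwa [fieldFlow_zero, fieldFlow_zero]) 1

/-- The first return map. -/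
noncomputable def returnMap : CircleDeg1Lift where
  toFun x := fieldFlow x 1
  monotone' := fieldFlow_strictMono.monotone
  map_add_one' x := by
    have h := eq_fieldFlow ((isPlaneSolution_fieldFlow x).add_int isDoublyPeriodic_fieldPlane 1)
    rw [fieldFlow_zero, Int.cast_one] at h
    exact (congrFun h 1).symm

theorem returnMap_apply {u : ℝ → ℝ} (hu : IsPlaneSolution fieldPlane u) :
    returnMap (u 0) = u 1 := (congrFun (eq_fieldFlow hu) 1).symm

theorem iterate_returnMap {u : ℝ → ℝ} (hu : IsPlaneSolution fieldPlane u) (n : ℕ) :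
    returnMap^[n] (u 0) = u n := by
  induction n with
  | zero => simp
  | succ n ih =>
    rw [Function.iterate_succ_apply', ih]
    have h := returnMap_apply (hu.shift_int isDoublyPeriodic_fieldPlane n)
    simp only [Int.cast_natCast, zero_add] at h
    rw [h]
    push_cast
    rw [add_comm]

theorem returnMap_strictMono : StrictMono returnMap := fieldFlow_strictMono

theorem returnMap_surjective : Function.Surjective returnMap := fun z => by
  have h := (isPlaneSolution_fieldFlow z).shift_int isDoublyPeriodic_fieldPlane (-1)
  refine ⟨_, (returnMap_apply h).trans ?_⟩
  simp [fieldFlow_zero]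

/-- The leaf with label `0` stays within `1/2` of the line of slope `leafSlope`. -/
theorem translationNumber_returnMap : returnMap.translationNumber = leafSlope := by
  have h0 : ∀ n : ℕ, leafL 0 n ∈ Icc (leafSlope * n) (leafSlope * n + 1 / 2) := fun n => by
    simpa using leafL_mem 0 n
  have hlim : Tendsto (fun n : ℕ => (returnMap ^ n : CircleDeg1Lift) (leafL 0 0) / n) atTop
      (𝓝 leafSlope) := by
    have h1 : Tendsto (fun n : ℕ => leafSlope + (1 / 2) / (n : ℝ)) atTop (𝓝 (leafSlope + 0)) :=
      tendsto_const_nhds.add (tendsto_const_div_atTop_nhds_zero_nat _)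
    rw [add_zero] at h1
    refine tendsto_of_tendsto_of_tendsto_of_le_of_le' tendsto_const_nhds h1 ?_ ?_
    · filter_upwards [eventually_gt_atTop 0] with n hn
      have hn' : (0 : ℝ) < n := by exact_mod_cast hn
      rw [CircleDeg1Lift.coe_pow, iterate_returnMap (isPlaneSolution_leafL 0), le_div_iff₀ hn']
      exact (h0 n).1
    · filter_upwards [eventually_gt_atTop 0] with n hn
      have hn' : (0 : ℝ) < n := by exact_mod_cast hn
      rw [CircleDeg1Lift.coe_pow, iterate_returnMap (isPlaneSolution_leafL 0), div_le_iff₀ hn',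
        add_mul, div_mul_cancel₀ _ hn'.ne']
      exact (h0 n).2
  have h2 := returnMap.tendsto_translationNumber (leafL 0 0)
  refine tendsto_nhds_unique h2 ?_
  have h3 := hlim.sub (tendsto_const_div_atTop_nhds_zero_nat (leafL 0 0))
  rw [sub_zero] at h3
  refine h3.congr fun n => ?_
  rw [sub_div]

/-- The image on the circle of an open interval. -/
theorem isOpen_image_Ioo (a b : ℝ) : IsOpen ((fun x : ℝ => (x : S1)) '' Ioo a b) :=
  QuotientAddGroup.isOpenMap_coe _ isOpen_Ioo

/-- An orbit visits the gap at time zero at most once. -/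
theorem inGap_iterate_returnMap {x : ℝ} {n m : ℕ} (hn : 0 < gapBump (returnMap^[n] x) 0)
    (hm : 0 < gapBump (returnMap^[m] x) 0) : n = m := by
  set u := fieldFlow x with hu
  have hux : ∀ n : ℕ, returnMap^[n] x = u n := fun n => by
    have := iterate_returnMap (isPlaneSolution_fieldFlow x) n
    rwa [fieldFlow_zero] at this
  -- A solution that is between the two edges of the gap at its `n`-th return stays between them
  -- when followed back by `n` levels, so its starting point lies in the gap at time `-n`.
  have key : ∀ n : ℕ, 0 < gapBump (returnMap^[n] x) 0 → InGap (u 0) (0 + ((-n : ℤ) : ℝ)) :=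
    fun n hn => by
      obtain ⟨k, h1, h2⟩ := gapBump_pos_iff.1 hn
      have e : gapEdge 0 = leafL 0 0 := by simpa using gapEdge_add_int 0 0
      have eR : leafR k 0 = leafL k 0 + gapWidth 0 := by simpa using leafR_leafSlope_mul 0 k 0
      have eL : leafL k 0 = leafL 0 0 + k := by simpa using leafL_add_int 0 0 k
      rw [hux, e] at h1 h2
      have hsol := (isPlaneSolution_fieldFlow x).shift_int isDoublyPeriodic_fieldPlane n
      have hl := fieldSolution_lt (isPlaneSolution_leafL k) hsol (s := 0)
        (by simp only [zero_add, Int.cast_natCast]; rw [eL]; linarith) ((-n : ℤ) : ℝ)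
      have hr := fieldSolution_lt hsol (isPlaneSolution_leafR k) (s := 0)
        (by simp only [zero_add, Int.cast_natCast]; rw [eR, eL]; linarith) ((-n : ℤ) : ℝ)
      have e1 := leafL_add_level k 0 (-n)
      have e2 := leafR_add_level k 0 (-n)
      have e3 := leafR_leafSlope_mul (-n) k 0
      have e4 := leafL_add_int (leafSlope * ((-n : ℤ) : ℝ)) 0 k
      have e5 := gapEdge_add_int 0 (-n)
      rw [zero_add] at e1 e2
      have e6 : ((-n : ℤ) : ℝ) + ((n : ℤ) : ℝ) = 0 := by push_cast; ring
      simp only [e6] at hl hr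
      rw [add_comm (k : ℝ)] at e1 e2
      refine ⟨k, ?_, ?_⟩
      · rw [e5]; linarith
      · rw [e5]; linarith
  have := InGap.eq (key n hn) (key m hm)
  omega

theorem isDenjoyMap_returnMap : IsDenjoyMap returnMap where
  strictMono := returnMap_strictMono
  continuous := returnMap_strictMono.monotone.continuous_of_surjective returnMap_surjective
  irrational := by rw [translationNumber_returnMap]; exact irrational_leafSlope
  not_dense x hd := by
    set a := gapEdge 0
    set w := gapWidth 0
    have hw : 0 < w := gapWidth_pos 0
    have hw2 : w ≤ 1 / 2 := gapWidth_le_half 0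
    -- A dense orbit would visit both halves of the gap at time zero, hence at the same iterate; the
    -- two integer translates would then differ by an integer strictly between `0` and `1`.
    have key : ∀ b c : ℝ, a ≤ b → b < c → c ≤ a + w →
        ∃ n : ℕ, ∃ k : ℤ, returnMap^[n] x - k ∈ Ioo b c := fun b c _ hbc _ => by
      obtain ⟨_, ⟨z, hz, hz'⟩, n, rfl⟩ := hd.inter_open_nonempty _ (isOpen_image_Ioo b c)
        ((nonempty_Ioo.2 hbc).image _)
      have hz2 : toT2 (returnMap^[n] x, 0) = toT2 (z, 0) := by
        simp only [toT2]; exact Prod.ext hz'.symm rfl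
      obtain ⟨k, -, hk, -⟩ := toT2_eq_iff.1 hz2
      refine ⟨n, k, ?_⟩
      simp only at hk
      rwa [hk, add_sub_cancel_right]
    obtain ⟨n, k, hnk⟩ := key a (a + w / 2) le_rfl (by linarith) (by linarith)
    obtain ⟨m, l, hml⟩ := key (a + w / 2) (a + w) (by linarith) (by linarith) le_rfl
    have hn : 0 < gapBump (returnMap^[n] x) 0 :=
      gapBump_pos_iff.2 ⟨k, hnk.1, by linarith [hnk.2]⟩
    have hm : 0 < gapBump (returnMap^[m] x) 0 :=
      gapBump_pos_iff.2 ⟨l, by linarith [hml.1], hml.2⟩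
    obtain rfl := inGap_iterate_returnMap hn hm
    have h1 : ((k - l : ℤ) : ℝ) < 1 := by push_cast; linarith [hnk.1, hml.2]
    have h2 : ((0 : ℤ) : ℝ) < ((k - l : ℤ) : ℝ) := by push_cast; linarith [hnk.2, hml.1]
    have h1' : k - l < 1 := by exact_mod_cast h1
    have h2' : 0 < k - l := by exact_mod_cast h2
    omega

theorem isDenjoyContinuum_denjoySet : IsDenjoyContinuum denjoyField denjoySet :=
  ⟨⟨by rw [onPlane_denjoyField]; exact contDiff_fieldPlane, returnMap, isDenjoyMap_returnMap,
    fun u hu => (returnMap_apply (isSolution_denjoyField_iff.1 hu)).symm⟩,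
    isMinimalSetOf_denjoySet⟩

end Solutions

/-! ### Local construction of the perturbation over short cells -/

section Cells

open Filter Real

/-- Points `z i` of the real line between `i / N` and `(i + 1) / N`, periodic modulo `1`. -/
structure IsCellDivision (N : ℕ) (z : ℤ → ℝ) : Prop where
  pos : 0 < N
  mem : ∀ i : ℤ, z i ∈ Ioo ((i : ℝ) / N) ((i + 1) / N)
  add : ∀ i : ℤ, z (i + N) = z i + 1

theorem exists_isCellDivision {N : ℕ} (hN : 0 < N) {ζ : ℤ → ℝ}
    (hζ : ∀ i : ℤ, ζ i ∈ Ioo ((i : ℝ) / N) ((i + 1) / N)) :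
    IsCellDivision N fun i => ζ (i % N) + (i / N : ℤ) where
  pos := hN
  mem i := by
    have hN' : (0 : ℝ) < N := by exact_mod_cast hN
    have h := hζ (i % N)
    have e : ((i % N : ℤ) : ℝ) = i - N * (i / N : ℤ) := by
      have := Int.emod_add_mul_ediv i N
      have h2 : ((i % N + N * (i / N) : ℤ) : ℝ) = i := by exact_mod_cast this
      push_cast at h2 ⊢
      linarith
    rw [e, mem_Ioo, div_lt_iff₀ hN', lt_div_iff₀ hN'] at h
    rw [mem_Ioo, div_lt_iff₀ hN', lt_div_iff₀ hN']
    constructor <;> nlinarith [h.1, h.2]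
  add i := by
    have hN' : (N : ℤ) ≠ 0 := by exact_mod_cast hN.ne'
    rw [Int.add_emod_right, Int.add_ediv_of_dvd_right dvd_rfl, Int.ediv_self hN']
    push_cast
    ring

/-- The index of the cell of `x`. -/
noncomputable def cellIndex (N : ℕ) (z : ℤ → ℝ) (x : ℝ) : ℤ :=
  if z ⌊N * x⌋ ≤ x then ⌊N * x⌋ else ⌊N * x⌋ - 1

variable {N : ℕ} {z : ℤ → ℝ}

theorem IsCellDivision.strictMono (hz : IsCellDivision N z) : StrictMono z :=
  strictMono_int_of_lt_succ fun i => by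
    have := (hz.mem (i + 1)).1
    push_cast at this
    exact (hz.mem i).2.trans this

theorem IsCellDivision.length_lt (hz : IsCellDivision N z) (i : ℤ) :
    z (i + 1) - z i < 2 / N := by
  have h1 := (hz.mem (i + 1)).2
  have h2 := (hz.mem i).1
  push_cast at h1
  have : ((i : ℝ) + 1 + 1) / N = i / N + 2 / N := by ring
  linarith

theorem IsCellDivision.cellIndex_spec (hz : IsCellDivision N z) (x : ℝ) :
    z (cellIndex N z x) ≤ x ∧ x < z (cellIndex N z x + 1) := by
  have hN' : (0 : ℝ) < N := by exact_mod_cast hz.pos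
  have h1 := Int.floor_le ((N : ℝ) * x)
  have h2 := Int.lt_floor_add_one ((N : ℝ) * x)
  unfold cellIndex
  split_ifs with h
  · refine ⟨h, lt_trans ?_ (hz.mem _).1⟩
    rw [lt_div_iff₀ hN']
    push_cast
    linarith
  · rw [sub_add_cancel]
    refine ⟨(lt_of_lt_of_le (hz.mem _).2 ?_).le, not_le.1 h⟩
    rw [div_le_iff₀ hN']
    push_cast
    linarith

theorem IsCellDivision.cellIndex_eq (hz : IsCellDivision N z) {x : ℝ} {i : ℤ} (h1 : z i ≤ x)
    (h2 : x < z (i + 1)) : cellIndex N z x = i := by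
  obtain ⟨h3, h4⟩ := hz.cellIndex_spec x
  have h5 := hz.strictMono.lt_iff_lt.1 (h1.trans_lt h4)
  have h6 := hz.strictMono.lt_iff_lt.1 (h3.trans_lt h2)
  omega

theorem IsCellDivision.cellIndex_add_one (hz : IsCellDivision N z) (x : ℝ) :
    cellIndex N z (x + 1) = cellIndex N z x + N := by
  obtain ⟨h3, h4⟩ := hz.cellIndex_spec x
  refine hz.cellIndex_eq (by rw [hz.add]; linarith) ?_
  rw [add_right_comm, hz.add]; linarith

/-- The function equal to `Q i` over the `i`-th cell. -/
noncomputable def cellGlue (N : ℕ) (z : ℤ → ℝ) (Q : ℤ → ℝ × ℝ × ℝ → ℝ) (p : ℝ × ℝ × ℝ) : ℝ :=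
  Q (cellIndex N z p.2.1) p

/-- The pieces vanish within `a` of the ends of their cells, so across a division point both
neighbours are zero and the glued function is locally one of the pieces. -/
theorem IsCellDivision.cellGlue_eventuallyEq (hz : IsCellDivision N z) {Q : ℤ → ℝ × ℝ × ℝ → ℝ}
    {a : ℝ} (ha : 0 < a)
    (hQ : ∀ i (p : ℝ × ℝ × ℝ), p.2.1 ≤ z i + a ∨ z (i + 1) - a ≤ p.2.1 → Q i p = 0)
    (p : ℝ × ℝ × ℝ) : cellGlue N z Q =ᶠ[𝓝 p] Q (cellIndex N z p.2.1) := by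
  obtain ⟨h1, h2⟩ := hz.cellIndex_spec p.2.1
  set i := cellIndex N z p.2.1
  have h3 : z (i - 1) < z i := hz.strictMono (by omega)
  have hc : Continuous fun p : ℝ × ℝ × ℝ => p.2.1 := by fun_prop
  have hn : Ioo (max (z (i - 1)) (z i - a)) (z (i + 1)) ∈ 𝓝 p.2.1 :=
    Ioo_mem_nhds (max_lt (by linarith) (by linarith)) h2
  filter_upwards [hc.continuousAt hn] with p' hp'
  obtain ⟨h4, h5⟩ := hp'
  rw [max_lt_iff] at h4
  rcases le_or_gt (z i) p'.2.1 with h | h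
  · rw [cellGlue, hz.cellIndex_eq h h5]
  · have hi : cellIndex N z p'.2.1 = i - 1 :=
      hz.cellIndex_eq h4.1.le (by rwa [sub_add_cancel])
    rw [cellGlue, hi, hQ i p' (Or.inl (by linarith)),
      hQ (i - 1) p' (Or.inr (by rw [sub_add_cancel]; linarith))]

theorem Real.smoothTransition.deriv_nonneg (u : ℝ) : 0 ≤ deriv smoothTransition u :=
  Real.smoothTransition.monotone.deriv_nonneg

theorem Real.smoothTransition.deriv_eq_zero {u : ℝ} (hu : 1 ≤ u) :
    deriv smoothTransition u = 0 := by
  refine IsLocalMax.deriv_eq_zero (Eventually.of_forall fun v => ?_)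
  rw [Real.smoothTransition.one_of_one_le hu]
  exact Real.smoothTransition.le_one v

/-- A bump function in the interval `[l, r]`. -/
noncomputable def cellBump (a l r x : ℝ) : ℝ :=
  smoothTransition ((x - l) / a - 1) * smoothTransition ((r - x) / a - 1)

theorem contDiff_cellBump (a l r : ℝ) : ContDiff ℝ 2 (cellBump a l r) := by
  have h := Real.smoothTransition.contDiff (n := 2)
  exact (h.comp (((contDiff_id.sub contDiff_const).div_const _).sub contDiff_const)).mul
    (h.comp (((contDiff_const.sub contDiff_id).div_const _).sub contDiff_const))

theorem cellBump_nonneg (a l r x : ℝ) : 0 ≤ cellBump a l r x :=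
  mul_nonneg (Real.smoothTransition.nonneg _) (Real.smoothTransition.nonneg _)

theorem cellBump_le_one (a l r x : ℝ) : cellBump a l r x ≤ 1 :=
  mul_le_one₀ (Real.smoothTransition.le_one _) (Real.smoothTransition.nonneg _)
    (Real.smoothTransition.le_one _)

theorem cellBump_eq_zero {a l r x : ℝ} (ha : 0 < a) (h : x ≤ l + a ∨ r - a ≤ x) :
    cellBump a l r x = 0 := by
  rcases h with h | h
  · rw [cellBump, Real.smoothTransition.zero_of_nonpos, zero_mul]
    rw [sub_nonpos, div_le_one ha]; linarith
  · rw [cellBump, mul_comm, Real.smoothTransition.zero_of_nonpos, zero_mul]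
    rw [sub_nonpos, div_le_one ha]; linarith

theorem cellBump_eq_one {a l r x : ℝ} (ha : 0 < a) (h1 : l + 2 * a ≤ x) (h2 : x ≤ r - 2 * a) :
    cellBump a l r x = 1 := by
  rw [cellBump, Real.smoothTransition.one_of_one_le, Real.smoothTransition.one_of_one_le, one_mul]
  · rw [le_sub_iff_add_le, le_div_iff₀ ha]; linarith
  · rw [le_sub_iff_add_le, le_div_iff₀ ha]; linarith

/-- The bump function increases to the left and decreases to the right of any point of the
middle of the interval. -/
theorem exists_hasDerivAt_cellBump {a l r : ℝ} (ha : 0 < a) (x : ℝ) :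
    ∃ d, HasDerivAt (cellBump a l r) d x ∧
      ∀ μ, l + 2 * a ≤ μ → μ ≤ r - 2 * a → 0 ≤ d * (μ - x) := by
  have hS : ∀ u, HasDerivAt smoothTransition (deriv smoothTransition u) u := fun u =>
    ((Real.smoothTransition.contDiff (n := 1)).differentiable one_ne_zero u).hasDerivAt
  have h1 := (hS ((x - l) / a - 1)).comp x
    ((((hasDerivAt_id' x).sub_const l).div_const a).sub_const 1)
  have h2 := (hS ((r - x) / a - 1)).comp x
    ((((hasDerivAt_id' x).const_sub r).div_const a).sub_const 1)
  refine ⟨_, h1.mul h2, fun μ hμ1 hμ2 => ?_⟩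
  set s₁ := deriv smoothTransition ((x - l) / a - 1)
  set s₂ := deriv smoothTransition ((r - x) / a - 1)
  have p1 : 0 ≤ s₁ := Real.smoothTransition.deriv_nonneg _
  have p2 : 0 ≤ s₂ := Real.smoothTransition.deriv_nonneg _
  have q1 : l + 2 * a ≤ x → s₁ = 0 := fun h => Real.smoothTransition.deriv_eq_zero (by
    rw [le_sub_iff_add_le, le_div_iff₀ ha]; linarith)
  have q2 : x ≤ r - 2 * a → s₂ = 0 := fun h => Real.smoothTransition.deriv_eq_zero (by
    rw [le_sub_iff_add_le, le_div_iff₀ ha]; linarith)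
  have n1 := Real.smoothTransition.nonneg ((x - l) / a - 1)
  have n2 := Real.smoothTransition.nonneg ((r - x) / a - 1)
  have e : (s₁ * (1 / a) * smoothTransition ((r - x) / a - 1) +
      smoothTransition ((x - l) / a - 1) * (s₂ * (-1 / a))) * (μ - x) =
      (s₁ * (μ - x) * smoothTransition ((r - x) / a - 1) +
        s₂ * (x - μ) * smoothTransition ((x - l) / a - 1)) / a := by
    ring
  refine le_of_le_of_eq ?_ e.symm
  refine div_nonneg (add_nonneg (mul_nonneg ?_ n2) (mul_nonneg ?_ n1)) ha.le
  · rcases le_or_gt (l + 2 * a) x with h | h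
    · rw [q1 h, zero_mul]
    · exact mul_nonneg p1 (by linarith)
  · rcases le_or_gt x (r - 2 * a) with h | h
    · rw [q2 h, zero_mul]
    · exact mul_nonneg p2 (by linarith)

/-- A perturbation of the coordinate `x` near the level `y₀` of the Denjoy continuum that vanishes
along `A`. -/
structure IsLocalShear (A : Set (ℝ × ℝ)) (ε y₀ κ : ℝ) (P : ℝ × ℝ × ℝ → ℝ) : Prop where
  contDiff : ContDiff ℝ 2 P
  add_int : ∀ (t x y : ℝ) (m n : ℤ), P (t, x + m, y + n) = P (t, x, y)
  abs_le : ∀ t x y, |t| < κ → |P (t, x, y)| ≤ ε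
  hasDerivAt_left : ∀ t x y, |t| < κ → ∃ d, HasDerivAt (fun x => P (t, x, y)) d x ∧ 0 ≤ 1 + d ∧
    (¬ (t = 0 ∧ (x, y) ∈ denjoyPlane) → 0 < 1 + d)
  hasDerivAt_of_mem : ∀ x y, |y - y₀| < κ → (x, y) ∈ denjoyPlane →
    HasDerivAt (fun x => P (0, x, y)) (-1) x ∧
      HasDerivAt (fun t => P (t, x, y)) (-fieldPlane (x, y)) 0
  eq_zero : ∀ t x y, |t| < κ → |y - y₀| < κ → (x, y - t) ∈ A → P (t, x, y) = 0

/-- The cell `(z i, z (i + 1))` meets the Denjoy continuum near the level `y₀`. -/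
def IsActiveCell (z : ℤ → ℝ) (y₀ η : ℝ) (i : ℤ) : Prop :=
  ∃ x y, (x, y) ∈ denjoyPlane ∧ z i < x ∧ x < z (i + 1) ∧ |y - y₀| < η

open Classical in
/-- The perturbation over the `i`-th cell. -/
noncomputable def cellShear (N : ℕ) (z : ℤ → ℝ) (y₀ η : ℝ) (M : ℝ × ℝ × ℝ → ℝ) (i : ℤ)
    (p : ℝ × ℝ × ℝ) : ℝ :=
  if IsActiveCell z y₀ η i then cellBump (η / 4) (z i) (z (i + 1)) p.2.1 *
    ((z i + z (i + 1)) / 2 - p.2.1 + M (p.1, p.2.1 - (i / N : ℤ), p.2.2)) else 0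

theorem cellShear_of_active {y₀ η : ℝ} {M : ℝ × ℝ × ℝ → ℝ} {i : ℤ} (h : IsActiveCell z y₀ η i) :
    cellShear N z y₀ η M i = fun p => cellBump (η / 4) (z i) (z (i + 1)) p.2.1 *
      ((z i + z (i + 1)) / 2 - p.2.1 + M (p.1, p.2.1 - (i / N : ℤ), p.2.2)) := by
  funext p; rw [cellShear, if_pos h]

theorem cellShear_of_not_active {y₀ η : ℝ} {M : ℝ × ℝ × ℝ → ℝ} {i : ℤ}
    (h : ¬ IsActiveCell z y₀ η i) : cellShear N z y₀ η M i = fun _ => 0 := by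
  funext p; rw [cellShear, if_neg h]

theorem IsCellDivision.isActiveCell_add (hz : IsCellDivision N z) {y₀ η : ℝ} {i : ℤ} :
    IsActiveCell z y₀ η (i + N) ↔ IsActiveCell z y₀ η i := by
  have hs : z (i + N + 1) = z (i + 1) + 1 := by rw [add_right_comm, hz.add]
  have hd : ∀ x y : ℝ, (x + 1, y) ∈ denjoyPlane ↔ (x, y) ∈ denjoyPlane := fun x y => by
    simpa using denjoyPlane_add_int x y 1 0
  simp only [IsActiveCell, hz.add, hs]
  constructor
  · rintro ⟨x, y, h, h1, h2, h3⟩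
    exact ⟨x - 1, y, (hd _ _).1 (by rwa [sub_add_cancel]), by linarith, by linarith, h3⟩
  · rintro ⟨x, y, h, h1, h2, h3⟩
    exact ⟨x + 1, y, (hd _ _).2 h, by linarith, by linarith, h3⟩

theorem IsCellDivision.cellShear_add_one (hz : IsCellDivision N z) (y₀ η : ℝ)
    (M : ℝ × ℝ × ℝ → ℝ) (i : ℤ) (t x y : ℝ) :
    cellShear N z y₀ η M (i + N) (t, x + 1, y) = cellShear N z y₀ η M i (t, x, y) := by
  have hN : (N : ℤ) ≠ 0 := by exact_mod_cast hz.pos.ne'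
  by_cases h : IsActiveCell z y₀ η i
  · rw [cellShear_of_active h, cellShear_of_active (hz.isActiveCell_add.2 h)]
    have hs : z (i + N + 1) = z (i + 1) + 1 := by rw [add_right_comm, hz.add]
    have hd : (i + N) / (N : ℤ) = i / N + 1 := by
      rw [Int.add_ediv_of_dvd_right dvd_rfl, Int.ediv_self hN]
    simp only [hs, hz.add, hd, cellBump]
    push_cast
    rw [show x + 1 - (((i / (N : ℤ) : ℤ) : ℝ) + 1) = x - ((i / (N : ℤ) : ℤ) : ℝ) by ring,
      show x + 1 - (z i + 1) = x - z i by ring,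
      show z (i + 1) + 1 - (x + 1) = z (i + 1) - x by ring]
    ring
  · rw [cellShear_of_not_active h, cellShear_of_not_active fun hc => h (hz.isActiveCell_add.1 hc)]

/-- The potential is not periodic in `x`; its argument is brought back near the unit interval, where
it is small. -/
theorem IsCellDivision.sub_ediv_mem (hz : IsCellDivision N z) {i : ℤ} {x : ℝ} (h1 : z i ≤ x)
    (h2 : x < z (i + 1)) : |x - (i / N : ℤ)| ≤ 2 := by
  have hN' : (0 : ℝ) < N := by exact_mod_cast hz.pos
  have hN1 : (1 : ℝ) ≤ N := by exact_mod_cast hz.pos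
  have hNz : (0 : ℤ) < N := by exact_mod_cast hz.pos
  have h3 := (hz.mem i).1.trans_le h1
  have h4 := h2.trans (hz.mem (i + 1)).2
  have h5 : ((N * (i / N : ℤ) : ℤ) : ℝ) ≤ i := by
    exact_mod_cast Int.mul_ediv_self_le hNz.ne'
  have h6 : (i : ℝ) + 1 ≤ ((N * (i / N : ℤ) + N : ℤ) : ℝ) := by
    have := Int.lt_mul_ediv_self_add (x := i) hNz
    exact_mod_cast this
  push_cast at h4 h5 h6
  rw [div_lt_iff₀ hN'] at h3
  rw [lt_div_iff₀ hN'] at h4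
  rw [abs_le]
  constructor <;> nlinarith

/-- In an active cell `x + P` interpolates between `x` and `midpoint + M`. Outside the active cells
`P` is zero; active cells are too short to contain points over which `A` must be respected. -/
theorem exists_isLocalShear {A : Set (ℝ × ℝ)} {ρ ε : ℝ} (hρ : 0 < ρ)
    (hA : ∀ p ∈ A, ∀ q ∈ denjoyPlane, ρ ≤ ‖p - q‖) (hε : 0 < ε) (y₀ : ℝ) :
    ∃ κ, 0 < κ ∧ ∃ P, IsLocalShear A ε y₀ κ P := by
  -- the cells
  obtain ⟨N, hN⟩ := exists_nat_gt (max (2 / ε) (4 / ρ))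
  rw [max_lt_iff] at hN
  have hN0 : (0 : ℝ) < N := lt_trans (by positivity) hN.1
  have hNε : 1 / (N : ℝ) ≤ ε / 2 := by
    rw [div_le_iff₀ hN0]
    have := (div_lt_iff₀ hε).1 hN.1
    nlinarith
  have hNρ : 2 / (N : ℝ) ≤ ρ / 2 := by
    rw [div_le_iff₀ hN0]
    have := (div_lt_iff₀ hρ).1 hN.2
    nlinarith
  have hNn : 0 < N := by exact_mod_cast hN0
  have hex : ∀ i : ℤ, ∃ x ∈ Ioo ((i : ℝ) / N) ((i + 1) / N), (x, y₀) ∉ denjoyPlane := fun i =>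
    exists_notMem_denjoyPlane (by gcongr; linarith) y₀
  choose ζ hζ hζD using hex
  have hz := exists_isCellDivision hNn hζ
  set z : ℤ → ℝ := fun i => ζ (i % N) + (i / N : ℤ) with hzdef
  -- The division points are off the closed set `denjoyPlane` at level `y₀`; since there are
  -- finitely many modulo one, a common `η` isolates all of them.
  obtain ⟨η, hη, hηρ, hηD⟩ : ∃ η, 0 < η ∧ η ≤ ρ / 8 ∧
      ∀ i : ℤ, ∀ x y, |x - z i| < η → |y - y₀| < η → (x, y) ∉ denjoyPlane := by
    have h1 : ∀ i ∈ Finset.range N, ∀ᶠ η in 𝓝[>] (0 : ℝ), ∀ x y, |x - ζ i| < η → |y - y₀| < η →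
        (x, y) ∉ denjoyPlane := fun i _ => by
      obtain ⟨r, hr, hball⟩ := Metric.isOpen_iff.1 isClosed_denjoyPlane.isOpen_compl (ζ i, y₀)
        (hζD i)
      filter_upwards [Ioo_mem_nhdsGT hr] with η hη x y hx hy
      refine hball ?_
      rw [Metric.mem_ball, Prod.dist_eq, max_lt_iff]
      exact ⟨hx.trans hη.2, hy.trans hη.2⟩
    obtain ⟨η, h2, h3⟩ := (((Finset.eventually_all _).2 h1).and
      (Ioc_mem_nhdsGT (show (0 : ℝ) < ρ / 8 by positivity))).exists
    refine ⟨η, h3.1, h3.2, fun i x y hx hy hm => ?_⟩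
    have hNz : (0 : ℤ) < N := by exact_mod_cast hNn
    have h4 := Int.emod_nonneg i hNz.ne'
    have h5 := Int.emod_lt_of_pos i hNz
    have h6 := h2 (i % N).toNat (Finset.mem_range.2 (by omega)) (x - (i / N : ℤ)) y
    rw [Int.toNat_of_nonneg h4] at h6
    refine h6 (by rw [hzdef] at hx; simpa [sub_sub, add_comm] using hx) hy ?_
    have := (denjoyPlane_add_int x y (-(i / N)) 0).2 hm
    simpa [sub_eq_add_neg] using this
  -- Smallness `ε / 2` is for closeness to `x`; `η / 2` keeps `midpoint + M` in the part of an
  -- active cell where the bump is one, as such a cell has length at least `2 * η`.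
  obtain ⟨M, hM, τ, hτ, hMτ⟩ := exists_isPotential 2 (lt_min (half_pos hε) (half_pos hη))
  set κ := min τ η with hκ
  have hκ0 : 0 < κ := lt_min hτ hη
  have ha : 0 < η / 4 := by positivity
  set Q := cellShear N z y₀ η M with hQd
  have hQ0 : ∀ i (p : ℝ × ℝ × ℝ), p.2.1 ≤ z i + η / 4 ∨ z (i + 1) - η / 4 ≤ p.2.1 → Q i p = 0 :=
    fun i p h => by
      by_cases hi : IsActiveCell z y₀ η i
      · simp only [hQd, cellShear_of_active hi, cellBump_eq_zero ha h, zero_mul]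
      · simp only [hQd, cellShear_of_not_active hi]
  have hQc : ∀ i, ContDiff ℝ 2 (Q i) := fun i => by
    by_cases hi : IsActiveCell z y₀ η i
    · rw [hQd, cellShear_of_active hi]
      have h1 : ContDiff ℝ 2 fun p : ℝ × ℝ × ℝ => cellBump (η / 4) (z i) (z (i + 1)) p.2.1 :=
        (contDiff_cellBump _ _ _).comp (by fun_prop)
      have h2 : ContDiff ℝ 2 fun p : ℝ × ℝ × ℝ => M (p.1, p.2.1 - (i / N : ℤ), p.2.2) :=
        hM.contDiff.comp (by fun_prop)
      have h3 : ContDiff ℝ 2 fun p : ℝ × ℝ × ℝ => (z i + z (i + 1)) / 2 - p.2.1 := by fun_prop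
      exact h1.mul (h3.add h2)
    · rw [hQd, cellShear_of_not_active hi]
      exact contDiff_const
  set P := cellGlue N z Q with hPd
  have hPQ : ∀ p, P =ᶠ[𝓝 p] Q (cellIndex N z p.2.1) := hz.cellGlue_eventuallyEq ha hQ0
  -- an active cell is long, and the Denjoy continuum stays away from its ends
  have hfar : ∀ x y (i : ℤ), (x, y) ∈ denjoyPlane → |y - y₀| < η → η ≤ |x - z i| :=
    fun x y i hm hy => not_lt.1 fun hc => hηD i x y hc hy hm
  have hins : ∀ x y (i : ℤ), (x, y) ∈ denjoyPlane → |y - y₀| < η → z i ≤ x → x < z (i + 1) →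
      z i + η ≤ x ∧ x ≤ z (i + 1) - η := fun x y i hm hy h1 h2 => by
    have h3 := hfar x y i hm hy
    have h4 := hfar x y (i + 1) hm hy
    rw [abs_of_nonneg (by linarith)] at h3
    rw [abs_of_nonpos (by linarith)] at h4
    constructor <;> linarith
  have hlen : ∀ i, IsActiveCell z y₀ η i → 2 * η ≤ z (i + 1) - z i := by
    rintro i ⟨x, y, hm, h1, h2, hy⟩
    have := hins x y i hm hy h1.le h2
    linarith
  have hMs : ∀ (t x y : ℝ) (i : ℤ), |t| < κ → z i ≤ x → x < z (i + 1) →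
      |M (t, x - (i / N : ℤ), y)| < min (ε / 2) (η / 2) := fun t x y i ht h1 h2 =>
    hMτ t _ y (ht.trans_le (min_le_left _ _)) (hz.sub_ediv_mem h1 h2)
  have hDs : ∀ (x y : ℝ) (k : ℤ), (x - k, y) ∈ denjoyPlane ↔ (x, y) ∈ denjoyPlane := fun x y k => by
    have := denjoyPlane_add_int x y (-k) 0
    simpa [← sub_eq_add_neg] using this
  refine ⟨κ, hκ0, P, ?_, ?_, ?_, ?_, ?_, ?_⟩
  · rw [contDiff_iff_contDiffAt]
    exact fun p => (hQc _).contDiffAt.congr_of_eventuallyEq (hPQ p)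
  · have hone : ∀ t x y, P (t, x + 1, y) = P (t, x, y) := fun t x y => by
      simp only [hPd, cellGlue, hz.cellIndex_add_one]
      exact hz.cellShear_add_one y₀ η M _ t x y
    have hper : ∀ t y, Function.Periodic (fun x => P (t, x, y)) 1 := fun t y x => hone t x y
    have hy : ∀ t x y (n : ℤ), P (t, x, y + n) = P (t, x, y) := fun t x y n => by
      simp only [hPd, cellGlue, hQd, cellShear, hM.add_int]
    intro t x y m n
    rw [hy]
    simpa using (hper t y).int_mul m x
  · intro t x y ht
    obtain ⟨h1, h2⟩ := hz.cellIndex_spec x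
    set i := cellIndex N z x with hi
    have e : P (t, x, y) = Q i (t, x, y) := rfl
    rw [e]
    by_cases hact : IsActiveCell z y₀ η i
    · rw [hQd, cellShear_of_active hact]
      have h3 := (hMs t x y i ht h1 h2).trans_le (min_le_left _ _)
      have h4 := hz.length_lt i
      have h5 : |(z i + z (i + 1)) / 2 - x| ≤ 1 / N := by
        have : 2 / (N : ℝ) = 2 * (1 / N) := by ring
        rw [abs_le]
        constructor <;> linarith
      rw [abs_mul, abs_of_nonneg (cellBump_nonneg _ _ _ _)]
      refine (mul_le_of_le_one_left (abs_nonneg _) (cellBump_le_one _ _ _ _)).trans ?_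
      refine (abs_add_le _ _).trans ?_
      linarith
    · rw [hQd, cellShear_of_not_active hact, abs_zero]
      exact hε.le
  · intro t x y ht
    obtain ⟨h1, h2⟩ := hz.cellIndex_spec x
    have hev := hPQ (t, x, y)
    simp only at hev
    set i := cellIndex N z x with hi
    have hcx : Tendsto (fun x' : ℝ => ((t, x', y) : ℝ × ℝ × ℝ)) (𝓝 x) (𝓝 (t, x, y)) :=
      (hasDerivAt_line_x t x y).continuousAt
    have hev' := hcx.eventually hev
    by_cases hact : IsActiveCell z y₀ η i
    · obtain ⟨d, hd, hd'⟩ := exists_hasDerivAt_cellBump (l := z i) (r := z (i + 1)) ha x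
      obtain ⟨m, hm, hm0, hm1, -⟩ := hM.hasDerivAt_left t (x - (i / N : ℤ)) y
      rw [hDs] at hm1
      have hm' := hm.comp_sub_const x ((i / N : ℤ) : ℝ)
      set b := cellBump (η / 4) (z i) (z (i + 1)) x with hb
      -- The derivative of `x + P` is `(1 - b) + b * m + d * (μ - x)`. The last term is nonnegative
      -- because the bump rises to the left and falls to the right of `μ`.
      set μ := (z i + z (i + 1)) / 2 + M (t, x - (i / N : ℤ), y) with hμ
      have hMt := (hMs t x y i ht h1 h2).trans_le (min_le_right _ _)
      have hμ' := abs_lt.1 hMt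
      have hl := hlen i hact
      have hdμ : 0 ≤ d * (μ - x) := hd' μ (by linarith) (by linarith)
      have hb0 : 0 ≤ b := cellBump_nonneg _ _ _ _
      have hb1 : b ≤ 1 := cellBump_le_one _ _ _ _
      refine ⟨d * (μ - x) + b * (-1 + m), HasDerivAt.congr_of_eventuallyEq ?_ hev', ?_, ?_⟩
      · simp only [hQd, cellShear_of_active hact]
        have h3 := hd.mul (((hasDerivAt_id' x).const_sub ((z i + z (i + 1)) / 2)).add hm')
        refine h3.congr_deriv ?_
        rw [hμ]
        simp only [Pi.add_apply]
        ring
      · have : 0 ≤ b * m := mul_nonneg hb0 hm0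
        linarith
      · intro hn
        rcases hb1.eq_or_lt with h | h
        · have := hm1 hn
          rw [h]; linarith
        · have : 0 ≤ b * m := mul_nonneg hb0 hm0
          linarith
    · refine ⟨0, HasDerivAt.congr_of_eventuallyEq ?_ hev', by norm_num, fun _ => by norm_num⟩
      simp only [hQd, cellShear_of_not_active hact]
      exact hasDerivAt_const _ _
  · intro x y hy hmem
    have hyη : |y - y₀| < η := hy.trans_le (min_le_right _ _)
    obtain ⟨h1, h2⟩ := hz.cellIndex_spec x
    have hev := hPQ (0, x, y)
    simp only at hev
    set i := cellIndex N z x with hi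
    obtain ⟨h3, h4⟩ := hins x y i hmem hyη h1 h2
    have hact : IsActiveCell z y₀ η i := ⟨x, y, hmem, by linarith, h2, hyη⟩
    -- The continuum stays `η` away from the ends of the cell, where the bump is one, so `x + P` is
    -- `M` up to a constant and inherits its derivatives.
    have hev2 : P =ᶠ[𝓝 ((0, x, y) : ℝ × ℝ × ℝ)] fun p =>
        (z i + z (i + 1)) / 2 - p.2.1 + M (p.1, p.2.1 - (i / N : ℤ), p.2.2) := by
      have hc : Continuous fun p : ℝ × ℝ × ℝ => p.2.1 := by fun_prop
      have hn : Ioo (z i + 2 * (η / 4)) (z (i + 1) - 2 * (η / 4)) ∈ 𝓝 x :=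
        Ioo_mem_nhds (by linarith) (by linarith)
      filter_upwards [hev, hc.continuousAt (x := ((0, x, y) : ℝ × ℝ × ℝ)) hn] with p hp hp'
      rw [hp, hQd, cellShear_of_active hact]
      simp only
      rw [cellBump_eq_one ha hp'.1.le hp'.2.le, one_mul]
    constructor
    · have hcx : Tendsto (fun x' : ℝ => ((0, x', y) : ℝ × ℝ × ℝ)) (𝓝 x) (𝓝 (0, x, y)) :=
        (hasDerivAt_line_x 0 x y).continuousAt
      obtain ⟨m, hm, -, -, hm2⟩ := hM.hasDerivAt_left 0 (x - (i / N : ℤ)) y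
      rw [hDs] at hm2
      rw [hm2 ⟨rfl, hmem⟩] at hm
      refine HasDerivAt.congr_of_eventuallyEq ?_ (hcx.eventually hev2)
      refine (((hasDerivAt_id' x).const_sub ((z i + z (i + 1)) / 2)).add
        (hm.comp_sub_const x ((i / N : ℤ) : ℝ))).congr_deriv ?_
      ring
    · have hct : Tendsto (fun t : ℝ => ((t, x, y) : ℝ × ℝ × ℝ)) (𝓝 0) (𝓝 (0, x, y)) :=
        (hasDerivAt_line_t 0 x y).continuousAt
      refine HasDerivAt.congr_of_eventuallyEq ?_ (hct.eventually hev2)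
      have h5 := hM.hasDerivAt_zero (x - (i / N : ℤ)) y
      have h6 := fieldPlane_add_int x y (-(i / N)) 0
      push_cast at h6
      rw [← sub_eq_add_neg, add_zero] at h6
      rw [h6] at h5
      exact h5.const_add ((z i + z (i + 1)) / 2 - x)
  · intro t x y ht hy hmem
    obtain ⟨h1, h2⟩ := hz.cellIndex_spec x
    set i := cellIndex N z x with hi
    have e : P (t, x, y) = Q i (t, x, y) := rfl
    rw [e]
    by_cases hact : IsActiveCell z y₀ η i
    · exfalso
      -- An active cell contains a point of the continuum within `ρ / 2` horizontally and within `3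
      -- * η < ρ` vertically of the given point of `A`, against the distance `ρ`.
      obtain ⟨x', y', hm', h3, h4, hy'⟩ := hact
      have h5 := hA _ hmem _ hm'
      have h6 := hz.length_lt i
      have h7 := abs_lt.1 (ht.trans_le (min_le_right τ η))
      have h8 := abs_lt.1 (hy.trans_le (min_le_right τ η))
      have h9 := abs_lt.1 hy'
      refine absurd h5 (not_le.2 ?_)
      rw [Prod.norm_def, max_lt_iff]
      simp only [Prod.fst_sub, Prod.snd_sub, norm_eq_abs, abs_lt]
      refine ⟨⟨by linarith, by linarith⟩, ⟨by linarith, by linarith⟩⟩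
    · rw [hQd, cellShear_of_not_active hact]

end Cells

/-! ### Patching in `y`, and the distance from the tube to the continuum -/

section Patching

open Filter Real

/-- The cosine is decreasing in the distance to `c` modulo one, so its superlevel set is a periodic
family of short intervals. -/
theorem exists_periodic_bump (c : ℝ) {κ : ℝ} (hκ : 0 < κ) :
    ∃ φ : ℝ → ℝ, ContDiff ℝ 2 φ ∧ (∀ (y : ℝ) (n : ℤ), φ (y + n) = φ y) ∧ (∀ y, 0 ≤ φ y) ∧
      0 < φ c ∧ ∀ y, φ y ≠ 0 → ∃ n : ℤ, |y + n - c| < κ := by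
  set κ' := min κ (1 / 4) with hκ'
  have h0 : 0 < κ' := lt_min hκ (by norm_num)
  have h4 : κ' ≤ 1 / 4 := min_le_right _ _
  have hπ := Real.pi_pos
  refine ⟨fun y => smoothTransition (cos (2 * π * (y - c)) - cos (2 * π * κ')), ?_, ?_, ?_, ?_, ?_⟩
  · have h := Real.smoothTransition.contDiff (n := 2)
    have h2 : ContDiff ℝ 2 fun y => cos (2 * π * (y - c)) - cos (2 * π * κ') := by fun_prop
    exact h.comp h2
  · intro y n
    have : 2 * π * (y + n - c) = 2 * π * (y - c) + n * (2 * π) := by ring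
    simp only [this, Real.cos_add_int_mul_two_pi]
  · exact fun y => Real.smoothTransition.nonneg _
  · refine Real.smoothTransition.pos_of_pos ?_
    have h := Real.strictAntiOn_cos (a := 0) (b := 2 * π * κ') ⟨le_rfl, hπ.le⟩
      ⟨by positivity, by nlinarith⟩ (by positivity)
    rw [sub_self, mul_zero]
    linarith
  · intro y hy
    have hpos : 0 < cos (2 * π * (y - c)) - cos (2 * π * κ') := by
      by_contra h
      exact hy (Real.smoothTransition.zero_of_nonpos (not_lt.1 h))
    refine ⟨-round (y - c), lt_of_lt_of_le ?_ (min_le_left κ (1 / 4))⟩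
    push_cast
    have e : y + -(round (y - c) : ℝ) - c = y - c - round (y - c) := by ring
    rw [e]
    set u := y - c - round (y - c) with hu
    have hu2 : |u| ≤ 1 / 2 := abs_sub_round _
    have hc : cos (2 * π * (y - c)) = cos (2 * π * |u|) := by
      have h1 : 2 * π * |u| = |2 * π * u| := by
        rw [abs_mul, abs_of_pos (by positivity : (0 : ℝ) < 2 * π)]
      have h2 : 2 * π * (y - c) = 2 * π * u + (round (y - c) : ℤ) * (2 * π) := by
        rw [hu]; ring
      rw [h1, Real.cos_abs, h2, Real.cos_add_int_mul_two_pi]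
    rw [hc] at hpos
    by_contra h
    have h3 := Real.strictAntiOn_cos.antitoneOn (a := 2 * π * κ') (b := 2 * π * |u|)
      ⟨by positivity, by nlinarith⟩ ⟨by positivity, by nlinarith⟩
      (mul_le_mul_of_nonneg_left (not_lt.1 h) (by positivity))
    linarith

theorem exists_periodic_partition {κ : ℝ → ℝ} (hκ : ∀ c, 0 < κ c) :
    ∃ (s : Finset ℝ) (ψ : ℝ → ℝ → ℝ), (∀ c, ContDiff ℝ 2 (ψ c)) ∧
      (∀ (c y : ℝ) (n : ℤ), ψ c (y + n) = ψ c y) ∧ (∀ c y, 0 ≤ ψ c y) ∧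
      (∀ y, ∑ c ∈ s, ψ c y = 1) ∧ ∀ c y, ψ c y ≠ 0 → ∃ n : ℤ, |y + n - c| < κ c := by
  choose φ h1 h2 h3 h4 h5 using fun c => exists_periodic_bump c (hκ c)
  obtain ⟨s, -, hs⟩ := (isCompact_Icc (a := (0 : ℝ)) (b := 1)).elim_nhds_subcover
    (fun c => {y | 0 < φ c y}) fun c _ => (h1 c).continuous.continuousAt.eventually (lt_mem_nhds (h4 c))
  have hpos : ∀ y, 0 < ∑ c ∈ s, φ c y := by
    intro y
    have hy : Int.fract y ∈ Icc (0 : ℝ) 1 := ⟨Int.fract_nonneg y, (Int.fract_lt_one y).le⟩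
    obtain ⟨c, hc, hcy⟩ := mem_iUnion₂.1 (hs hy)
    have e : φ c (Int.fract y) = φ c y := by
      have := h2 c (Int.fract y) ⌊y⌋
      rw [Int.fract_add_floor] at this
      exact this.symm
    refine Finset.sum_pos' (fun c _ => h3 c y) ⟨c, hc, ?_⟩
    rw [← e]
    exact hcy
  refine ⟨s, fun c y => φ c y / ∑ c ∈ s, φ c y, ?_, ?_, ?_, ?_, ?_⟩
  · exact fun c => (h1 c).div (ContDiff.sum fun c _ => h1 c) fun y => (hpos y).ne'
  · intro c y n
    simp only [h2]
  · exact fun c y => div_nonneg (h3 c y) (hpos y).le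
  · intro y
    rw [← Finset.sum_div, div_self (hpos y).ne']
  · intro c y h
    exact h5 c y fun h0 => h (by simp only [h0, zero_div])

/-- A perturbation of the coordinate `x` near the Denjoy continuum that vanishes along `A`. -/
structure IsShear (A : Set (ℝ × ℝ)) (ε κ : ℝ) (P : ℝ × ℝ × ℝ → ℝ) : Prop where
  contDiff : ContDiff ℝ 2 P
  add_int : ∀ (t x y : ℝ) (m n : ℤ), P (t, x + m, y + n) = P (t, x, y)
  abs_le : ∀ t x y, |t| < κ → |P (t, x, y)| ≤ ε
  hasDerivAt_left : ∀ t x y, |t| < κ → ∃ d, HasDerivAt (fun x => P (t, x, y)) d x ∧ 0 ≤ 1 + d ∧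
    (¬ (t = 0 ∧ (x, y) ∈ denjoyPlane) → 0 < 1 + d)
  hasDerivAt_of_mem : ∀ x y, (x, y) ∈ denjoyPlane →
    HasDerivAt (fun x => P (0, x, y)) (-1) x ∧
      HasDerivAt (fun t => P (t, x, y)) (-fieldPlane (x, y)) 0
  eq_zero : ∀ t x y, |t| < κ → (x, y - t) ∈ A → P (t, x, y) = 0

/-- The weights depend on `y` only, so derivatives in `t` and `x` of the sum are convex
combinations, and each condition on a local shear is preserved. By compactness modulo integers
finitely many levels suffice, which gives a positive `κ`. -/
theorem exists_isShear {A : Set (ℝ × ℝ)} {ρ ε : ℝ} (hρ : 0 < ρ)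
    (hA : ∀ p ∈ A, ∀ q ∈ denjoyPlane, ρ ≤ ‖p - q‖)
    (hA' : ∀ (x y : ℝ) (n : ℤ), (x, y) ∈ A → (x, y + n) ∈ A) (hε : 0 < ε) :
    ∃ κ, 0 < κ ∧ ∃ P, IsShear A ε κ P := by
  choose κ hκ P hP using exists_isLocalShear hρ hA hε
  obtain ⟨s, ψ, hψ, hψn, hψ0, hψ1, hψκ⟩ := exists_periodic_partition hκ
  have hs : s.Nonempty := by
    by_contra h
    have := hψ1 0
    rw [Finset.not_nonempty_iff_eq_empty.1 h, Finset.sum_empty] at this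
    exact zero_ne_one this
  refine ⟨s.inf' hs κ, (Finset.lt_inf'_iff hs).2 fun c _ => hκ c,
    fun p => ∑ c ∈ s, ψ c p.2.2 * P c p, ?_, ?_, ?_, ?_, ?_, ?_⟩
  · refine ContDiff.sum fun c _ => ((hψ c).comp ?_).mul (hP c).contDiff
    fun_prop
  · intro t x y m n
    simp only [hψn, (hP _).add_int]
  · intro t x y ht
    calc |∑ c ∈ s, ψ c y * P c (t, x, y)| ≤ ∑ c ∈ s, |ψ c y * P c (t, x, y)| :=
          Finset.abs_sum_le_sum_abs _ _
      _ ≤ ∑ c ∈ s, ψ c y * ε := by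
          refine Finset.sum_le_sum fun c hc => ?_
          rw [abs_mul, abs_of_nonneg (hψ0 c y)]
          exact mul_le_mul_of_nonneg_left
            ((hP c).abs_le t x y (ht.trans_le (Finset.inf'_le κ hc))) (hψ0 c y)
      _ = ε := by rw [← Finset.sum_mul, hψ1, one_mul]
  · intro t x y ht
    have h : ∀ c, ∃ d, c ∈ s → HasDerivAt (fun x => P c (t, x, y)) d x ∧ 0 ≤ 1 + d ∧
        (¬ (t = 0 ∧ (x, y) ∈ denjoyPlane) → 0 < 1 + d) := fun c => by
      by_cases hc : c ∈ s
      · obtain ⟨d, hd⟩ := (hP c).hasDerivAt_left t x y (ht.trans_le (Finset.inf'_le κ hc))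
        exact ⟨d, fun _ => hd⟩
      · exact ⟨0, fun h => absurd h hc⟩
    choose d hd using h
    have e : 1 + ∑ c ∈ s, ψ c y * d c = ∑ c ∈ s, ψ c y * (1 + d c) := by
      simp only [mul_add, mul_one, Finset.sum_add_distrib, hψ1]
    refine ⟨∑ c ∈ s, ψ c y * d c, HasDerivAt.fun_sum fun c hc => (hd c hc).1.const_mul (ψ c y),
      ?_, fun hn => ?_⟩
    · rw [e]
      exact Finset.sum_nonneg fun c hc => mul_nonneg (hψ0 c y) (hd c hc).2.1
    · rw [e]
      obtain ⟨c, hc, hcy⟩ := Finset.exists_ne_zero_of_sum_ne_zero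
        (by rw [hψ1 y]; exact one_ne_zero : ∑ c ∈ s, ψ c y ≠ 0)
      exact Finset.sum_pos' (fun c hc => mul_nonneg (hψ0 c y) (hd c hc).2.1)
        ⟨c, hc, mul_pos (lt_of_le_of_ne (hψ0 c y) hcy.symm) ((hd c hc).2.2 hn)⟩
  · intro x y hmem
    have h : ∀ c, ψ c y ≠ 0 → HasDerivAt (fun x => P c (0, x, y)) (-1) x ∧
        HasDerivAt (fun t => P c (t, x, y)) (-fieldPlane (x, y)) 0 := by
      intro c hc
      obtain ⟨n, hn⟩ := hψκ c y hc
      have h1 := (hP c).hasDerivAt_of_mem x (y + n) hn (by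
        have := (denjoyPlane_add_int x y 0 n).2 hmem
        rwa [Int.cast_zero, add_zero] at this)
      have h2 : ∀ t x, P c (t, x, y + n) = P c (t, x, y) := fun t x => by
        have := (hP c).add_int t x y 0 n
        rwa [Int.cast_zero, add_zero] at this
      have h3 := fieldPlane_add_int x y 0 n
      rw [Int.cast_zero, add_zero] at h3
      simpa only [h2, h3] using h1
    constructor
    · have e : (-1 : ℝ) = ∑ c ∈ s, ψ c y * (-1) := by rw [← Finset.sum_mul, hψ1, one_mul]
      rw [e]
      refine HasDerivAt.fun_sum fun c _ => ?_
      by_cases hc : ψ c y = 0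
      · simpa only [hc, zero_mul] using hasDerivAt_const x (0 : ℝ)
      · exact (h c hc).1.const_mul (ψ c y)
    · have e : -fieldPlane (x, y) = ∑ c ∈ s, ψ c y * -fieldPlane (x, y) := by
        rw [← Finset.sum_mul, hψ1, one_mul]
      rw [e]
      refine HasDerivAt.fun_sum fun c _ => ?_
      by_cases hc : ψ c y = 0
      · simpa only [hc, zero_mul] using hasDerivAt_const (0 : ℝ) (0 : ℝ)
      · exact (h c hc).2.const_mul (ψ c y)
  · intro t x y ht hmem
    refine Finset.sum_eq_zero fun c hc => ?_
    by_cases hcy : ψ c y = 0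
    · rw [hcy, zero_mul]
    · obtain ⟨n, hn⟩ := hψκ c y hcy
      have h1 := (hP c).add_int t x y 0 n
      rw [Int.cast_zero, add_zero] at h1
      rw [← h1, (hP c).eq_zero t x (y + n) (ht.trans_le (Finset.inf'_le κ hc)) hn, mul_zero]
      rw [show y + n - t = y - t + n by ring]
      exact hA' _ _ _ hmem

theorem exists_cutoff {κ : ℝ} (hκ : 0 < κ) :
    ∃ χ : ℝ → ℝ, ContDiff ℝ 2 χ ∧ (∀ t, 0 ≤ χ t) ∧ (∀ t, χ t ≤ 1) ∧ (∀ t, κ ≤ |t| → χ t = 0) ∧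
      χ =ᶠ[𝓝 0] 1 := by
  let f : ContDiffBump (0 : ℝ) := ⟨κ / 2, κ, by linarith, by linarith⟩
  refine ⟨f, f.contDiff, fun t => f.nonneg, fun t => f.le_one, fun t ht => ?_, ?_⟩
  · refine f.zero_of_le_dist ?_
    rwa [Real.dist_eq, sub_zero]
  · exact f.eventuallyEq_one

theorem dist_coe_S1_le (a b : ℝ) : dist (a : S1) (b : S1) ≤ |a - b| := by
  rw [dist_eq_norm, ← QuotientAddGroup.mk_sub]
  have h : ‖((a - b : ℝ) : S1)‖ ≤ |a - b| := by
    rw [UnitAddCircle.norm_eq]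
    simpa using round_le (a - b) 0
  exact h

theorem exists_le_norm_sub {V : Set T2} (hV : Disjoint (closure V) denjoySet) :
    ∃ ρ > 0, ∀ p ∈ toT2 ⁻¹' V, ∀ q ∈ denjoyPlane, ρ ≤ ‖p - q‖ := by
  obtain ⟨r, hr, h⟩ := Metric.exists_pos_forall_lt_edist
    (isClosed_closure (s := V)).isCompact isClosed_denjoySet hV
  refine ⟨r, NNReal.coe_pos.2 hr, fun p hp q hq => ?_⟩
  have h1 := h _ (subset_closure hp) _ (toT2_mem_denjoySet.2 hq)
  rw [edist_nndist, ENNReal.coe_lt_coe] at h1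
  have h2 : (r : ℝ) < dist (toT2 p) (toT2 q) := by exact_mod_cast h1
  refine h2.le.trans ?_
  rw [Prod.dist_eq, Prod.norm_def]
  exact max_le_max (dist_coe_S1_le _ _) (dist_coe_S1_le _ _)

end Patching

/-! ### Assembly of the map `K` -/

theorem mainTheorem4 :
    ∃ (h : T2 → ℝ) (D : Set T2),
      -- the Denjoy vector field and its Denjoy continuum
      IsDenjoyContinuum h D ∧
      IsC1AlphaForAll h ∧
      (∀ x y : ℝ, toT2 (x, y) ∈ D → dx h x y = 0) ∧
      ContDiff ℝ 2 (fun p : ℝ × ℝ => ∫ ξ in (0 : ℝ)..p.1, (dx h ξ p.2) ^ 2) ∧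
      -- the puncture, its neighbourhood, the collar of the boundary, and the closeness
      ∀ (p₀ : T2), p₀ ∉ D → ∀ V ∈ 𝓝 p₀, Disjoint (closure V) D →
      ∀ δ : ℝ, 0 < δ → δ < 1 → ∀ ε : ℝ, 0 < ε →
        ∃ (K : Slab → S1) (L : ℝ × ℝ × ℝ → ℝ), IsC2Lift K L ∧
          (∀ x y : ℝ, toT2 (x, y) ∈ D → vField L 0 x y = (0, onPlane h (x, y), 1)) ∧
          (∀ t ∈ Icc (-1 : ℝ) 1, ∀ x y : ℝ, ¬ (t = 0 ∧ toT2 (x, y) ∈ D) →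
            0 < (vField L t x y).1) ∧
          (∀ q : Slab, dist (K q) (K0 q) < ε) ∧
          (∀ q ∈ tube V ∪ collar δ, K q = K0 q) := by
  refine ⟨denjoyField, denjoySet, isDenjoyContinuum_denjoySet, isC1AlphaForAll_denjoyField,
    fun x y h => ?_, ?_, fun p₀ _ V _ hV δ _ hδ1 ε hε => ?_⟩
  · rw [dx_denjoyField]
    exact fieldSlope_of_mem (toT2_mem_denjoySet.1 h)
  · simp only [dx_denjoyField]
    exact contDiff_integral_fieldSlope_sq
  obtain ⟨ρ, hρ, hA⟩ := exists_le_norm_sub hV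
  obtain ⟨κ, hκ, P, hP⟩ := exists_isShear hρ hA (fun x y n h => by
    have := toT2_add_int x y 0 n
    rw [Int.cast_zero, add_zero] at this
    rwa [mem_preimage, this]) (half_pos hε)
  -- The bound `κ` confines the perturbation to where `P` is controlled, and `1 - δ` keeps it off
  -- the collar. That `χ` is one near `0`, not only at `0`, leaves `∂ₜ` unchanged there.
  obtain ⟨χ, hχ, hχ0, hχ1, hχκ, hχe⟩ := exists_cutoff (lt_min hκ (sub_pos.2 hδ1))
  have hχ00 : χ 0 = 1 := hχe.self_of_nhds
  set L : ℝ × ℝ × ℝ → ℝ := fun p => p.2.1 + χ p.1 * P p with hL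
  have hLint : ∀ (t x y : ℝ) (m n : ℤ), L (t, x + m, y + n) = L (t, x, y) + m := by
    intro t x y m n
    simp only [hL, hP.add_int]
    ring
  -- Any choice of representatives gives the same value on the circle, since `L` changes by an
  -- integer under the deck group.
  set K : Slab → S1 := fun q =>
    ((L ((q.1 : ℝ), Function.surjInv toT2_surjective q.2) : ℝ) : S1) with hK
  have hKL : ∀ (t : Icc (-1 : ℝ) 1) (x y : ℝ),
      K (t, toT2 (x, y)) = ((L ((t : ℝ), x, y) : ℝ) : S1) := by
    intro t x y
    obtain ⟨m, n, h1, h2⟩ := toT2_eq_iff.1 (Function.surjInv_eq toT2_surjective (toT2 (x, y)))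
    have e : Function.surjInv toT2_surjective (toT2 (x, y)) = (x + m, y + n) := Prod.ext h1 h2
    have := toT2_eq_iff (p := (L (t, x, y) + m, 0)) (q := (L (t, x, y), 0))
    simp only [hK, e, hLint]
    exact congrArg Prod.fst (this.2 ⟨m, 0, rfl, by simp⟩)
  have hχP : ∀ t x y, |χ t * P (t, x, y)| ≤ ε / 2 := by
    intro t x y
    rcases le_or_gt (min κ (1 - δ)) |t| with h | h
    · rw [hχκ t h, zero_mul, abs_zero]
      exact (half_pos hε).le
    · rw [abs_mul, abs_of_nonneg (hχ0 t)]
      exact (mul_le_of_le_one_left (abs_nonneg _) (hχ1 t)).trans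
        (hP.abs_le t x y (h.trans_le (min_le_left _ _)))
  refine ⟨K, L, ⟨?_, hKL⟩, ?_, ?_, ?_, ?_⟩
  · refine ContDiff.contDiffOn ?_
    have h1 := hP.contDiff
    have h2 : ContDiff ℝ 2 fun p : ℝ × ℝ × ℝ => χ p.1 := hχ.comp contDiff_fst
    fun_prop
  · intro x y hmem
    obtain ⟨h1, h2⟩ := hP.hasDerivAt_of_mem x y (toT2_mem_denjoySet.1 hmem)
    rw [vField, onPlane_denjoyField]
    have h3 : HasDerivAt (fun ξ => L (0, ξ, y)) 0 x := by
      refine ((hasDerivAt_id' x).add (h1.const_mul (χ 0))).congr_deriv ?_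
      rw [hχ00]
      norm_num
    have h4 : HasDerivAt (fun τ => L (τ, x, y)) (-fieldPlane (x, y)) 0 := by
      refine HasDerivAt.congr_of_eventuallyEq (h2.const_add x) ?_
      filter_upwards [hχe] with τ hτ
      simp only [hL, hτ, Pi.one_apply, one_mul]
    rw [h3.deriv, h4.hasDerivWithinAt.derivWithin
      ((uniqueDiffOn_Icc (by norm_num)) 0 ⟨by norm_num, by norm_num⟩), neg_neg]
  · intro t _ x y hn
    rw [toT2_mem_denjoySet] at hn
    change 0 < deriv (fun ξ => ξ + χ t * P (t, ξ, y)) x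
    rcases le_or_gt (min κ (1 - δ)) |t| with h | h
    · simp only [hχκ t h, zero_mul, add_zero, deriv_id'']
      exact one_pos
    · obtain ⟨d, hd, -, hd1⟩ := hP.hasDerivAt_left t x y (h.trans_le (min_le_left _ _))
      rw [((hasDerivAt_id' x).fun_add (hd.const_mul (χ t))).deriv]
      have h1 := hd1 hn
      -- The derivative is the convex combination `(1 - χ t) + χ t * (1 + d)`.
      rcases (hχ1 t).eq_or_lt with h2 | h2
      · rw [h2]; linarith
      · have := mul_nonneg (hχ0 t) h1.le
        linarith
  · rintro ⟨t, p⟩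
    obtain ⟨⟨x, y⟩, rfl⟩ := toT2_surjective p
    rw [hKL]
    refine (dist_coe_S1_le _ x).trans_lt ?_
    have h1 := hχP t x y
    have e : L (t, x, y) - x = χ t * P (t, x, y) := by simp only [hL]; ring
    rw [e]
    linarith
  · rintro ⟨t, p⟩ hq
    obtain ⟨⟨x, y⟩, rfl⟩ := toT2_surjective p
    rw [hKL]
    suffices h : χ t * P (t, x, y) = 0 by
      change ((L (t, x, y) : ℝ) : S1) = (x : S1)
      simp only [hL, h, add_zero]
    rcases le_or_gt (min κ (1 - δ)) |(t : ℝ)| with h | h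
    · rw [hχκ t h, zero_mul]
    · rcases hq with ⟨⟨a, b⟩, hab, h1⟩ | h1
      · rw [hP.eq_zero t x y (h.trans_le (min_le_left _ _)), mul_zero]
        rw [toT2, Prod.mk.injEq] at h1
        have e : toT2 (x, y - t) = (a, b) := by
          refine Prod.ext h1.1 ?_
          change ((y - t : ℝ) : S1) = b
          rw [QuotientAddGroup.mk_sub]
          exact sub_eq_of_eq_add h1.2
        rwa [mem_preimage, e]
      · exact absurd (h.trans_le (min_le_right _ _)) (not_lt.2 (le_of_lt h1))
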